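/- Let $(\mathcal Y,\mathfrak Y)$ be a measurable space, let $\mathcal P(\mathcal Y)$ be the set of probability measures on it, and let $\alpha\in(0,\infty]$. Definitions. For $W,Q\in\mathcal P(\mathcal Y)$ and any $\sigma$-finite $\nu$ with $W,Q\ll\nu$, let $D_\alpha(W\|Q)$ be the order $\alpha$ Rényi divergence: $D_\alpha(W\|Q)=\frac{1}{\alpha-1}\ln\int(\frac{dW}{d\nu})^{\alpha}(\frac{dQ}{d\nu})^{1-\alpha}\,d\nu$ if $\alpha\in(0,\infty)\setminus\{1\}$, $D_1(W\|Q)=\int\frac{dW}{d\nu}\ln\frac{dW/d\nu}{dQ/d\nu}\,d\nu$ (the Kullback–Leibler divergence), and $D_\infty(W\|Q)=\ln\operatorname{ess\,sup}_\nu\frac{dW/d\nu}{dQ/d\nu}$. For $\mathcal W\subset\mathcal P(\mathcal Y)$, a prior on $\mathcal W$ is a probability mass function $P$ on $\mathcal W$ with finite support. Its mixture is $\mu_{1,P}=\sum_W P(W)W$, its posterior is $P_1(W|y)=P(W)\frac{dW}{d\mu_{1,P}}(y)$, and its mean measure $\mu_{\alpha,P}$ has $\mu_{1,P}$-density $\big(\sum_W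 P(W)(\frac{dW}{d\mu_{1,P}})^\alpha\big)^{1/\alpha}$ for $\alpha<\infty$ and $\max_{W:P(W)>0}\frac{dW}{d\mu_{1,P}}$ for $\alpha=\infty$. The order $\alpha$ Rényi information is $I_\alpha(P;\mathcal W)=\frac{\alpha}{\alpha-1}\ln\mu_{\alpha,P}(\mathcal Y)$ for $\alpha\in(0,\infty)\setminus\{1\}$, $I_1(P;\mathcal W)=\int\sum_W P_1(W|y)\ln\frac{P_1(W|y)}{P(W)}\,\mu_{1,P}(dy)$, and $I_\infty(P;\mathcal W)=\ln\mu_{\infty,P}(\mathcal Y)$. The order $\alpha$ Rényi capacity is $C_\alpha(\mathcal W)=\sup_P I_\alpha(P;\mathcal W)$, the supremum being over all priors $P$ on $\mathcal W$. The order $\alpha$ Rényi radius of $\mathcal W$ relative to $Q$ is $S_\alpha(\mathcal W,Q)=\sup_{W\in\mathcal W}D_\alpha(W\|Q)$. If $C_\alpha(\mathcal W)<\infty$, an order $\alpha$ Rényi center of $\mathcal W$ is a $q\in\mathcal P(\mathcal Y)$ with $S_\alpha(\mathcal W,q)=C_\alpha(\mathcal W)$. Lemma. Let $\mathcal T$ be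 a non-empty set and let $\mathcal W=\bigcup_{i\in\mathcal T}\mathcal W_i$, where each $\mathcal W_i\subset\mathcal P(\mathcal Y)$ is non-empty and $C_\alpha(\mathcal W_i)<\infty$. Then $$\sup_{i\in\mathcal T}C_\alpha(\mathcal W_i)\le C_\alpha(\mathcal W)\le\ln\sum_{i\in\mathcal T}e^{C_\alpha(\mathcal W_i)} .$$ Each $\mathcal W_i$ has a unique order $\alpha$ Rényi center $q_{\alpha,\mathcal W_i}$. Furthermore: 1. For each $i$, $C_\alpha(\mathcal W_i)=C_\alpha(\mathcal W)$ if and only if $S_\alpha(\mathcal W,q_{\alpha,\mathcal W_i})\le C_\alpha(\mathcal W_i)$. 2. For each $i$, if $C_\alpha(\mathcal W_i)=C_\alpha(\mathcal W)$, then $\mathcal W$ has a unique order $\alpha$ Rényi center $q_{\alpha,\mathcal W}$, and $q_{\alpha,\mathcal W}=q_{\alpha,\mathcal W_i}$. 3. $C_\alpha(\mathcal W)=\ln\sum_{i\in\mathcal T}e^{C_\alpha(\mathcal W_i)}$ and $C_\alpha(\mathcal W)<\infty$ if and only if $\mathcal T$ is finite and $q_{\alpha,\mathcal W_i}\perp q_{\alpha,\mathcal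 W_j}$ for all $i\ne j$ in $\mathcal T$. 4. If $\mathcal T$ is finite and $q_{\alpha,\mathcal W_i}\perp q_{\alpha,\mathcal W_j}$ for all $i\ne j$ in $\mathcal T$, then $\mathcal W$ has a unique order $\alpha$ Rényi center and $$q_{\alpha,\mathcal W}=\Big(\sum_{j\in\mathcal T}e^{C_\alpha(\mathcal W_j)}\Big)^{-1}\sum_{i\in\mathcal T}e^{C_\alpha(\mathcal W_i)}\,q_{\alpha,\mathcal W_i}.$$ -/

import Mathlib

open MeasureTheory
open scoped ENNReal NNReal

noncomputable section

variable {Y : Type*} [MeasurableSpace Y]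

/-- The Rényi divergence of order `α ∈ [0, ∞]` between probability measures, with values in
`[-∞, ∞]`. The densities are taken with respect to the reference measure `W + Q`, which dominates
both; the value does not depend on this choice. At order one it is the Kullback-Leibler
divergence. -/
def renyiDiv (α : ℝ≥0∞) (W Q : ProbabilityMeasure Y) : EReal :=
  let ρ : Measure Y := (W : Measure Y) + (Q : Measure Y)
  let w : Y → ℝ≥0∞ := (W : Measure Y).rnDeriv ρ
  let q : Y → ℝ≥0∞ := (Q : Measure Y).rnDeriv ρ
  if α = 0 then - ENNReal.log ((Q : Measure Y) {y | 0 < w y})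
  else if α = 1 then (InformationTheory.klDiv (W : Measure Y) (Q : Measure Y) : EReal)
  else if α = ∞ then ENNReal.log (essSup (fun y => w y / q y) ρ)
  else ((1 / (α.toReal - 1) : ℝ) : EReal) *
    ENNReal.log (∫⁻ y, w y ^ α.toReal * q y ^ (1 - α.toReal) ∂ρ)

/-- The Rényi radius of order `α` of the set `𝒲` relative to `Q`. -/
def renyiRelRadius (α : ℝ≥0∞) (𝒲 : Set (ProbabilityMeasure Y)) (Q : ProbabilityMeasure Y) :
    EReal :=
  ⨆ W ∈ 𝒲, renyiDiv α W Q

/-- The priors on `𝒲`: probability mass functions with finite support contained in `𝒲`. -/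
def priors (𝒲 : Set (ProbabilityMeasure Y)) : Set (ProbabilityMeasure Y →₀ ℝ≥0) :=
  {P | (∀ W ∈ P.support, W ∈ 𝒲) ∧ ∑ W ∈ P.support, P W = 1}

/-- The mixture `∑ P(W) W` of a prior; it is the reference measure for the densities below, and
it is also the mean measure of order one. -/
def priorMixture (P : ProbabilityMeasure Y →₀ ℝ≥0) : Measure Y :=
  ∑ W ∈ P.support, P W • (W : Measure Y)

/-- The density `dW/dμ₁`, where `μ₁` is the mixture of the prior `P`. -/
def mixtureDensity (P : ProbabilityMeasure Y →₀ ℝ≥0) (W : ProbabilityMeasure Y) (y : Y) : ℝ≥0∞ :=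
  (W : Measure Y).rnDeriv (priorMixture P) y

/-- The order `α` weighted power mean of the densities, for the prior `P`. -/
def meanDensity (α : ℝ≥0∞) (P : ProbabilityMeasure Y →₀ ℝ≥0) (y : Y) : ℝ≥0∞ :=
  if α = 0 then ∏ W ∈ P.support, mixtureDensity P W y ^ (P W : ℝ)
  else if α = ∞ then P.support.sup fun W => mixtureDensity P W y
  else (∑ W ∈ P.support, (P W : ℝ≥0∞) * mixtureDensity P W y ^ α.toReal) ^ (1 / α.toReal)

/-- The order `α` mean measure for the prior `P`. -/
def meanMeasure (α : ℝ≥0∞) (P : ProbabilityMeasure Y →₀ ℝ≥0) : Measure Y :=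
  (priorMixture P).withDensity (meanDensity α P)

/-- The (order one) posterior probability of `W` given `y`, for the prior `P`. -/
def posterior (P : ProbabilityMeasure Y →₀ ℝ≥0) (W : ProbabilityMeasure Y) (y : Y) : ℝ :=
  P W * (mixtureDensity P W y).toReal

open scoped Classical in
/-- The Rényi information of order `α ∈ [0, ∞]` for the prior `P`. The total variation norm of
the mean measure is its total mass. -/
def renyiInfo (α : ℝ≥0∞) (P : ProbabilityMeasure Y →₀ ℝ≥0) : EReal :=
  if α = 0 then
    essInf (fun y => ENNReal.log
      (1 / ∑ W ∈ P.support, if 0 < posterior P W y then (P W : ℝ≥0∞) else 0)) (priorMixture P)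
  else if α = 1 then
    ((∫ y, ∑ W ∈ P.support, posterior P W y * Real.log (posterior P W y / P W)
      ∂(priorMixture P) : ℝ) : EReal)
  else if α = ∞ then ENNReal.log (meanMeasure ∞ P Set.univ)
  else ((α.toReal / (α.toReal - 1) : ℝ) : EReal) * ENNReal.log (meanMeasure α P Set.univ)

/-- The Rényi capacity of order `α` of the set `𝒲` (equal to `⊥` if and only if `𝒲 = ∅`). -/
def renyiCapacity (α : ℝ≥0∞) (𝒲 : Set (ProbabilityMeasure Y)) : EReal :=
  ⨆ P ∈ priors 𝒲, renyiInfo α P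

/-- `q` is an order `α` Rényi center of the set `𝒲` of finite capacity: the radius of `𝒲` relative
to `q` is the capacity of `𝒲`. -/
def IsRenyiCenter (α : ℝ≥0∞) (𝒲 : Set (ProbabilityMeasure Y)) (q : ProbabilityMeasure Y) : Prop :=
  renyiCapacity α 𝒲 < ⊤ ∧ renyiRelRadius α 𝒲 q = renyiCapacity α 𝒲

end

open MeasureTheory Filter
open scoped ENNReal NNReal Topology

noncomputable section

variable {Y : Type*} [MeasurableSpace Y]

/-! The Rényi divergence is an increasing function of a Hellinger-type divergence J. With β = α - 1
it equals (1/β) log (1 + β J); at order one J is the Kullback-Leibler divergence itself, and at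
order ∞ it is the essential supremum of the density ratio minus one, with β = 1
(`renyiDiv_eq_logGauge`). In terms of J, Sibson's identity is affine: for finite orders, Σ P(W) J(W,
Q) = K + (1 + β K) J(q_P, Q), where q_P is the normalised mean measure and K the linearised
information of P. At order ∞ the mean measure is the least upper bound of the members of the prior,
and inequalities of the same shape follow (`exists_sibson_family`).

Consequently nearly optimal priors have nearly equal q_P: compare two of them with their
half-and-half mixture. Along maximising priors q_P converges in total variation, and lower
semicontinuity of J passes two bounds to the limit q: D(W‖q) ≤ C for all W in the set, and C +
D(q‖Q) ≤ S(Q) for all Q (`exists_center_of_sibson`, `exists_renyiDiv_le_capacity`). As C ≤ S(Q)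
always holds, q is a center; the second bound makes it unique.

For the union, let ν dominate every e^{C_i} q_i, let N be its mass and Q = ν/N. Then Q ≥ (e^{C_i}/N)
q_i, so D(W‖Q) ≤ D(W‖q_i) + log N - C_i ≤ log N for W in the i-th set (`renyiRelRadius_iUnion_le`).
The sum of the e^{C_i} q_i gives the upper bound. If q_i and q_j are not singular, their common part
can be removed from that sum without losing domination, because e^{C_k} ≥ 1, and the bound is strict
(`renyiCapacity_iUnion_lt`). If the q_i are carried by disjoint sets A_i and Q is the center of the
union, then C_i + D(q_i‖Q) ≤ C and D(q_i‖Q) ≥ -log Q(A_i), so e^{C_i} ≤ e^C Q(A_i), and summation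
gives equality (`renyiCapacity_iUnion_of_mutuallySingular`). A finite sum of terms e^{C_i} ≥ 1
forces a finite index set. The lower bound and its equality case come from monotonicity and
uniqueness. -/

/-! ### Closeness in total variation, completeness, and convergence of densities -/

/-- The measure `μ` exceeds `μ'` by at most `ε` on every measurable set. -/
def TVle (μ μ' : Measure Y) (ε : ℝ≥0∞) : Prop :=
  ∀ A, MeasurableSet A → μ A ≤ μ' A + ε

lemma TVle.mono {μ μ' : Measure Y} {ε δ : ℝ≥0∞} (h : TVle μ μ' ε) (hεδ : ε ≤ δ) :
    TVle μ μ' δ := fun A hA => (h A hA).trans (by gcongr)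

lemma TVle.refl (μ : Measure Y) (ε : ℝ≥0∞) : TVle μ μ ε := fun _ _ => le_self_add

lemma TVle.trans {μ₁ μ₂ μ₃ : Measure Y} {ε δ : ℝ≥0∞} (h : TVle μ₁ μ₂ ε) (h' : TVle μ₂ μ₃ δ) :
    TVle μ₁ μ₃ (ε + δ) := fun A hA =>
  calc μ₁ A ≤ μ₂ A + ε := h A hA
    _ ≤ μ₃ A + δ + ε := by gcongr; exact h' A hA
    _ = μ₃ A + (ε + δ) := by ring

/-- Both total masses are one, so the bound on a complement is the reverse bound on the set. -/
lemma TVle.symm {μ μ' : Measure Y} [IsProbabilityMeasure μ] [IsProbabilityMeasure μ']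
    {ε : ℝ≥0∞} (h : TVle μ μ' ε) : TVle μ' μ ε := fun A hA => by
  have h1 := h Aᶜ hA.compl
  have h2 := prob_add_prob_compl (μ := μ) hA
  have h3 := prob_add_prob_compl (μ := μ') hA
  have h4 : μ' A + μ' Aᶜ ≤ μ A + ε + μ' Aᶜ := by
    rw [h3, ← h2, add_assoc, add_comm ε]
    gcongr
  exact (ENNReal.add_le_add_iff_right (measure_ne_top _ _)).1 h4

lemma eq_of_forall_TVle {μ μ' : Measure Y} [IsProbabilityMeasure μ] [IsProbabilityMeasure μ']
    (h : ∀ ε ≠ 0, TVle μ μ' ε) : μ = μ' := by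
  ext A hA
  refine le_antisymm ?_ ?_
  · exact ENNReal.le_of_forall_pos_le_add fun ε hε _ => h ε (by positivity) A hA
  · exact ENNReal.le_of_forall_pos_le_add fun ε hε _ => (h ε (by positivity)).symm A hA

/-- The set where `g < f` carries the whole truncated difference, so testing the bound on it
suffices. -/
lemma TVle.lintegral_sub_le {ν : Measure Y} {f g : Y → ℝ≥0∞} (hf : Measurable f)
    (hg : Measurable g) {ε : ℝ≥0∞} [IsFiniteMeasure (ν.withDensity g)]
    (h : TVle (ν.withDensity f) (ν.withDensity g) ε) : ∫⁻ y, f y - g y ∂ν ≤ ε := by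
  have hA : MeasurableSet {y | g y < f y} := measurableSet_lt hg hf
  have h1 := h _ hA
  rw [withDensity_apply _ hA, withDensity_apply _ hA] at h1
  have h2 : ∫⁻ y, f y - g y ∂ν = ∫⁻ y in {y | g y < f y}, (f y - g y) ∂ν := by
    rw [← lintegral_indicator hA]
    congr 1 with y
    by_cases hy : g y < f y
    · simp [Set.indicator, hy]
    · simp [Set.indicator, hy, tsub_eq_zero_of_le (not_lt.1 hy)]
  have h3 : ∫⁻ y in {y | g y < f y}, f y ∂ν =
      ∫⁻ y in {y | g y < f y}, g y ∂ν + ∫⁻ y in {y | g y < f y}, (f y - g y) ∂ν := by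
    rw [← lintegral_add_left hg]
    exact setLIntegral_congr_fun hA fun y hy => (add_tsub_cancel_of_le (le_of_lt hy)).symm
  have h4 : ∫⁻ y in {y | g y < f y}, g y ∂ν ≠ ∞ := by
    rw [← withDensity_apply _ hA]
    exact measure_ne_top _ _
  rw [h2]
  rw [h3] at h1
  exact (ENNReal.add_le_add_iff_left h4).1 h1

/-- A sequence of probability measures has a common finite dominating measure. -/
lemma exists_dominating (q : ℕ → ProbabilityMeasure Y) :
    ∃ ν : Measure Y, IsFiniteMeasure ν ∧ ∀ n, (q n : Measure Y) ≪ ν := by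
  refine ⟨(Measure.sum fun n => (q n : Measure Y)).toFinite, inferInstance, fun n => ?_⟩
  exact (Measure.absolutelyContinuous_sum_right n Measure.AbsolutelyContinuous.rfl).trans
    (absolutelyContinuous_toFinite _)

/-- Completeness of the space of probability measures in total variation, for sequences with
geometric rate. -/
theorem exists_TVle_limit (q : ℕ → ProbabilityMeasure Y)
    (h : ∀ n, TVle (q n : Measure Y) (q (n + 1) : Measure Y) (2⁻¹ ^ n)) :
    ∃ r : ProbabilityMeasure Y, ∀ n, TVle (q n : Measure Y) (r : Measure Y) (2 * 2⁻¹ ^ n) := by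
  obtain ⟨ν, hν, hq⟩ := exists_dominating q
  let f : ℕ → Y → ℝ≥0∞ := fun n => (q n : Measure Y).rnDeriv ν
  have hf : ∀ n, Measurable (f n) := fun n => Measure.measurable_rnDeriv _ _
  have hqf : ∀ n, ν.withDensity (f n) = q n := fun n => Measure.withDensity_rnDeriv_eq _ _ (hq n)
  -- The liminf serves as limit density without any prior convergence: `f n` exceeds it by at most
  -- the sum `r n` of the later downward jumps, and `r n` has integral at most `2 * 2⁻¹ ^ n`.
  let g : Y → ℝ≥0∞ := fun y => liminf (fun n => f n y) atTop
  have hg : Measurable g := Measurable.liminf hf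
  have hle : ∀ n, ∫⁻ y, f n y - f (n + 1) y ∂ν ≤ 2⁻¹ ^ n := fun n => by
    have : IsFiniteMeasure (ν.withDensity (f (n + 1))) := by rw [hqf]; infer_instance
    refine TVle.lintegral_sub_le (hf n) (hf _) ?_
    rw [hqf, hqf]
    exact h n
  let r : ℕ → Y → ℝ≥0∞ := fun n y => ∑' k, (f (n + k) y - f (n + k + 1) y)
  have hr : ∀ n, ∫⁻ y, r n y ∂ν ≤ 2 * 2⁻¹ ^ n := fun n => by
    have hm : ∀ k, AEMeasurable (fun y => f (n + k) y - f (n + k + 1) y) ν := fun k =>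
      ((hf _).sub (hf _)).aemeasurable
    rw [lintegral_tsum hm]
    calc ∑' k, ∫⁻ y, f (n + k) y - f (n + k + 1) y ∂ν ≤ ∑' k, 2⁻¹ ^ (n + k) :=
          ENNReal.tsum_le_tsum fun k => hle _
      _ = 2 * 2⁻¹ ^ n := by
          simp_rw [pow_add]
          rw [ENNReal.tsum_mul_left, ENNReal.tsum_geometric, ENNReal.one_sub_inv_two, inv_inv,
            mul_comm]
  have hfr : ∀ n y, f n y ≤ g y + r n y := fun n y => by
    have h1 : ∀ k, f n y ≤ f (n + k) y + ∑ i ∈ Finset.range k, (f (n + i) y - f (n + i + 1) y) := by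
      intro k
      induction k with
      | zero => simp
      | succ k ih =>
        rw [Finset.sum_range_succ]
        calc f n y ≤ f (n + k) y + ∑ i ∈ Finset.range k, (f (n + i) y - f (n + i + 1) y) := ih
          _ ≤ (f (n + k + 1) y + (f (n + k) y - f (n + k + 1) y)) +
              ∑ i ∈ Finset.range k, (f (n + i) y - f (n + i + 1) y) := by
            gcongr; exact le_add_tsub
          _ = _ := by rw [← add_assoc n k 1]; ring
    rw [← tsub_le_iff_right]
    refine le_liminf_of_le (by isBoundedDefault) ?_
    filter_upwards [eventually_ge_atTop n] with m hm
    obtain ⟨k, rfl⟩ := Nat.exists_eq_add_of_le hm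
    rw [tsub_le_iff_right]
    refine (h1 k).trans ?_
    gcongr
    exact ENNReal.sum_le_tsum _
  have hTV : ∀ n, TVle (q n : Measure Y) (ν.withDensity g) (2 * 2⁻¹ ^ n) := fun n A hA => by
    rw [← hqf, withDensity_apply _ hA, withDensity_apply _ hA]
    calc ∫⁻ y in A, f n y ∂ν ≤ ∫⁻ y in A, (g y + r n y) ∂ν := lintegral_mono fun y => hfr n y
      _ = ∫⁻ y in A, g y ∂ν + ∫⁻ y in A, r n y ∂ν := lintegral_add_left hg _
      _ ≤ _ := by gcongr; exact (setLIntegral_le_lintegral _ _).trans (hr n)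
  -- Fatou's lemma gives mass at most one; `hTV` on the whole space, as `n` grows, gives at least
  -- one.
  have hmass : (ν.withDensity g) Set.univ = 1 := by
    refine le_antisymm ?_ ?_
    · rw [withDensity_apply _ MeasurableSet.univ, setLIntegral_univ]
      refine (lintegral_liminf_le hf).trans ?_
      have : ∀ n, ∫⁻ y, f n y ∂ν = 1 := fun n => by
        rw [← setLIntegral_univ, ← withDensity_apply _ MeasurableSet.univ, hqf]
        simp
      simp [this]
    · have h0 : Tendsto (fun n : ℕ => (ν.withDensity g) Set.univ + 2 * (2⁻¹ : ℝ≥0∞) ^ n) atTop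
          (𝓝 ((ν.withDensity g) Set.univ + 2 * 0)) := by
        refine tendsto_const_nhds.add (ENNReal.Tendsto.const_mul ?_ (by simp))
        exact ENNReal.tendsto_pow_atTop_nhds_zero_of_lt_one (by simp)
      have := ge_of_tendsto' h0 (b := 1) fun n => by simpa using hTV n _ MeasurableSet.univ
      simpa using this
  exact ⟨⟨ν.withDensity g, ⟨hmass⟩⟩, hTV⟩

/-- Convergence in total variation at a summable rate yields almost everywhere convergence of the
densities. -/
theorem ae_tendsto_of_TVle {ν : Measure Y} {q : ℕ → Measure Y} {r : Measure Y}
    [∀ n, IsProbabilityMeasure (q n)] [IsProbabilityMeasure r] {ε : ℕ → ℝ≥0∞}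
    (hε : ∑' n, ε n ≠ ∞) (h : ∀ n, TVle (q n) r (ε n)) {f : ℕ → Y → ℝ≥0∞} {g : Y → ℝ≥0∞}
    (hf : ∀ n, Measurable (f n)) (hg : Measurable g) (hqf : ∀ n, ν.withDensity (f n) = q n)
    (hrg : ν.withDensity g = r) : ∀ᵐ y ∂ν, Tendsto (fun n => f n y) atTop (𝓝 (g y)) := by
  have h1 : ∀ n, ∫⁻ y, f n y - g y ∂ν ≤ ε n := fun n => by
    have : IsFiniteMeasure (ν.withDensity g) := by rw [hrg]; infer_instance
    exact TVle.lintegral_sub_le (hf n) hg (by rw [hqf, hrg]; exact h n)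
  have h2 : ∀ n, ∫⁻ y, g y - f n y ∂ν ≤ ε n := fun n => by
    have : IsFiniteMeasure (ν.withDensity (f n)) := by rw [hqf]; infer_instance
    exact TVle.lintegral_sub_le hg (hf n) (by rw [hqf, hrg]; exact (h n).symm)
  have hm : ∀ n, Measurable fun y => (f n y - g y) + (g y - f n y) := fun n =>
    ((hf n).sub hg).add (hg.sub (hf n))
  -- The L¹ distances are summable, so the pointwise distances form an almost everywhere convergent
  -- series and tend to zero.
  have h3 : ∫⁻ y, ∑' n, ((f n y - g y) + (g y - f n y)) ∂ν ≠ ∞ := by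
    rw [lintegral_tsum fun n => (hm n).aemeasurable]
    refine ne_top_of_le_ne_top (b := ∑' n, (ε n + ε n)) ?_ ?_
    · rw [ENNReal.tsum_add]
      exact ENNReal.add_ne_top.2 ⟨hε, hε⟩
    · refine ENNReal.tsum_le_tsum fun n => ?_
      have hs : Measurable fun y => f n y - g y := (hf n).sub hg
      rw [lintegral_add_left hs]
      exact add_le_add (h1 n) (h2 n)
  have h4 := ae_lt_top (Measurable.tsum hm) h3
  have h5 : ∀ᵐ y ∂ν, g y < ∞ := by
    refine ae_lt_top hg ?_
    rw [← setLIntegral_univ, ← withDensity_apply _ MeasurableSet.univ, hrg]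
    exact measure_ne_top _ _
  filter_upwards [h4, h5] with y hy hgy
  have h6 := ENNReal.tendsto_atTop_zero_of_tsum_ne_top hy.ne
  rw [ENNReal.tendsto_nhds hgy.ne]
  intro δ hδ
  filter_upwards [(ENNReal.tendsto_nhds_zero.1 h6) δ hδ] with n hn
  refine ⟨?_, ?_⟩
  · rw [tsub_le_iff_right, ← tsub_le_iff_left]
    exact le_add_self.trans hn
  · rw [← tsub_le_iff_left]
    exact le_self_add.trans hn

/-! ### Abstract existence of centers from a linearised Sibson inequality -/

lemma exists_le_add_of_iSup_ne_top {ι : Type*} [Nonempty ι] {K : ι → ℝ≥0∞} (hK : ⨆ i, K i ≠ ∞)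
    {η : ℝ≥0∞} (hη : η ≠ 0) : ∃ i, ⨆ j, K j ≤ K i + η := by
  by_cases h0 : ⨆ j, K j = 0
  · exact ⟨Classical.arbitrary ι, by simp [h0]⟩
  · obtain ⟨i, hi⟩ := lt_iSup_iff.1 (ENNReal.sub_lt_self hK h0 hη)
    exact ⟨i, tsub_le_iff_right.1 hi.le⟩

/-- If the informations of two members of a family closed under mixtures are close to the
supremum, then their mean measures are close. -/
lemma TVle_of_near_optimal {ι : Type*} {J : ProbabilityMeasure Y → ProbabilityMeasure Y → ℝ≥0∞}
    (hJ : ∀ ε ≠ 0, ∃ δ ≠ 0, ∀ W Q, J W Q ≤ δ → TVle (W : Measure Y) (Q : Measure Y) ε)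
    {K : ι → ℝ≥0∞} (hK : ⨆ i, K i ≠ ∞) {F : ι → ℝ≥0∞} {F₀ : ℝ≥0∞} (hF₀ : F₀ ≠ 0) (hF₀' : F₀ ≠ ∞)
    (hF : ∀ i, F₀ ≤ F i) {q : ι → ProbabilityMeasure Y}
    (hmix : ∀ i j, ∀ s t : ℝ≥0∞, s + t = 1 → s ≠ 0 → t ≠ 0 → ∃ k,
      s * (K i + F i * J (q i) (q k)) + t * (K j + F j * J (q j) (q k)) ≤ K k)
    {ε : ℝ≥0∞} (hε : ε ≠ 0) : ∃ δ ≠ 0, ∀ i j, ⨆ i, K i ≤ K i + δ → ⨆ i, K i ≤ K j + δ →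
      TVle (q i : Measure Y) (q j : Measure Y) ε := by
  obtain ⟨δ, hδ, h⟩ := hJ (ε / 2) (by simp [hε])
  refine ⟨F₀ * δ / 2, by simp [hF₀, hδ], fun i j hi hj => ?_⟩
  -- The even mixture `k` cannot beat the supremum, so the divergences of both `q i` and `q j` from
  -- `q k` are paid for by the slack of `i` and `j`; the lower bound `F₀` on the slopes turns this
  -- into a bound on `J`.
  obtain ⟨k, hk⟩ := hmix i j 2⁻¹ 2⁻¹ (ENNReal.inv_two_add_inv_two) (by simp) (by simp)
  set κ := ⨆ i, K i with hκ
  have hKκ : ∀ i, K i ≤ κ := fun i => le_iSup K i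
  have h1 : (K i + F i * J (q i) (q k)) + (K j + F j * J (q j) (q k)) ≤ κ + κ := by
    rw [← mul_add] at hk
    have := mul_le_mul_right (hk.trans (hKκ k)) 2
    rwa [← mul_assoc, ENNReal.mul_inv_cancel (by simp) (by simp), one_mul, two_mul] at this
  have h2 : (K i + K j) + (F i * J (q i) (q k) + F j * J (q j) (q k)) ≤ (K i + K j) + F₀ * δ :=
    calc _ = (K i + F i * J (q i) (q k)) + (K j + F j * J (q j) (q k)) := by ring
      _ ≤ κ + κ := h1
      _ ≤ (K i + F₀ * δ / 2) + (K j + F₀ * δ / 2) := add_le_add hi hj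
      _ = (K i + K j) + (F₀ * δ / 2 + F₀ * δ / 2) := by ring
      _ = _ := by rw [ENNReal.add_halves]
  have h3 := (ENNReal.add_le_add_iff_left (ENNReal.add_ne_top.2
    ⟨ne_top_of_le_ne_top hK (hKκ i), ne_top_of_le_ne_top hK (hKκ j)⟩)).1 h2
  have h4 : ∀ l, F l * J (q l) (q k) ≤ F₀ * δ → J (q l) (q k) ≤ δ := fun l hl =>
    (ENNReal.mul_le_mul_iff_right hF₀ hF₀').1 ((mul_le_mul_left (hF l) _).trans hl)
  have h5 := h _ _ (h4 i (le_self_add.trans h3))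
  have h6 := h _ _ (h4 j (le_add_self.trans h3))
  simpa [ENNReal.add_halves] using h5.trans h6.symm

/-- In a family closed under mixtures that contains the point mass at `W`, there is a nearly
optimal member whose mean measure is nearly as close to `W` as the supremum. -/
lemma exists_near_optimal_of_point {ι : Type*} [Nonempty ι]
    {J : ProbabilityMeasure Y → ProbabilityMeasure Y → ℝ≥0∞}
    {K : ι → ℝ≥0∞} (hK : ⨆ i, K i ≠ ∞) {F : ι → ℝ≥0∞} {q : ι → ProbabilityMeasure Y}
    (hmix : ∀ i j, ∀ s t : ℝ≥0∞, s + t = 1 → s ≠ 0 → t ≠ 0 → ∃ k,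
      s * (K i + F i * J (q i) (q k)) + t * (K j + F j * J (q j) (q k)) ≤ K k)
    {j : ι} (hj : F j = 1) {η : ℝ≥0∞} (hη : η ≠ 0) :
    ∃ k, ⨆ i, K i ≤ K k + η ∧ J (q j) (q k) ≤ (⨆ i, K i) + η := by
  set κ := ⨆ i, K i with hκ
  have hKκ : ∀ i, K i ≤ κ := fun i => le_iSup K i
  have hκ1 : κ + 1 ≠ ∞ := by simp [hK]
  -- The weight `t` of the point mass is small enough that `t * κ ≤ η / 2`, and at most one half so
  -- that `1 - t` is nonzero. The index `i` below is optimal up to `t * (η / 2)`, so that dividing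
  -- by `t` leaves an error of only `η / 2`.
  let t : ℝ≥0∞ := min 2⁻¹ (η / 2 / (κ + 1))
  have ht0 : t ≠ 0 := by
    have : 0 < t := lt_min (by simp) (ENNReal.div_pos (by simp [hη]) hκ1)
    exact this.ne'
  have ht1 : t ≤ 2⁻¹ := min_le_left _ _
  have ht2 : t ≤ 1 := ht1.trans (by simp)
  have htt : t ≠ ∞ := ne_top_of_le_ne_top (by simp) ht2
  have htκ : t * κ ≤ η / 2 := calc
    t * κ ≤ (η / 2 / (κ + 1)) * (κ + 1) := mul_le_mul' (min_le_right _ _) le_self_add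
    _ = η / 2 := ENNReal.div_mul_cancel (by simp) hκ1
  have hst : (1 - t) + t = 1 := tsub_add_cancel_of_le ht2
  have hs0 : 1 - t ≠ 0 := by
    have : t < 1 := ht1.trans_lt (by simp)
    exact (tsub_pos_of_lt this).ne'
  obtain ⟨i, hi⟩ := exists_le_add_of_iSup_ne_top hK (η := t * (η / 2)) (by simp [ht0, hη])
  obtain ⟨k, hk⟩ := hmix i j (1 - t) t hst hs0 ht0
  have h1 : (1 - t) * K i + t * J (q j) (q k) ≤ K k := by
    refine le_trans ?_ hk
    rw [hj, one_mul]
    gcongr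
    · exact le_self_add
    · exact le_add_self
  have h2 : κ ≤ (1 - t) * K i + (t * (η / 2) + t * κ) := calc
    κ = (1 - t) * κ + t * κ := by rw [← add_mul, hst, one_mul]
    _ ≤ (1 - t) * (K i + t * (η / 2)) + t * κ := by gcongr
    _ ≤ (1 - t) * K i + 1 * (t * (η / 2)) + t * κ := by
      rw [mul_add]; gcongr; exact tsub_le_self
    _ = _ := by ring
  refine ⟨k, ?_, ?_⟩
  · calc κ ≤ (1 - t) * K i + (t * (η / 2) + t * κ) := h2
      _ ≤ K k + (1 * (η / 2) + η / 2) := by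
        gcongr
        exact le_self_add.trans h1
      _ = K k + η := by rw [one_mul, ENNReal.add_halves]
  · have h3 := (h1.trans (hKκ k)).trans h2
    have h4 : (1 - t) * K i ≠ ∞ :=
      ENNReal.mul_ne_top (by simp) (ne_top_of_le_ne_top hK (hKκ i))
    rw [ENNReal.add_le_add_iff_left h4, ← mul_add, ENNReal.mul_le_mul_iff_right ht0 htt] at h3
    calc _ ≤ η / 2 + κ := h3
      _ ≤ κ + η := by rw [add_comm]; gcongr; exact ENNReal.half_le_self

/-- The abstract existence theorem for centers: a family closed under mixtures which satisfies
Sibson's identity in linearised form has a center, and the bound of van Erven and Harremoës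
holds. -/
theorem exists_center_of_sibson {ι : Type*} [Nonempty ι] (𝒲 : Set (ProbabilityMeasure Y))
    {J : ProbabilityMeasure Y → ProbabilityMeasure Y → ℝ≥0∞}
    (hJ : ∀ ε ≠ 0, ∃ δ ≠ 0, ∀ W Q, J W Q ≤ δ → TVle (W : Measure Y) (Q : Measure Y) ε)
    (hlsc : ∀ (W Q : ℕ → ProbabilityMeasure Y) (W' Q' : ProbabilityMeasure Y) (ε : ℕ → ℝ≥0∞),
      ∑' n, ε n ≠ ∞ → (∀ n, TVle (W n : Measure Y) (W' : Measure Y) (ε n)) →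
      (∀ n, TVle (Q n : Measure Y) (Q' : Measure Y) (ε n)) →
      J W' Q' ≤ liminf (fun n => J (W n) (Q n)) atTop)
    {K : ι → ℝ≥0∞} (hK : ⨆ i, K i ≠ ∞) {φ : ℝ≥0∞ → ℝ≥0∞} (hφ : Continuous φ)
    {F₀ : ℝ≥0∞} (hF₀ : F₀ ≠ 0) (hF₀' : F₀ ≠ ∞)
    (hF : ∀ i, F₀ ≤ φ (K i)) (hφt : φ (⨆ i, K i) ≠ ∞) {q : ι → ProbabilityMeasure Y}
    (hmix : ∀ i j, ∀ s t : ℝ≥0∞, s + t = 1 → s ≠ 0 → t ≠ 0 → ∃ k,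
      s * (K i + φ (K i) * J (q i) (q k)) + t * (K j + φ (K j) * J (q j) (q k)) ≤ K k)
    (hpt : ∀ W ∈ 𝒲, ∃ i, q i = W ∧ φ (K i) = 1)
    (hsib : ∀ i Q, K i + φ (K i) * J (q i) Q ≤ ⨆ W ∈ 𝒲, J W Q) :
    ∃ r, (∀ W ∈ 𝒲, J W r ≤ ⨆ i, K i) ∧
      ∀ Q, (⨆ i, K i) + φ (⨆ i, K i) * J r Q ≤ ⨆ W ∈ 𝒲, J W Q := by
  set κ := ⨆ i, K i with hκ
  have hKκ : ∀ i, K i ≤ κ := fun i => le_iSup K i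
  have hpow0 : ∀ n : ℕ, (2⁻¹ : ℝ≥0∞) ^ n ≠ 0 := fun n => pow_ne_zero n (by simp)
  choose δ hδ0 hδ using fun n : ℕ => TVle_of_near_optimal hJ hK hF₀ hF₀' hF hmix (hpow0 n)
  -- The entry `δ (n - 1)` puts the consecutive choices `i n` and `i (n + 1)` both within `δ n` of
  -- the supremum; at `n = 0` the truncated subtraction merely repeats `δ 0`.
  let η : ℕ → ℝ≥0∞ := fun n => min (min (δ n) (δ (n - 1))) (2⁻¹ ^ n)
  have hη0 : ∀ n, η n ≠ 0 := fun n => (lt_min (lt_min (pos_iff_ne_zero.2 (hδ0 _))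
    (pos_iff_ne_zero.2 (hδ0 _))) (pos_iff_ne_zero.2 (hpow0 n))).ne'
  have hηδ : ∀ n, η n ≤ δ n := fun n => (min_le_left _ _).trans (min_le_left _ _)
  have hηδ' : ∀ n, η (n + 1) ≤ δ n := fun n => (min_le_left _ _).trans (min_le_right _ _)
  have hηp : ∀ n, η n ≤ 2⁻¹ ^ n := fun n => min_le_right _ _
  choose i hi using fun n => exists_le_add_of_iSup_ne_top hK (hη0 n)
  obtain ⟨r, hr⟩ := exists_TVle_limit (fun n => q (i n)) fun n =>
    hδ n _ _ ((hi n).trans (by gcongr; exact hηδ n)) ((hi (n + 1)).trans (by gcongr; exact hηδ' n))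
  -- Every nearly optimal index, not only the chosen `i n`, has its measure close to `r`; this
  -- allows approximating sequences that depend on the member `W`.
  have hlim : ∀ n k, κ ≤ K k + η n → TVle (q k : Measure Y) (r : Measure Y) (3 * 2⁻¹ ^ n) := by
    intro n k hk
    have h1 := hδ n k (i n) (hk.trans (by gcongr; exact hηδ n))
      ((hi n).trans (by gcongr; exact hηδ n))
    exact (h1.trans (hr n)).mono (le_of_eq (by ring))
  have hpow : Tendsto (fun n : ℕ => (2⁻¹ : ℝ≥0∞) ^ n) atTop (𝓝 0) :=
    ENNReal.tendsto_pow_atTop_nhds_zero_of_lt_one (by simp)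
  have hsum : ∑' n : ℕ, 3 * (2⁻¹ : ℝ≥0∞) ^ n ≠ ∞ := by
    rw [ENNReal.tsum_mul_left, ENNReal.tsum_geometric, ENNReal.one_sub_inv_two, inv_inv]
    exact ENNReal.mul_ne_top (by simp) (by simp)
  refine ⟨r, fun W hW => ?_, fun Q => ?_⟩
  · obtain ⟨j, rfl, hj⟩ := hpt W hW
    choose k hk hk' using fun n =>
      exists_near_optimal_of_point (F := fun i => φ (K i)) hK hmix hj (hη0 n)
    refine (hlsc (fun _ => q j) (fun n => q (k n)) (q j) r _ hsum (fun n => TVle.refl _ _)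
      fun n => hlim n _ (hk n)).trans ?_
    have hT : Tendsto (fun n : ℕ => κ + (2⁻¹ : ℝ≥0∞) ^ n) atTop (𝓝 (κ + 0)) :=
      tendsto_const_nhds.add hpow
    rw [add_zero] at hT
    rw [← hT.liminf_eq]
    refine liminf_le_liminf (Eventually.of_forall fun n => (hk' n).trans ?_)
    gcongr
    exact hηp n
  · have hl := hlsc (fun n => q (i n)) (fun _ => Q) r Q _ hsum (fun n => hlim n _ (hi n))
      fun n => TVle.refl _ _
    have hKt : Tendsto (fun n => K (i n)) atTop (𝓝 κ) := by
      have hT : Tendsto (fun n : ℕ => κ - (2⁻¹ : ℝ≥0∞) ^ n) atTop (𝓝 (κ - 0)) :=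
        ENNReal.Tendsto.sub tendsto_const_nhds hpow (Or.inl hK)
      rw [tsub_zero] at hT
      refine tendsto_of_tendsto_of_tendsto_of_le_of_le hT tendsto_const_nhds (fun n => ?_)
        fun n => hKκ _
      rw [tsub_le_iff_right]
      exact (hi n).trans (by gcongr; exact hηp n)
    set s := ⨆ W ∈ 𝒲, J W Q
    -- Since `J r Q` may be infinite, the bound is proved for each smaller `c` and then `c`
    -- increases to `J r Q`. When `J r Q = 0` there is no smaller `c`, hence the separate case
    -- below.
    have hc : ∀ c < J r Q, κ + φ κ * c ≤ s := by
      intro c hc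
      have hT : Tendsto (fun n => K (i n) + φ (K (i n)) * c) atTop (𝓝 (κ + φ κ * c)) :=
        hKt.add (ENNReal.Tendsto.mul_const ((hφ.tendsto κ).comp hKt) (Or.inr hc.ne_top))
      refine le_of_tendsto hT ?_
      filter_upwards [eventually_lt_of_lt_liminf (hc.trans_le hl)] with n hn
      exact le_trans (by gcongr) (hsib (i n) Q)
    have hcont : Tendsto (fun c => κ + φ κ * c) (𝓝[<] (J r Q)) (𝓝 (κ + φ κ * J r Q)) :=
      tendsto_const_nhds.add (ENNReal.Tendsto.const_mul
        (tendsto_id.mono_left nhdsWithin_le_nhds) (Or.inr hφt))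
    by_cases h0 : J r Q = 0
    · rw [h0, mul_zero, add_zero]
      exact le_of_tendsto' hKt fun n => le_self_add.trans (hsib (i n) Q)
    · have : (𝓝[<] (J r Q)).NeBot := nhdsLT_neBot_of_exists_lt ⟨0, pos_iff_ne_zero.2 h0⟩
      refine le_of_tendsto hcont ?_
      filter_upwards [self_mem_nhdsWithin] with c hc' using hc c hc'

/-! ### The integrand of the linearised divergence of finite order -/

/-- The weighted inequality between the geometric and the arithmetic mean. -/
lemma rpow_mul_rpow_le {a : ℝ} (ha : 0 < a) (ha1 : a < 1) {w q : ℝ≥0∞} (hw : w ≠ ∞) (hq : q ≠ ∞) :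
    w ^ a * q ^ (1 - a) ≤ ENNReal.ofReal a * w + ENNReal.ofReal (1 - a) * q := by
  lift w to ℝ≥0 using hw
  lift q to ℝ≥0 using hq
  have h := NNReal.geom_mean_le_arith_mean2_weighted a.toNNReal (1 - a).toNNReal w q (by
    rw [← Real.toNNReal_add ha.le (by linarith)]; simp)
  rw [Real.coe_toNNReal _ ha.le, Real.coe_toNNReal _ (by linarith : 0 ≤ 1 - a)] at h
  rw [← ENNReal.coe_rpow_of_nonneg _ ha.le, ← ENNReal.coe_rpow_of_nonneg _ (by linarith)]
  unfold ENNReal.ofReal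
  exact_mod_cast h

/-- Apply the mean inequality with exponent `a⁻¹` to `w ^ a * q ^ (1 - a)` and `q`, whose weighted
geometric mean is `w`, and multiply by `a`. -/
lemma le_rpow_mul_rpow_add {a : ℝ} (ha : 1 < a) {w q : ℝ≥0∞} (hw : w ≠ ∞) (hq : q ≠ ∞) :
    ENNReal.ofReal a * w ≤ w ^ a * q ^ (1 - a) + ENNReal.ofReal (a - 1) * q := by
  have ha0 : 0 < a := by linarith
  by_cases hq0 : q = 0
  · by_cases hw0 : w = 0
    · simp [hw0]
    · have : w ^ a * q ^ (1 - a) = ∞ := by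
        rw [hq0, ENNReal.zero_rpow_of_neg (by linarith), ENNReal.mul_top]
        simp [ENNReal.rpow_eq_zero_iff, hw0, ha0.not_gt]
      simp [this]
  · have h1 : w ^ a * q ^ (1 - a) ≠ ∞ := ENNReal.mul_ne_top
      (ENNReal.rpow_ne_top_of_nonneg ha0.le hw) (ENNReal.rpow_ne_top_of_ne_zero hq0 hq)
    have h2 := rpow_mul_rpow_le (a := a⁻¹) (by positivity) (inv_lt_one_of_one_lt₀ ha) h1 hq
    have h3 : (w ^ a * q ^ (1 - a)) ^ a⁻¹ * q ^ (1 - a⁻¹) = w := by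
      rw [ENNReal.mul_rpow_of_nonneg _ _ (by positivity), ← ENNReal.rpow_mul, ← ENNReal.rpow_mul,
        mul_assoc, ← ENNReal.rpow_add _ _ hq0 hq, mul_inv_cancel₀ ha0.ne']
      have : (1 - a) * a⁻¹ + (1 - a⁻¹) = 0 := by field_simp; ring
      simp [this]
    rw [h3] at h2
    calc ENNReal.ofReal a * w ≤ ENNReal.ofReal a * (ENNReal.ofReal a⁻¹ * (w ^ a * q ^ (1 - a)) +
          ENNReal.ofReal (1 - a⁻¹) * q) := by gcongr
      _ = w ^ a * q ^ (1 - a) + ENNReal.ofReal (a - 1) * q := by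
        have e1 : ENNReal.ofReal a * ENNReal.ofReal a⁻¹ = 1 := by
          rw [← ENNReal.ofReal_mul ha0.le, mul_inv_cancel₀ ha0.ne', ENNReal.ofReal_one]
        have e2 : ENNReal.ofReal a * ENNReal.ofReal (1 - a⁻¹) = ENNReal.ofReal (a - 1) := by
          rw [← ENNReal.ofReal_mul ha0.le, mul_sub, mul_inv_cancel₀ ha0.ne', mul_one]
        rw [mul_add, ← mul_assoc, e1, one_mul, ← mul_assoc, e2]

/-- The integrand of the linearised Rényi divergence of finite order `a`, as a function of the two
densities. -/
def jfun (a : ℝ) (w q : ℝ≥0∞) : ℝ≥0∞ :=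
  if a = 1 then
    if q = 0 then if w = 0 then 0 else ∞
    else ENNReal.ofReal (q.toReal * InformationTheory.klFun (w.toReal / q.toReal))
  else if 1 < a then
    (w ^ a * q ^ (1 - a) + ENNReal.ofReal (a - 1) * q - ENNReal.ofReal a * w) / ENNReal.ofReal (a - 1)
  else
    (ENNReal.ofReal a * w + ENNReal.ofReal (1 - a) * q - w ^ a * q ^ (1 - a)) / ENNReal.ofReal (1 - a)

lemma jfun_one (w q : ℝ≥0∞) : jfun 1 w q = if q = 0 then if w = 0 then 0 else ∞
    else ENNReal.ofReal (q.toReal * InformationTheory.klFun (w.toReal / q.toReal)) := if_pos rfl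

lemma jfun_of_one_lt {a : ℝ} (ha : 1 < a) (w q : ℝ≥0∞) : jfun a w q =
    (w ^ a * q ^ (1 - a) + ENNReal.ofReal (a - 1) * q - ENNReal.ofReal a * w) /
      ENNReal.ofReal (a - 1) := by rw [jfun, if_neg ha.ne', if_pos ha]

lemma jfun_of_lt_one {a : ℝ} (ha : a < 1) (w q : ℝ≥0∞) : jfun a w q =
    (ENNReal.ofReal a * w + ENNReal.ofReal (1 - a) * q - w ^ a * q ^ (1 - a)) /
      ENNReal.ofReal (1 - a) := by rw [jfun, if_neg ha.ne, if_neg ha.not_gt]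

attribute [irreducible] jfun

/-- By `le_rpow_mul_rpow_add` the truncated subtraction in `jfun` loses nothing. The additive form
can be integrated without subtracting infinite quantities. -/
lemma rpow_mul_rpow_add_of_one_lt {a : ℝ} (ha : 1 < a) {w q : ℝ≥0∞} (hw : w ≠ ∞) (hq : q ≠ ∞) :
    w ^ a * q ^ (1 - a) + ENNReal.ofReal (a - 1) * q =
      ENNReal.ofReal a * w + ENNReal.ofReal (a - 1) * jfun a w q := by
  rw [jfun_of_one_lt ha, ENNReal.mul_div_cancel (by simpa using ha) (by simp),
    add_tsub_cancel_of_le (le_rpow_mul_rpow_add ha hw hq)]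

lemma rpow_mul_rpow_add_of_lt_one {a : ℝ} (ha0 : 0 < a) (ha : a < 1) {w q : ℝ≥0∞} (hw : w ≠ ∞)
    (hq : q ≠ ∞) : w ^ a * q ^ (1 - a) + ENNReal.ofReal (1 - a) * jfun a w q =
      ENNReal.ofReal a * w + ENNReal.ofReal (1 - a) * q := by
  rw [jfun_of_lt_one ha, ENNReal.mul_div_cancel (by simpa using ha) (by simp),
    add_tsub_cancel_of_le (rpow_mul_rpow_le ha0 ha hw hq)]

/-- Homogeneity is what makes the integrals below independent of the dominating measure. The case `c
= 0` is separate because powers of `c` can be combined only when `c ≠ 0`. -/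
lemma rpow_mul_rpow_homogeneous {a : ℝ} (ha : 0 < a) {c : ℝ≥0∞} (hc : c ≠ ∞) (w : ℝ≥0∞)
    {q : ℝ≥0∞} (hq : q ≠ ∞) :
    (c * w) ^ a * (c * q) ^ (1 - a) = c * (w ^ a * q ^ (1 - a)) := by
  by_cases hc0 : c = 0
  · simp [hc0, ENNReal.zero_rpow_of_pos ha]
  · rw [ENNReal.mul_rpow_of_nonneg _ _ ha.le, ENNReal.mul_rpow_of_ne_top hc hq]
    calc _ = (c ^ a * c ^ (1 - a)) * (w ^ a * q ^ (1 - a)) := by ring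
      _ = _ := by rw [← ENNReal.rpow_add _ _ hc0 hc]; simp

lemma jfun_homogeneous {a : ℝ} (ha : 0 < a) {c : ℝ≥0∞} (hc : c ≠ ∞) (w : ℝ≥0∞)
    {q : ℝ≥0∞} (hq : q ≠ ∞) : jfun a (c * w) (c * q) = c * jfun a w q := by
  rcases lt_trichotomy a 1 with h | rfl | h
  · rw [jfun_of_lt_one h, jfun_of_lt_one h, rpow_mul_rpow_homogeneous ha hc w hq,
      ← mul_div_assoc, ENNReal.mul_sub fun _ _ => hc]
    congr 2
    ring
  · by_cases hc0 : c = 0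
    · simp [hc0, jfun_one]
    · by_cases hq0 : q = 0
      · by_cases hw0 : w = 0
        · simp [hq0, hw0, jfun_one]
        · simp [hq0, hw0, jfun_one, hc0]
      · have h1 : c.toReal ≠ 0 := ENNReal.toReal_ne_zero.2 ⟨hc0, hc⟩
        rw [jfun_one, jfun_one, if_neg (by simp [hc0, hq0]), if_neg hq0]
        rw [ENNReal.toReal_mul, ENNReal.toReal_mul, mul_div_mul_left _ _ h1, mul_assoc,
          ENNReal.ofReal_mul ENNReal.toReal_nonneg, ENNReal.ofReal_toReal hc]
  · rw [jfun_of_one_lt h, jfun_of_one_lt h, rpow_mul_rpow_homogeneous ha hc w hq,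
      ← mul_div_assoc, ENNReal.mul_sub fun _ _ => hc]
    congr 2 <;> ring

lemma measurable_jfun (a : ℝ) : Measurable fun p : ℝ≥0∞ × ℝ≥0∞ => jfun a p.1 p.2 := by
  rcases lt_trichotomy a 1 with h | rfl | h
  · simp_rw [jfun_of_lt_one h]
    fun_prop
  · simp_rw [jfun_one]
    refine Measurable.ite (measurable_snd (measurableSet_singleton 0)) ?_ ?_
    · exact Measurable.ite (measurable_fst (measurableSet_singleton 0)) measurable_const
        measurable_const
    · have := InformationTheory.measurable_klFun
      fun_prop
  · simp_rw [jfun_of_one_lt h]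
    fun_prop

/-- The tangent bound for the function `jfun 1`. -/
lemma mul_log_le_jfun_one {c : ℝ} (hc : 1 < c) {w q : ℝ≥0∞} (hw : w ≠ ∞) (hq : q ≠ ∞) :
    ENNReal.ofReal (Real.log c) * w ≤ ENNReal.ofReal (c - 1) * q + jfun 1 w q := by
  by_cases hq0 : q = 0
  · by_cases hw0 : w = 0
    · simp [hw0]
    · simp [hq0, hw0, jfun_one]
  · have hq1 : 0 < q.toReal := ENNReal.toReal_pos hq0 hq
    have hl : 0 ≤ Real.log c := Real.log_nonneg hc.le
    rw [jfun_one, if_neg hq0]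
    have hw1 := ENNReal.ofReal_toReal hw
    have hq2 := ENNReal.ofReal_toReal hq
    have h1 : ENNReal.ofReal (Real.log c) * w = ENNReal.ofReal (Real.log c * w.toReal) := by
      rw [ENNReal.ofReal_mul hl, hw1]
    have h2 : ENNReal.ofReal (c - 1) * q = ENNReal.ofReal ((c - 1) * q.toReal) := by
      rw [ENNReal.ofReal_mul (by linarith), hq2]
    rw [h1, h2, ← ENNReal.ofReal_add (by nlinarith) (mul_nonneg hq1.le
        (InformationTheory.klFun_nonneg (by positivity)))]
    refine ENNReal.ofReal_le_ofReal ?_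
    set x := w.toReal / q.toReal with hx
    have hx0 : 0 ≤ x := by positivity
    have hwx : w.toReal = q.toReal * x := by rw [hx]; field_simp
    rw [hwx, InformationTheory.klFun]
    have key : x * Real.log c ≤ (c - 1) + (x * Real.log x + 1 - x) := by
      rcases hx0.eq_or_lt with h0 | h0
      · rw [← h0]; simp; linarith
      · have := Real.log_le_sub_one_of_pos (x := c / x) (by positivity)
        rw [Real.log_div (by positivity) (by positivity)] at this
        have h2 := mul_le_mul_of_nonneg_left this h0.le
        have h3 : x * (c / x - 1) = c - x := by field_simp
        rw [h3] at h2
        linarith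
    nlinarith

/-- The function `jfun` controls the excess of `w` over `c * q`. -/
lemma exists_le_mul_add_jfun {a : ℝ} (ha : 0 < a) {c : ℝ} (hc : 1 < c) : ∃ B : ℝ≥0∞, B ≠ ∞ ∧
    ∀ w q : ℝ≥0∞, w ≠ ∞ → q ≠ ∞ → w ≤ ENNReal.ofReal c * q + B * jfun a w q := by
  have hc0 : 0 < c := by linarith
  rcases lt_trichotomy a 1 with h | rfl | h
  · have hca : c ^ (a - 1) < 1 := Real.rpow_lt_one_of_one_lt_of_neg hc (by linarith)
    have hD : 0 < a * (1 - c ^ (a - 1)) := mul_pos ha (by linarith)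
    -- The constant comes from the mean inequality for `w` and `c * q` instead of `w` and `q`,
    -- multiplied by `c ^ (a - 1)` and compared with the definition of `jfun`. Bernoulli's
    -- inequality `h5` absorbs the remaining multiple of `q`.
    refine ⟨ENNReal.ofReal ((1 - a) / (a * (1 - c ^ (a - 1)))), by simp, fun w q hw hq => ?_⟩
    have h1 := rpow_mul_rpow_add_of_lt_one ha h hw hq
    have h2 := rpow_mul_rpow_le ha h hw (q := ENNReal.ofReal c * q)
      (ENNReal.mul_ne_top (by simp) hq)
    have hj : jfun a w q ≠ ∞ := by
      rw [jfun_of_lt_one h]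
      refine ENNReal.div_ne_top (ne_top_of_le_ne_top ?_ tsub_le_self) (by simpa using h)
      finiteness
    have hA : w ^ a * q ^ (1 - a) ≠ ∞ := ENNReal.mul_ne_top
      (ENNReal.rpow_ne_top_of_nonneg ha.le hw) (ENNReal.rpow_ne_top_of_nonneg (by linarith) hq)
    lift w to ℝ≥0 using hw
    lift q to ℝ≥0 using hq
    generalize jfun a w q = j at *
    lift j to ℝ≥0 using hj
    rw [← ENNReal.toReal_eq_toReal_iff' (by finiteness) (by finiteness)] at h1
    rw [← ENNReal.toReal_le_toReal (by
      refine ENNReal.mul_ne_top (ENNReal.rpow_ne_top_of_nonneg ha.le (by simp))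
        (ENNReal.rpow_ne_top_of_nonneg (by linarith) (by finiteness))) (by finiteness)] at h2
    rw [← ENNReal.toReal_le_toReal (by finiteness) (by finiteness)]
    rw [ENNReal.toReal_add (by finiteness) (by finiteness),
      ENNReal.toReal_add (by finiteness) (by finiteness)] at h1
    rw [ENNReal.toReal_add (by finiteness) (by finiteness)] at h2
    rw [ENNReal.toReal_add (by finiteness) (by finiteness)]
    simp only [ENNReal.toReal_mul, ← ENNReal.toReal_rpow, ENNReal.coe_toReal,
      ENNReal.toReal_ofReal ha.le, ENNReal.toReal_ofReal (by linarith : 0 ≤ 1 - a),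
      ENNReal.toReal_ofReal hc0.le, ENNReal.toReal_ofReal (div_pos (by linarith : 0 < 1 - a) hD).le]
      at h1 h2 ⊢
    have hq := q.coe_nonneg
    have hw := w.coe_nonneg
    rw [Real.mul_rpow hc0.le hq] at h2
    have h3 : c ^ (a - 1) * c ^ (1 - a) = 1 := by rw [← Real.rpow_add hc0]; simp
    have h4 : c ^ (a - 1) * c = c ^ a := by
      nth_rewrite 2 [← Real.rpow_one c]; rw [← Real.rpow_add hc0]; simp
    have h5 : c ^ a ≤ 1 + a * (c - 1) := by
      have := rpow_one_add_le_one_add_mul_self (s := c - 1) (by linarith) ha.le h.le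
      simpa using this
    have h6 := mul_le_mul_of_nonneg_left h2 (Real.rpow_nonneg hc0.le (a - 1))
    have h7 : (w : ℝ) ^ a * q ^ (1 - a) ≤ c ^ (a - 1) * a * w + (1 - a) * c ^ a * q := by
      calc (w : ℝ) ^ a * q ^ (1 - a) =
          (c ^ (a - 1) * c ^ (1 - a)) * ((w : ℝ) ^ a * q ^ (1 - a)) := by rw [h3, one_mul]
        _ = c ^ (a - 1) * ((w : ℝ) ^ a * (c ^ (1 - a) * q ^ (1 - a))) := by ring
        _ ≤ _ := h6
        _ = c ^ (a - 1) * a * w + (1 - a) * (c ^ (a - 1) * c) * q := by ring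
        _ = _ := by rw [h4]
    have h8 : a * (1 - c ^ (a - 1)) * w ≤ a * (1 - c ^ (a - 1)) * (c * q) + (1 - a) * j := by
      have : (1 - a) * (c ^ a - 1) * q ≤ a * (c - c ^ (a - 1) * c) * q := by
        rw [h4]
        refine mul_le_mul_of_nonneg_right ?_ hq
        nlinarith
      nlinarith
    calc (w : ℝ) = (a * (1 - c ^ (a - 1)))⁻¹ * (a * (1 - c ^ (a - 1)) * w) := by
          rw [← mul_assoc, inv_mul_cancel₀ hD.ne', one_mul]
      _ ≤ (a * (1 - c ^ (a - 1)))⁻¹ * (a * (1 - c ^ (a - 1)) * (c * q) + (1 - a) * j) := by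
          gcongr
      _ = _ := by rw [mul_add, inv_mul_cancel_left₀ hD.ne', div_eq_mul_inv]; ring
  · have hl : 0 < Real.log c := Real.log_pos hc
    -- Divide the tangent bound by `log c`; the inequality `c - 1 ≤ c log c` keeps the coefficient
    -- of `q` at most `c`.
    refine ⟨(ENNReal.ofReal (Real.log c))⁻¹, by simpa using hl, fun w q hw hq => ?_⟩
    have h1 := mul_log_le_jfun_one hc hw hq
    have h2 : c - 1 ≤ Real.log c * c := by
      have := Real.log_le_sub_one_of_pos (x := c⁻¹) (by positivity)
      rw [Real.log_inv] at this
      have h3 := mul_le_mul_of_nonneg_right this hc0.le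
      have h4 : (c⁻¹ - 1) * c = 1 - c := by field_simp
      rw [h4] at h3
      linarith
    have h0 : ENNReal.ofReal (Real.log c) ≠ 0 := by simpa using hl
    rw [← ENNReal.mul_le_mul_iff_right h0 (by simp), mul_add, ← mul_assoc, ← mul_assoc,
      ENNReal.mul_inv_cancel h0 (by simp), one_mul, ← ENNReal.ofReal_mul hl.le]
    refine h1.trans ?_
    gcongr
  · have hca : 1 < c ^ (a - 1) := Real.one_lt_rpow hc (by linarith)
    have hD : 0 < a * (c ^ (a - 1) - 1) := mul_pos ha (by linarith)
    -- As for `a < 1`, with the mean inequality and Bernoulli's inequality both reversed.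
    refine ⟨ENNReal.ofReal ((a - 1) / (a * (c ^ (a - 1) - 1))), by simp, fun w q hw hq => ?_⟩
    by_cases hj : jfun a w q = ∞
    · rw [hj, ENNReal.mul_top]
      · simp
      · simpa using div_pos (by linarith : 0 < a - 1) hD
    have h1 := rpow_mul_rpow_add_of_one_lt h hw hq
    have h2 := le_rpow_mul_rpow_add h hw (q := ENNReal.ofReal c * q)
      (ENNReal.mul_ne_top (by simp) hq)
    have hA : w ^ a * q ^ (1 - a) ≠ ∞ := by
      refine ne_top_of_le_ne_top (b := ENNReal.ofReal a * w + ENNReal.ofReal (a - 1) * jfun a w q)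
        (by finiteness) ?_
      rw [← h1]
      exact le_self_add
    rw [ENNReal.mul_rpow_of_ne_top (by simp) hq, ENNReal.ofReal_rpow_of_pos hc0] at h2
    have hA' : w ^ a * (ENNReal.ofReal (c ^ (1 - a)) * q ^ (1 - a)) ≠ ∞ := by
      rw [mul_left_comm]
      exact ENNReal.mul_ne_top (by simp) hA
    lift w to ℝ≥0 using hw
    lift q to ℝ≥0 using hq
    generalize jfun a w q = j at *
    lift j to ℝ≥0 using hj
    rw [← ENNReal.toReal_eq_toReal_iff' (by finiteness) (by finiteness)] at h1
    rw [← ENNReal.toReal_le_toReal (by finiteness) (by finiteness)] at h2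
    rw [← ENNReal.toReal_le_toReal (by finiteness) (by finiteness)]
    rw [ENNReal.toReal_add (by finiteness) (by finiteness),
      ENNReal.toReal_add (by finiteness) (by finiteness)] at h1
    rw [ENNReal.toReal_add (by finiteness) (by finiteness)] at h2
    rw [ENNReal.toReal_add (by finiteness) (by finiteness)]
    simp only [ENNReal.toReal_mul, ← ENNReal.toReal_rpow, ENNReal.coe_toReal,
      ENNReal.toReal_ofReal ha.le, ENNReal.toReal_ofReal (by linarith : 0 ≤ a - 1),
      ENNReal.toReal_ofReal hc0.le, ENNReal.toReal_ofReal (Real.rpow_nonneg hc0.le (1 - a)),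
      ENNReal.toReal_ofReal (div_pos (by linarith : 0 < a - 1) hD).le] at h1 h2 ⊢
    have hq := q.coe_nonneg
    have hw := w.coe_nonneg
    have h3 : c ^ (a - 1) * c ^ (1 - a) = 1 := by rw [← Real.rpow_add hc0]; simp
    have h4 : c ^ (a - 1) * c = c ^ a := by
      nth_rewrite 2 [← Real.rpow_one c]; rw [← Real.rpow_add hc0]; simp
    have h5 : 1 + a * (c - 1) ≤ c ^ a := by
      have := one_add_mul_self_le_rpow_one_add (s := c - 1) (by linarith) h.le
      simpa using this
    have h6 := mul_le_mul_of_nonneg_left h2 (Real.rpow_nonneg hc0.le (a - 1))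
    have h7 : c ^ (a - 1) * a * w ≤ (w : ℝ) ^ a * q ^ (1 - a) + (a - 1) * c ^ a * q := by
      calc c ^ (a - 1) * a * w = c ^ (a - 1) * (a * w) := by ring
        _ ≤ _ := h6
        _ = (c ^ (a - 1) * c ^ (1 - a)) * ((w : ℝ) ^ a * q ^ (1 - a)) +
            (a - 1) * (c ^ (a - 1) * c) * q := by ring
        _ = _ := by rw [h4, h3, one_mul]
    have h8 : a * (c ^ (a - 1) - 1) * w ≤ a * (c ^ (a - 1) - 1) * (c * q) + (a - 1) * j := by
      have : (a - 1) * (c ^ a - 1) * q ≤ a * (c ^ (a - 1) * c - c) * q := by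
        rw [h4]
        refine mul_le_mul_of_nonneg_right ?_ hq
        nlinarith
      nlinarith
    calc (w : ℝ) = (a * (c ^ (a - 1) - 1))⁻¹ * (a * (c ^ (a - 1) - 1) * w) := by
          rw [← mul_assoc, inv_mul_cancel₀ hD.ne', one_mul]
      _ ≤ (a * (c ^ (a - 1) - 1))⁻¹ * (a * (c ^ (a - 1) - 1) * (c * q) + (a - 1) * j) := by
          gcongr
      _ = _ := by rw [mul_add, inv_mul_cancel_left₀ hD.ne', div_eq_mul_inv]; ring

/-- Sequential lower semicontinuity of the integrand. -/
lemma jfun_le_liminf {a : ℝ} (ha : 0 < a) {w q : ℕ → ℝ≥0∞} {w' q' : ℝ≥0∞}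
    (hw : Tendsto w atTop (𝓝 w')) (hq : Tendsto q atTop (𝓝 q')) (hw' : w' ≠ ∞) (hq' : q' ≠ ∞) :
    jfun a w' q' ≤ liminf (fun n => jfun a (w n) (q n)) atTop := by
  have hwn : ∀ᶠ n in atTop, w n ≠ ∞ := hw.eventually_ne hw'
  have hqn : ∀ᶠ n in atTop, q n ≠ ∞ := hq.eventually_ne hq'
  rcases lt_trichotomy a 1 with h | rfl | h
  · refine le_of_eq (Tendsto.liminf_eq ?_).symm
    simp_rw [jfun_of_lt_one h]
    have h1 : Tendsto (fun n => w n ^ a * q n ^ (1 - a)) atTop (𝓝 (w' ^ a * q' ^ (1 - a))) :=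
      ENNReal.Tendsto.mul ((ENNReal.continuous_rpow_const.tendsto _).comp hw)
        (Or.inr (ENNReal.rpow_ne_top_of_nonneg (by linarith) hq'))
        ((ENNReal.continuous_rpow_const.tendsto _).comp hq)
        (Or.inr (ENNReal.rpow_ne_top_of_nonneg ha.le hw'))
    refine ENNReal.Tendsto.div_const (ENNReal.Tendsto.sub ?_ h1 (Or.inl (by finiteness)))
      (Or.inr (by simpa using h))
    exact (ENNReal.Tendsto.const_mul hw (Or.inr (by simp))).add
      (ENNReal.Tendsto.const_mul hq (Or.inr (by simp)))
  · by_cases hq0 : q' = 0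
    · by_cases hw0 : w' = 0
      · simp [jfun_one, hq0, hw0]
      -- Here the limiting value is infinite. The tangent bounds give the lower estimates `log c *
      -- w'`, which are unbounded in `c` because `w' ≠ 0`.
      · have key : ∀ c : ℝ, 1 < c → ENNReal.ofReal (Real.log c) * w' ≤
            liminf (fun n => jfun 1 (w n) (q n)) atTop := by
          intro c hc
          have hT : Tendsto (fun n => ENNReal.ofReal (Real.log c) * w n -
              ENNReal.ofReal (c - 1) * q n) atTop (𝓝 (ENNReal.ofReal (Real.log c) * w' -
                ENNReal.ofReal (c - 1) * q')) :=
            ENNReal.Tendsto.sub (ENNReal.Tendsto.const_mul hw (Or.inr (by simp)))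
              (ENNReal.Tendsto.const_mul hq (Or.inr (by simp))) (Or.inl (by finiteness))
          rw [hq0, mul_zero, tsub_zero] at hT
          rw [← hT.liminf_eq]
          refine liminf_le_liminf ?_
          filter_upwards [hwn, hqn] with n h1 h2
          rw [tsub_le_iff_left]
          exact mul_log_le_jfun_one hc h1 h2
        have hTT : Tendsto (fun c : ℝ => ENNReal.ofReal (Real.log c) * w') atTop (𝓝 (∞ * w')) :=
          ENNReal.Tendsto.mul_const (ENNReal.tendsto_ofReal_atTop.comp Real.tendsto_log_atTop)
            (Or.inl (by simp))
        rw [ENNReal.top_mul hw0] at hTT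
        refine le_top.trans (le_of_tendsto hTT ?_)
        filter_upwards [eventually_gt_atTop 1] with c hc using key c hc
    · refine le_of_eq (Tendsto.liminf_eq ?_).symm
      have h1 : Tendsto (fun n => ENNReal.ofReal ((q n).toReal *
          InformationTheory.klFun ((w n).toReal / (q n).toReal))) atTop (𝓝 (ENNReal.ofReal
            (q'.toReal * InformationTheory.klFun (w'.toReal / q'.toReal)))) := by
        have hqr := (ENNReal.tendsto_toReal hq').comp hq
        have hwr := (ENNReal.tendsto_toReal hw').comp hw
        refine ENNReal.tendsto_ofReal (hqr.mul ?_)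
        exact (InformationTheory.continuous_klFun.tendsto _).comp
          (hwr.div hqr (ENNReal.toReal_ne_zero.2 ⟨hq0, hq'⟩))
      rw [jfun_one, if_neg hq0]
      refine h1.congr' ?_
      filter_upwards [hq.eventually_ne hq0] with n hn
      rw [jfun_one, if_neg hn]
  -- At the origin `w ^ a * q ^ (1 - a)` has no limit, but there `jfun` vanishes because `0 * ∞ =
  -- 0`, so nothing has to be shown.
  · by_cases h0 : w' = 0 ∧ q' = 0
    · have : jfun a w' q' = 0 := by
        rw [h0.1, h0.2, jfun_of_one_lt h]
        simp [ENNReal.zero_rpow_of_pos ha]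
      rw [this]
      exact zero_le
    · refine le_of_eq (Tendsto.liminf_eq ?_).symm
      simp_rw [jfun_of_one_lt h]
      have h1 : Tendsto (fun n => w n ^ a * q n ^ (1 - a)) atTop (𝓝 (w' ^ a * q' ^ (1 - a))) := by
        refine ENNReal.Tendsto.mul ((ENNReal.continuous_rpow_const.tendsto _).comp hw) ?_
          ((ENNReal.continuous_rpow_const.tendsto _).comp hq)
          (Or.inr (ENNReal.rpow_ne_top_of_nonneg ha.le hw'))
        by_cases hw0 : w' = 0
        · exact Or.inr (ENNReal.rpow_ne_top_of_ne_zero (fun hq0 => h0 ⟨hw0, hq0⟩) hq')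
        · left
          simp [ENNReal.rpow_eq_zero_iff, hw0, hw']
      refine ENNReal.Tendsto.div_const (ENNReal.Tendsto.sub (h1.add
        (ENNReal.Tendsto.const_mul hq (Or.inr (by simp))))
        (ENNReal.Tendsto.const_mul hw (Or.inr (by simp))) (Or.inr (by finiteness)))
        (Or.inr (by simpa using h))

/-! ### Integrals of homogeneous functions of densities, and the linearised divergence -/

/-- The integral of a homogeneous function of the densities of two measures. The densities are
taken with respect to the sum of the two measures. -/
def homDiv (h : ℝ≥0∞ → ℝ≥0∞ → ℝ≥0∞) (W Q : Measure Y) : ℝ≥0∞ :=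
  ∫⁻ y, h (W.rnDeriv (W + Q) y) (Q.rnDeriv (W + Q) y) ∂(W + Q)

/-- The integral `homDiv h W Q` may be computed with any dominating measure. -/
lemma homDiv_eq {h : ℝ≥0∞ → ℝ≥0∞ → ℝ≥0∞} (hm : Measurable fun p : ℝ≥0∞ × ℝ≥0∞ => h p.1 p.2)
    (hh : ∀ c ≠ ∞, ∀ w, ∀ q ≠ ∞, h (c * w) (c * q) = c * h w q)
    {W Q : Measure Y} [IsFiniteMeasure W] [IsFiniteMeasure Q] {ν : Measure Y}
    {w q : Y → ℝ≥0∞} (hw : Measurable w) (hq : Measurable q) (hW : ν.withDensity w = W)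
    (hQ : ν.withDensity q = Q) : homDiv h W Q = ∫⁻ y, h (w y) (q y) ∂ν := by
  have hρ : ν.withDensity (w + q) = W + Q := by rw [withDensity_add_left hw, hW, hQ]
  have hWρ : W ≪ W + Q := Measure.AbsolutelyContinuous.rfl.add_right Q
  have hQρ : Q ≪ W + Q := by
    rw [add_comm]; exact Measure.AbsolutelyContinuous.rfl.add_right W
  have hw' := Measure.measurable_rnDeriv W (W + Q)
  have hq' := Measure.measurable_rnDeriv Q (W + Q)
  -- By the chain rule each density with respect to `ν` is `w + q` times the density with respect to
  -- `W + Q`; homogeneity then pulls out the factor `w + q`.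
  have ew : w =ᵐ[ν] (w + q) * W.rnDeriv (W + Q) := by
    refine (withDensity_eq_iff hw.aemeasurable ((hw.add hq).mul hw').aemeasurable ?_).1 ?_
    · rw [← setLIntegral_univ, ← withDensity_apply _ MeasurableSet.univ, hW]
      exact measure_ne_top _ _
    · rw [withDensity_mul _ (hw.add hq) hw', hρ, Measure.withDensity_rnDeriv_eq _ _ hWρ, hW]
  have eq : q =ᵐ[ν] (w + q) * Q.rnDeriv (W + Q) := by
    refine (withDensity_eq_iff hq.aemeasurable ((hw.add hq).mul hq').aemeasurable ?_).1 ?_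
    · rw [← setLIntegral_univ, ← withDensity_apply _ MeasurableSet.univ, hQ]
      exact measure_ne_top _ _
    · rw [withDensity_mul _ (hw.add hq) hq', hρ, Measure.withDensity_rnDeriv_eq _ _ hQρ, hQ]
  have hfin : ∀ᵐ y ∂ν, (w + q) y < ∞ := by
    refine ae_lt_top (hw.add hq) ?_
    rw [← setLIntegral_univ, ← withDensity_apply _ MeasurableSet.univ, hρ]
    exact measure_ne_top _ _
  have hqfin : ∀ᵐ y ∂ν, (w + q) y ≠ 0 → Q.rnDeriv (W + Q) y ≠ ∞ := by
    have := Measure.rnDeriv_ne_top Q (W + Q)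
    rwa [← hρ, ae_withDensity_iff (hw.add hq), hρ] at this
  have hcomp : Measurable fun y => h (W.rnDeriv (W + Q) y) (Q.rnDeriv (W + Q) y) :=
    hm.comp (hw'.prodMk hq')
  have h00 : h 0 0 = 0 := by simpa using hh 0 (by simp) 0 0 (by simp)
  have e0 : homDiv h W Q = ∫⁻ y, h (W.rnDeriv (W + Q) y) (Q.rnDeriv (W + Q) y)
      ∂(ν.withDensity (w + q)) := by rw [hρ]; rfl
  rw [e0, lintegral_withDensity_eq_lintegral_mul _ (hw.add hq) hcomp]
  refine lintegral_congr_ae ?_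
  filter_upwards [ew, eq, hfin, hqfin] with y h1 h2 h3 h4
  by_cases h0 : (w + q) y = 0
  · have hw0 : w y = 0 := (add_eq_zero.1 h0).1
    have hq0 : q y = 0 := (add_eq_zero.1 h0).2
    simp [hw0, hq0, h00]
  · rw [h1, h2]
    exact (hh _ h3.ne _ _ (h4 h0)).symm

lemma withDensity_rnDeriv_dominated {W ν : Measure Y} [SigmaFinite W] [SigmaFinite ν]
    (h : W ≪ ν) : ν.withDensity (W.rnDeriv ν) = W := Measure.withDensity_rnDeriv_eq _ _ h

lemma lintegral_density_eq_one {ν W : Measure Y} [IsProbabilityMeasure W] {w : Y → ℝ≥0∞}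
    (hW : ν.withDensity w = W) : ∫⁻ y, w y ∂ν = 1 := by
  rw [← setLIntegral_univ, ← withDensity_apply _ MeasurableSet.univ, hW, measure_univ]

lemma ae_density_ne_top {ν W : Measure Y} [IsFiniteMeasure W] {w : Y → ℝ≥0∞} (hw : Measurable w)
    (hW : ν.withDensity w = W) : ∀ᵐ y ∂ν, w y ≠ ∞ := by
  have : ∫⁻ y, w y ∂ν ≠ ∞ := by
    rw [← setLIntegral_univ, ← withDensity_apply _ MeasurableSet.univ, hW]
    exact measure_ne_top _ _
  filter_upwards [ae_lt_top hw this] with y hy using hy.ne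

/-- Densities of two measures with respect to their sum. -/
lemma exists_densities (W Q : Measure Y) [IsFiniteMeasure W] [IsFiniteMeasure Q] :
    (W + Q).withDensity (W.rnDeriv (W + Q)) = W ∧ (W + Q).withDensity (Q.rnDeriv (W + Q)) = Q := by
  refine ⟨withDensity_rnDeriv_dominated (Measure.AbsolutelyContinuous.rfl.add_right Q),
    withDensity_rnDeriv_dominated ?_⟩
  rw [add_comm]
  exact Measure.AbsolutelyContinuous.rfl.add_right W

lemma exists_common_densities (W Q : Measure Y) [IsFiniteMeasure W] [IsFiniteMeasure Q] :
    ∃ (ρ : Measure Y) (w q : Y → ℝ≥0∞), IsFiniteMeasure ρ ∧ Measurable w ∧ Measurable q ∧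
      ρ.withDensity w = W ∧ ρ.withDensity q = Q :=
  ⟨W + Q, _, _, inferInstance, Measure.measurable_rnDeriv _ _, Measure.measurable_rnDeriv _ _,
    (exists_densities W Q).1, (exists_densities W Q).2⟩

/-- Densities of a sequence of measures and a further measure with respect to a common one. -/
lemma exists_common_densities_seq (W Q : ℕ → ProbabilityMeasure Y) (W' Q' : ProbabilityMeasure Y) :
    ∃ (ν : Measure Y) (w q : ℕ → Y → ℝ≥0∞) (w' q' : Y → ℝ≥0∞),
      IsFiniteMeasure ν ∧ (∀ n, Measurable (w n)) ∧ (∀ n, Measurable (q n)) ∧ Measurable w' ∧ Measurable q' ∧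
      (∀ n, ν.withDensity (w n) = W n) ∧ (∀ n, ν.withDensity (q n) = Q n) ∧
      ν.withDensity w' = W' ∧ ν.withDensity q' = Q' := by
  obtain ⟨ν₁, hν₁, h₁⟩ := exists_dominating W
  obtain ⟨ν₂, hν₂, h₂⟩ := exists_dominating Q
  have hW' : (W' : Measure Y) ≪ ν₁ + ν₂ + ((W' : Measure Y) + (Q' : Measure Y)) :=
    Measure.absolutelyContinuous_of_le
      ((Measure.le_add_right le_rfl).trans (Measure.le_add_left le_rfl))
  have hQ' : (Q' : Measure Y) ≪ ν₁ + ν₂ + ((W' : Measure Y) + (Q' : Measure Y)) :=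
    Measure.absolutelyContinuous_of_le
      ((Measure.le_add_left le_rfl).trans (Measure.le_add_left le_rfl))
  have hWn : ∀ n, (W n : Measure Y) ≪ ν₁ + ν₂ + ((W' : Measure Y) + (Q' : Measure Y)) :=
    fun n => (h₁ n).trans (Measure.absolutelyContinuous_of_le
      ((Measure.le_add_right le_rfl).trans (Measure.le_add_right le_rfl)))
  have hQn : ∀ n, (Q n : Measure Y) ≪ ν₁ + ν₂ + ((W' : Measure Y) + (Q' : Measure Y)) :=
    fun n => (h₂ n).trans (Measure.absolutelyContinuous_of_le
      ((Measure.le_add_left le_rfl).trans (Measure.le_add_right le_rfl)))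
  exact ⟨ν₁ + ν₂ + ((W' : Measure Y) + (Q' : Measure Y)), _, _, _, _, inferInstance,
    fun n => Measure.measurable_rnDeriv _ _,
    fun n => Measure.measurable_rnDeriv _ _, Measure.measurable_rnDeriv _ _,
    Measure.measurable_rnDeriv _ _, fun n => withDensity_rnDeriv_dominated (hWn n),
    fun n => withDensity_rnDeriv_dominated (hQn n), withDensity_rnDeriv_dominated hW',
    withDensity_rnDeriv_dominated hQ'⟩

/-- The linearised Rényi divergence of finite order `a`. -/
def linDiv (a : ℝ) (W Q : Measure Y) : ℝ≥0∞ := homDiv (jfun a) W Q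

/-- The Hellinger integral of order `a`. -/
def hellinger (a : ℝ) (W Q : Measure Y) : ℝ≥0∞ := homDiv (fun w q => w ^ a * q ^ (1 - a)) W Q

lemma linDiv_eq {a : ℝ} (ha : 0 < a) {W Q : Measure Y} [IsFiniteMeasure W] [IsFiniteMeasure Q]
    {ν : Measure Y} {w q : Y → ℝ≥0∞} (hw : Measurable w) (hq : Measurable q)
    (hW : ν.withDensity w = W) (hQ : ν.withDensity q = Q) :
    linDiv a W Q = ∫⁻ y, jfun a (w y) (q y) ∂ν :=
  homDiv_eq (measurable_jfun a) (fun _ hc w _ hq => jfun_homogeneous ha hc w hq) hw hq hW hQ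

lemma hellinger_eq {a : ℝ} (ha : 0 < a) {W Q : Measure Y} [IsFiniteMeasure W] [IsFiniteMeasure Q]
    {ν : Measure Y} {w q : Y → ℝ≥0∞} (hw : Measurable w) (hq : Measurable q)
    (hW : ν.withDensity w = W) (hQ : ν.withDensity q = Q) :
    hellinger a W Q = ∫⁻ y, w y ^ a * q y ^ (1 - a) ∂ν :=
  homDiv_eq (by fun_prop) (fun _ hc w _ hq => rpow_mul_rpow_homogeneous ha hc w hq) hw hq hW hQ

lemma hellinger_of_one_lt {a : ℝ} (ha : 1 < a) (W Q : Measure Y) [IsProbabilityMeasure W]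
    [IsProbabilityMeasure Q] : hellinger a W Q = 1 + ENNReal.ofReal (a - 1) * linDiv a W Q := by
  obtain ⟨hW, hQ⟩ := exists_densities W Q
  have hw := Measure.measurable_rnDeriv W (W + Q)
  have hq := Measure.measurable_rnDeriv Q (W + Q)
  have hj : Measurable fun y => jfun a (W.rnDeriv (W + Q) y) (Q.rnDeriv (W + Q) y) :=
    (measurable_jfun a).comp (hw.prodMk hq)
  have h1 : ∫⁻ y, (W.rnDeriv (W + Q) y ^ a * Q.rnDeriv (W + Q) y ^ (1 - a) +
      ENNReal.ofReal (a - 1) * Q.rnDeriv (W + Q) y) ∂(W + Q) =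
      ∫⁻ y, (ENNReal.ofReal a * W.rnDeriv (W + Q) y +
        ENNReal.ofReal (a - 1) * jfun a (W.rnDeriv (W + Q) y) (Q.rnDeriv (W + Q) y)) ∂(W + Q) := by
    refine lintegral_congr_ae ?_
    filter_upwards [ae_density_ne_top hw hW, ae_density_ne_top hq hQ] with y h1 h2
    exact rpow_mul_rpow_add_of_one_lt ha h1 h2
  rw [lintegral_add_right _ (hq.const_mul _), lintegral_add_left (hw.const_mul _),
    lintegral_const_mul _ hq, lintegral_const_mul _ hw, lintegral_const_mul _ hj,
    lintegral_density_eq_one hW, lintegral_density_eq_one hQ, mul_one, mul_one] at h1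
  have h2 : ENNReal.ofReal a = ENNReal.ofReal (a - 1) + 1 := by
    rw [← ENNReal.ofReal_one, ← ENNReal.ofReal_add (by linarith) (by norm_num)]
    congr 1; ring
  rw [h2, add_comm, add_assoc] at h1
  exact (ENNReal.add_right_inj (by simp)).1 h1

lemma hellinger_add_of_lt_one {a : ℝ} (ha0 : 0 < a) (ha : a < 1) (W Q : Measure Y)
    [IsProbabilityMeasure W] [IsProbabilityMeasure Q] :
    hellinger a W Q + ENNReal.ofReal (1 - a) * linDiv a W Q = 1 := by
  obtain ⟨hW, hQ⟩ := exists_densities W Q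
  have hw := Measure.measurable_rnDeriv W (W + Q)
  have hq := Measure.measurable_rnDeriv Q (W + Q)
  have hj : Measurable fun y => jfun a (W.rnDeriv (W + Q) y) (Q.rnDeriv (W + Q) y) :=
    (measurable_jfun a).comp (hw.prodMk hq)
  have h1 : ∫⁻ y, (W.rnDeriv (W + Q) y ^ a * Q.rnDeriv (W + Q) y ^ (1 - a) +
        ENNReal.ofReal (1 - a) * jfun a (W.rnDeriv (W + Q) y) (Q.rnDeriv (W + Q) y)) ∂(W + Q) =
      ∫⁻ y, (ENNReal.ofReal a * W.rnDeriv (W + Q) y +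
        ENNReal.ofReal (1 - a) * Q.rnDeriv (W + Q) y) ∂(W + Q) := by
    refine lintegral_congr_ae ?_
    filter_upwards [ae_density_ne_top hw hW, ae_density_ne_top hq hQ] with y h1 h2
    exact rpow_mul_rpow_add_of_lt_one ha0 ha h1 h2
  rw [lintegral_add_right _ (hj.const_mul _), lintegral_add_left (hw.const_mul _),
    lintegral_const_mul _ hq, lintegral_const_mul _ hw, lintegral_const_mul _ hj,
    lintegral_density_eq_one hW, lintegral_density_eq_one hQ, mul_one, mul_one,
    ← ENNReal.ofReal_add ha0.le (by linarith)] at h1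
  rwa [add_sub_cancel, ENNReal.ofReal_one] at h1

/-- When `W` is not dominated by `Q` both sides are infinite: a finite integral forces `w = 0`
almost everywhere on `q = 0`, since `jfun 1 w 0 = ∞` for `w ≠ 0`. -/
lemma linDiv_one_eq_klDiv (W Q : Measure Y) [IsProbabilityMeasure W] [IsProbabilityMeasure Q] :
    linDiv 1 W Q = InformationTheory.klDiv W Q := by
  by_cases hac : W ≪ Q
  · rw [InformationTheory.klDiv_eq_lintegral_klFun_of_ac hac,
      linDiv_eq one_pos (Measure.measurable_rnDeriv W Q) (measurable_const (a := 1))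
        (withDensity_rnDeriv_dominated hac) (by exact withDensity_one)]
    simp [jfun_one]
  · rw [InformationTheory.klDiv_of_not_ac hac]
    by_contra hfin
    obtain ⟨hW, hQ⟩ := exists_densities W Q
    have hw := Measure.measurable_rnDeriv W (W + Q)
    have hq := Measure.measurable_rnDeriv Q (W + Q)
    have hj := (measurable_jfun 1).comp (hw.prodMk hq)
    have h1 := ae_lt_top hj hfin
    refine hac (Measure.AbsolutelyContinuous.mk fun s hs hQs => ?_)
    rw [← hW, withDensity_apply _ hs]
    rw [← hQ, withDensity_apply _ hs, lintegral_eq_zero_iff hq] at hQs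
    rw [lintegral_eq_zero_iff hw]
    filter_upwards [hQs, ae_restrict_of_ae h1] with y h2 h3
    by_contra h4
    simp only [Pi.zero_apply] at h2 h4
    simp [Function.comp, jfun_one, h2, h4] at h3

/-- Probability measures with a small linearised divergence are close. -/
lemma TVle_of_linDiv_le {a : ℝ} (ha : 0 < a) {ε : ℝ≥0∞} (hε : ε ≠ 0) :
    ∃ δ ≠ 0, ∀ W Q : ProbabilityMeasure Y, linDiv a (W : Measure Y) (Q : Measure Y) ≤ δ →
      TVle (W : Measure Y) (Q : Measure Y) ε := by
  wlog hε' : ε ≠ ∞ generalizing ε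
  · obtain ⟨δ, hδ, h⟩ := this one_ne_zero (by simp)
    exact ⟨δ, hδ, fun W Q hWQ => (h W Q hWQ).mono (by rw [not_not.1 hε']; exact le_top)⟩
  have hε0 : 0 < (ε / 2).toReal :=
    ENNReal.toReal_pos (by simp [hε]) (ENNReal.div_ne_top hε' (by simp))
  -- One half of `ε` pays for the excess of the factor `1 + ε / 2` over one, the other half for the
  -- divergence term; `B + 1` keeps the denominator nonzero.
  obtain ⟨B, hB, h⟩ := exists_le_mul_add_jfun ha (c := 1 + (ε / 2).toReal) (by linarith)
  refine ⟨ε / 2 / (B + 1), (ENNReal.div_pos (by simp [hε]) (by simp [hB])).ne',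
    fun W Q hWQ A hA => ?_⟩
  obtain ⟨ρ, w, q, -, hw, hq, hW, hQ⟩ := exists_common_densities (W : Measure Y) (Q : Measure Y)
  rw [linDiv_eq ha hw hq hW hQ] at hWQ
  have hj : Measurable fun y => jfun a (w y) (q y) := (measurable_jfun a).comp (hw.prodMk hq)
  have hc : ENNReal.ofReal (1 + (ε / 2).toReal) = 1 + ε / 2 := by
    rw [ENNReal.ofReal_add (by norm_num) hε0.le, ENNReal.ofReal_one,
      ENNReal.ofReal_toReal (ENNReal.div_ne_top hε' (by simp))]
  have hWA : (W : Measure Y) A = ∫⁻ y in A, w y ∂ρ := by rw [← withDensity_apply _ hA, hW]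
  have hQA : (Q : Measure Y) A = ∫⁻ y in A, q y ∂ρ := by rw [← withDensity_apply _ hA, hQ]
  calc (W : Measure Y) A = ∫⁻ y in A, w y ∂ρ := hWA
    _ ≤ ∫⁻ y in A, ((1 + ε / 2) * q y + B * jfun a (w y) (q y)) ∂ρ := by
      refine lintegral_mono_ae (ae_restrict_of_ae ?_)
      filter_upwards [ae_density_ne_top hw hW, ae_density_ne_top hq hQ] with y h1 h2
      rw [← hc]
      exact h _ _ h1 h2
    _ = (1 + ε / 2) * (Q : Measure Y) A + B * ∫⁻ y in A, jfun a (w y) (q y) ∂ρ := by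
      rw [lintegral_add_left (hq.const_mul _), lintegral_const_mul _ hq,
        lintegral_const_mul _ hj, hQA]
    _ ≤ ((Q : Measure Y) A + ε / 2 * 1) + (B + 1) * (ε / 2 / (B + 1)) := by
      rw [add_mul, one_mul]
      gcongr
      · exact prob_le_one
      · exact le_self_add
      · exact (setLIntegral_le_lintegral _ _).trans hWQ
    _ = (Q : Measure Y) A + ε := by
      rw [ENNReal.mul_div_cancel (by simp) (by simp [hB]), mul_one, add_assoc, ENNReal.add_halves]

/-- Lower semicontinuity of the linearised divergence. -/
lemma linDiv_le_liminf {a : ℝ} (ha : 0 < a) (W Q : ℕ → ProbabilityMeasure Y)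
    (W' Q' : ProbabilityMeasure Y) (ε : ℕ → ℝ≥0∞) (hε : ∑' n, ε n ≠ ∞)
    (hW : ∀ n, TVle (W n : Measure Y) (W' : Measure Y) (ε n))
    (hQ : ∀ n, TVle (Q n : Measure Y) (Q' : Measure Y) (ε n)) :
    linDiv a (W' : Measure Y) (Q' : Measure Y) ≤
      liminf (fun n => linDiv a (W n : Measure Y) (Q n : Measure Y)) atTop := by
  obtain ⟨ν, w, q, w', q', -, mw, mq, mw', mq', ew, eq, ew', eq'⟩ :=
    exists_common_densities_seq W Q W' Q'
  have hlim_w := ae_tendsto_of_TVle hε hW mw mw' ew ew'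
  have hlim_q := ae_tendsto_of_TVle hε hQ mq mq' eq eq'
  rw [linDiv_eq ha mw' mq' ew' eq']
  simp_rw [fun n => linDiv_eq ha (mw n) (mq n) (ew n) (eq n)]
  refine le_trans (lintegral_mono_ae ?_)
    (lintegral_liminf_le fun n => (measurable_jfun a).comp ((mw n).prodMk (mq n)))
  filter_upwards [hlim_w, hlim_q, ae_density_ne_top mw' ew', ae_density_ne_top mq' eq']
    with y h1 h2 h3 h4
  exact jfun_le_liminf ha h1 h2 h3 h4

/-! ### Priors, their mixtures and mean measures -/

lemma priorMixture_apply (P : ProbabilityMeasure Y →₀ ℝ≥0) (A : Set Y) :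
    priorMixture P A = ∑ W ∈ P.support, (P W : ℝ≥0∞) * (W : Measure Y) A := by
  rw [priorMixture, Measure.finsetSum_apply]
  rfl

lemma coe_sum_eq_one {P : ProbabilityMeasure Y →₀ ℝ≥0} (hP : ∑ W ∈ P.support, P W = 1) :
    ∑ W ∈ P.support, (P W : ℝ≥0∞) = 1 := by exact_mod_cast hP

lemma isProbabilityMeasure_priorMixture {P : ProbabilityMeasure Y →₀ ℝ≥0}
    (hP : ∑ W ∈ P.support, P W = 1) : IsProbabilityMeasure (priorMixture P) := by
  constructor
  rw [priorMixture_apply, ← coe_sum_eq_one hP]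
  simp

instance (P : ProbabilityMeasure Y →₀ ℝ≥0) : IsFiniteMeasure (priorMixture P) := by
  constructor
  rw [priorMixture_apply, ENNReal.sum_lt_top]
  intro W _
  finiteness

lemma smul_le_priorMixture (P : ProbabilityMeasure Y →₀ ℝ≥0) {W : ProbabilityMeasure Y}
    (hW : W ∈ P.support) : P W • (W : Measure Y) ≤ priorMixture P := by
  refine Measure.le_iff'.2 fun A => ?_
  rw [priorMixture_apply]
  exact Finset.single_le_sum (f := fun W : ProbabilityMeasure Y => (P W : ℝ≥0∞) * (W : Measure Y) A)
    (fun _ _ => zero_le) hW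

lemma absolutelyContinuous_priorMixture (P : ProbabilityMeasure Y →₀ ℝ≥0)
    {W : ProbabilityMeasure Y} (hW : W ∈ P.support) : (W : Measure Y) ≪ priorMixture P := by
  refine Measure.AbsolutelyContinuous.trans ?_
    (Measure.absolutelyContinuous_of_le (smul_le_priorMixture P hW))
  exact Measure.absolutelyContinuous_smul (c := (P W : ℝ≥0∞)) (by simpa using hW)

lemma measurable_mixtureDensity (P : ProbabilityMeasure Y →₀ ℝ≥0) (W : ProbabilityMeasure Y) :
    Measurable (mixtureDensity P W) := Measure.measurable_rnDeriv _ _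

lemma withDensity_mixtureDensity (P : ProbabilityMeasure Y →₀ ℝ≥0) {W : ProbabilityMeasure Y}
    (hW : W ∈ P.support) : (priorMixture P).withDensity (mixtureDensity P W) = W :=
  withDensity_rnDeriv_dominated (absolutelyContinuous_priorMixture P hW)

lemma sum_mul_mixtureDensity (P : ProbabilityMeasure Y →₀ ℝ≥0) :
    ∀ᵐ y ∂(priorMixture P), ∑ W ∈ P.support, (P W : ℝ≥0∞) * mixtureDensity P W y = 1 := by
  have hm : Measurable fun y => ∑ W ∈ P.support, (P W : ℝ≥0∞) * mixtureDensity P W y :=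
    Finset.measurable_fun_sum _ fun W _ => (measurable_mixtureDensity P W).const_mul _
  have h : (priorMixture P).withDensity (fun y => ∑ W ∈ P.support,
      (P W : ℝ≥0∞) * mixtureDensity P W y) = (priorMixture P).withDensity 1 := by
    ext A hA
    rw [withDensity_one, withDensity_apply _ hA, priorMixture_apply,
      lintegral_finsetSum _ fun W _ => (measurable_mixtureDensity P W).const_mul _]
    refine Finset.sum_congr rfl fun W hW => ?_
    rw [lintegral_const_mul _ (measurable_mixtureDensity P W), ← withDensity_apply _ hA,
      withDensity_mixtureDensity P hW]
  exact (withDensity_eq_iff_of_sigmaFinite hm.aemeasurable aemeasurable_const).1 h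

/-- Each weighted density is one term of a sum equal to one. This boundedness makes the mean
measures finite and the integrand of the order one information integrable. -/
lemma mixtureDensity_le (P : ProbabilityMeasure Y →₀ ℝ≥0) :
    ∀ᵐ y ∂(priorMixture P), ∀ W ∈ P.support, mixtureDensity P W y ≤ (P W : ℝ≥0∞)⁻¹ := by
  filter_upwards [sum_mul_mixtureDensity P] with y hy W hW
  have h0 : (P W : ℝ≥0∞) ≠ 0 := by simpa using hW
  have h1 : (P W : ℝ≥0∞) * mixtureDensity P W y ≤ 1 := by
    rw [← hy]
    exact Finset.single_le_sum (f := fun W => (P W : ℝ≥0∞) * mixtureDensity P W y)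
      (fun _ _ => zero_le) hW
  rw [mul_comm] at h1
  rw [← one_div]
  exact (ENNReal.le_div_iff_mul_le (Or.inl h0) (Or.inl (by simp))).2 h1

lemma meanDensity_of_ne {α : ℝ≥0∞} (h0 : α ≠ 0) (ht : α ≠ ∞) (P : ProbabilityMeasure Y →₀ ℝ≥0)
    (y : Y) : meanDensity α P y = (∑ W ∈ P.support, (P W : ℝ≥0∞) *
      mixtureDensity P W y ^ α.toReal) ^ (1 / α.toReal) := by
  rw [meanDensity, if_neg h0, if_neg ht]

lemma measurable_meanDensity {α : ℝ≥0∞} (h0 : α ≠ 0) (P : ProbabilityMeasure Y →₀ ℝ≥0) :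
    Measurable (meanDensity α P) := by
  by_cases ht : α = ∞
  · have : meanDensity α P = fun y => P.support.sup fun W => mixtureDensity P W y := by
      ext y
      rw [meanDensity, if_neg h0, if_pos ht]
    rw [this]
    induction P.support using Finset.cons_induction with
    | empty => simp
    | cons W s hW ih =>
      simp only [Finset.sup_cons]
      exact (measurable_mixtureDensity P W).sup ih
  · have : meanDensity α P = fun y => (∑ W ∈ P.support, (P W : ℝ≥0∞) *
        mixtureDensity P W y ^ α.toReal) ^ (1 / α.toReal) := by
      ext y
      rw [meanDensity_of_ne h0 ht]
    rw [this]
    refine Measurable.pow_const (Finset.measurable_fun_sum _ fun W _ => ?_) _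
    exact ((measurable_mixtureDensity P W).pow_const _).const_mul _

lemma meanMeasure_univ_ne_top {α : ℝ≥0∞} (h0 : α ≠ 0) (P : ProbabilityMeasure Y →₀ ℝ≥0) :
    meanMeasure α P Set.univ ≠ ∞ := by
  rw [meanMeasure, withDensity_apply _ MeasurableSet.univ, setLIntegral_univ]
  suffices ∃ C : ℝ≥0∞, C ≠ ∞ ∧ ∀ᵐ y ∂(priorMixture P), meanDensity α P y ≤ C by
    obtain ⟨C, hC, h⟩ := this
    refine ne_top_of_le_ne_top ?_ (lintegral_mono_ae h)
    rw [lintegral_const]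
    finiteness
  have hinv : ∀ W ∈ P.support, (P W : ℝ≥0∞)⁻¹ ≠ ∞ := fun W hW => by
    simpa using hW
  by_cases ht : α = ∞
  · refine ⟨P.support.sup fun W => (P W : ℝ≥0∞)⁻¹, ?_, ?_⟩
    · rw [← lt_top_iff_ne_top, Finset.sup_lt_iff (by simp)]
      exact fun W hW => (hinv W hW).lt_top
    · filter_upwards [mixtureDensity_le P] with y hy
      rw [meanDensity, if_neg h0, if_pos ht]
      exact Finset.sup_mono_fun hy
  · have ha : 0 < α.toReal := ENNReal.toReal_pos h0 ht
    refine ⟨(∑ W ∈ P.support, (P W : ℝ≥0∞) * ((P W : ℝ≥0∞)⁻¹) ^ α.toReal) ^ (1 / α.toReal), ?_, ?_⟩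
    · refine ENNReal.rpow_ne_top_of_nonneg (by positivity) (ENNReal.sum_ne_top.2 fun W hW => ?_)
      exact ENNReal.mul_ne_top (by simp) (ENNReal.rpow_ne_top_of_nonneg ha.le (hinv W hW))
    · filter_upwards [mixtureDensity_le P] with y hy
      rw [meanDensity_of_ne h0 ht]
      gcongr with W hW
      exact hy W hW

lemma meanMeasure_univ_ne_zero {α : ℝ≥0∞} (h0 : α ≠ 0) {P : ProbabilityMeasure Y →₀ ℝ≥0}
    (hP : ∑ W ∈ P.support, P W = 1) : meanMeasure α P Set.univ ≠ 0 := by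
  have := isProbabilityMeasure_priorMixture hP
  rw [meanMeasure, withDensity_apply _ MeasurableSet.univ, setLIntegral_univ, Ne,
    lintegral_eq_zero_iff (measurable_meanDensity h0 P)]
  intro h
  have : ∀ᵐ y ∂(priorMixture P), False := by
    filter_upwards [h, sum_mul_mixtureDensity P] with y h1 h2
    have h3 : ∀ W ∈ P.support, mixtureDensity P W y = 0 := fun W hW => by
      have hPW : (P W : ℝ≥0∞) ≠ 0 := by simpa using hW
      by_cases ht : α = ∞
      · rw [meanDensity, if_neg h0, if_pos ht] at h1
        simp only [Pi.zero_apply, ← ENNReal.bot_eq_zero] at h1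
        exact (Finset.sup_eq_bot_iff _ _).1 h1 W hW
      · have ha : 0 < α.toReal := ENNReal.toReal_pos h0 ht
        rw [meanDensity_of_ne h0 ht] at h1
        simp only [Pi.zero_apply] at h1
        rw [ENNReal.rpow_eq_zero_iff_of_pos (by positivity)] at h1
        have := (Finset.sum_eq_zero_iff.1 h1) W hW
        rw [mul_eq_zero, or_iff_right hPW, ENNReal.rpow_eq_zero_iff_of_pos ha] at this
        exact this
    rw [Finset.sum_eq_zero fun W hW => by rw [h3 W hW, mul_zero]] at h2
    exact zero_ne_one h2
  simp at this
  exact IsProbabilityMeasure.ne_zero _ this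

/-- The mean measure is a positive multiple of a probability measure. -/
lemma exists_meanProb {α : ℝ≥0∞} (h0 : α ≠ 0) {P : ProbabilityMeasure Y →₀ ℝ≥0}
    (hP : ∑ W ∈ P.support, P W = 1) : ∃ q : ProbabilityMeasure Y,
      (q : Measure Y) = (meanMeasure α P Set.univ)⁻¹ • meanMeasure α P := by
  have h1 := meanMeasure_univ_ne_zero h0 hP
  have h2 := meanMeasure_univ_ne_top h0 P
  refine ⟨⟨(meanMeasure α P Set.univ)⁻¹ • meanMeasure α P, ⟨?_⟩⟩, rfl⟩
  rw [Measure.smul_apply, smul_eq_mul, ENNReal.inv_mul_cancel h1 h2]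

/-- Densities of the members of a prior and of a further measure, expressed through the densities
with respect to the mixture. -/
lemma exists_prior_densities (P : ProbabilityMeasure Y →₀ ℝ≥0) (Q : Measure Y) [IsFiniteMeasure Q] :
    ∃ (ρ : Measure Y) (t r : Y → ℝ≥0∞), IsFiniteMeasure ρ ∧ Measurable t ∧ Measurable r ∧
      ρ.withDensity t = priorMixture P ∧ ρ.withDensity r = Q ∧
      ∀ f : Y → ℝ≥0∞, Measurable f →
        ρ.withDensity (fun y => t y * f y) = (priorMixture P).withDensity f := by
  obtain ⟨ρ, t, r, hf, ht, hr, h1, h2⟩ := exists_common_densities (priorMixture P) Q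
  refine ⟨ρ, t, r, hf, ht, hr, h1, h2, fun f hf => ?_⟩
  rw [← h1, ← withDensity_mul _ ht hf]
  rfl

/-! ### Sibson's identity for Hellinger integrals and the compensation identity -/

/-- Sibson's identity for the Hellinger integrals. -/
lemma sum_hellinger_eq {α : ℝ≥0∞} (h0 : α ≠ 0) (ht : α ≠ ∞) {P : ProbabilityMeasure Y →₀ ℝ≥0}
    (hP : ∑ W ∈ P.support, P W = 1) {q : ProbabilityMeasure Y}
    (hq : (q : Measure Y) = (meanMeasure α P Set.univ)⁻¹ • meanMeasure α P)
    (Q : ProbabilityMeasure Y) :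
    ∑ W ∈ P.support, (P W : ℝ≥0∞) * hellinger α.toReal (W : Measure Y) (Q : Measure Y) =
      meanMeasure α P Set.univ ^ α.toReal * hellinger α.toReal (q : Measure Y) (Q : Measure Y) := by
  have ha : 0 < α.toReal := ENNReal.toReal_pos h0 ht
  obtain ⟨ρ, t, r, -, mt, mr, hρt, hρr, hρ⟩ := exists_prior_densities P (Q : Measure Y)
  have hM0 := meanMeasure_univ_ne_zero h0 hP
  have hMt := meanMeasure_univ_ne_top h0 P
  have hqρ : ρ.withDensity (fun y => t y * ((meanMeasure α P Set.univ)⁻¹ * meanDensity α P y)) =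
      q := by
    rw [hρ _ ((measurable_meanDensity h0 P).const_mul _), hq, meanMeasure]
    exact withDensity_smul _ (measurable_meanDensity h0 P)
  have hW : ∀ W ∈ P.support, hellinger α.toReal (W : Measure Y) (Q : Measure Y) =
      ∫⁻ y, (t y * mixtureDensity P W y) ^ α.toReal * r y ^ (1 - α.toReal) ∂ρ := fun W hW => by
    refine hellinger_eq ha (mt.mul (measurable_mixtureDensity P W)) mr ?_ hρr
    rw [hρ _ (measurable_mixtureDensity P W), withDensity_mixtureDensity P hW]
  have hm : ∀ W, Measurable fun y =>
      (t y * mixtureDensity P W y) ^ α.toReal * r y ^ (1 - α.toReal) := fun W => by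
    have := measurable_mixtureDensity P W
    fun_prop
  have mf := measurable_meanDensity h0 P
  rw [hellinger_eq ha (mt.mul ((measurable_meanDensity h0 P).const_mul _)) mr hqρ hρr,
    ← lintegral_const_mul _ (by fun_prop),
    Finset.sum_congr rfl fun W h => by rw [hW W h, ← lintegral_const_mul _ (hm W)],
    ← lintegral_finsetSum _ fun W _ => (hm W).const_mul _]
  refine lintegral_congr fun y => ?_
  simp only [Pi.mul_apply]
  rw [meanDensity_of_ne h0 ht]
  have h1 : (meanMeasure α P Set.univ) ^ α.toReal * ((meanMeasure α P Set.univ)⁻¹) ^ α.toReal = 1 := by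
    rw [← ENNReal.mul_rpow_of_nonneg _ _ ha.le, ENNReal.mul_inv_cancel hM0 hMt, ENNReal.one_rpow]
  simp_rw [ENNReal.mul_rpow_of_nonneg _ _ ha.le]
  -- The order `α` power of the mean density is by construction the weighted sum of the powers of
  -- the member densities, so the two integrands agree at every point.
  rw [← ENNReal.rpow_mul, one_div, inv_mul_cancel₀ ha.ne', ENNReal.rpow_one]
  calc _ = t y ^ α.toReal * r y ^ (1 - α.toReal) *
        ∑ W ∈ P.support, (P W : ℝ≥0∞) * mixtureDensity P W y ^ α.toReal := by
        rw [Finset.mul_sum]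
        exact Finset.sum_congr rfl fun W _ => by ring
    _ = (meanMeasure α P Set.univ ^ α.toReal * ((meanMeasure α P Set.univ)⁻¹) ^ α.toReal) *
        (t y ^ α.toReal * r y ^ (1 - α.toReal) *
        ∑ W ∈ P.support, (P W : ℝ≥0∞) * mixtureDensity P W y ^ α.toReal) := by rw [h1, one_mul]
    _ = _ := by ring

lemma mul_klFun_div {w q : ℝ} (hq : 0 < q) :
    q * InformationTheory.klFun (w / q) = w * Real.log (w / q) + q - w := by
  rw [InformationTheory.klFun]
  field_simp

/-- The pointwise compensation identity. -/
lemma sum_jfun_one {ι : Type*} (s : Finset ι) (p : ι → ℝ≥0) (hp : ∑ i ∈ s, p i = 1)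
    (w : ι → ℝ≥0∞) (hw : ∀ i ∈ s, w i ≠ ∞) (q : ℝ≥0∞) (hq : q ≠ ∞) :
    ∑ i ∈ s, (p i : ℝ≥0∞) * jfun 1 (w i) q =
      ∑ i ∈ s, (p i : ℝ≥0∞) * jfun 1 (w i) (∑ i ∈ s, (p i : ℝ≥0∞) * w i) +
        jfun 1 (∑ i ∈ s, (p i : ℝ≥0∞) * w i) q := by
  set m : ℝ≥0∞ := ∑ i ∈ s, (p i : ℝ≥0∞) * w i with hm
  have hmt : m ≠ ∞ := ENNReal.sum_ne_top.2 fun i hi => ENNReal.mul_ne_top (by simp) (hw i hi)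
  have hp' : ∑ i ∈ s, (p i : ℝ≥0∞) = 1 := by exact_mod_cast hp
  by_cases hm0 : m = 0
  · have hz : ∀ i ∈ s, (p i : ℝ≥0∞) = 0 ∨ w i = 0 := fun i hi => by
      have := (Finset.sum_eq_zero_iff.1 (hm.symm.trans hm0)) i hi
      rwa [mul_eq_zero] at this
    rw [hm0]
    have h1 : ∀ i ∈ s, (p i : ℝ≥0∞) * jfun 1 (w i) q = (p i : ℝ≥0∞) * jfun 1 0 q := fun i hi => by
      rcases hz i hi with h | h
      · simp [h]
      · rw [h]
    have h2 : ∀ i ∈ s, (p i : ℝ≥0∞) * jfun 1 (w i) 0 = 0 := fun i hi => by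
      rcases hz i hi with h | h
      · simp [h]
      · simp [h, jfun_one]
    rw [Finset.sum_congr rfl h1, Finset.sum_congr rfl h2, ← Finset.sum_mul, hp']
    simp
  · by_cases hq0 : q = 0
    · obtain ⟨i, hi, h⟩ := Finset.exists_ne_zero_of_sum_ne_zero (hm ▸ hm0)
      have h1 : (p i : ℝ≥0∞) * jfun 1 (w i) q = ∞ := by
        rw [hq0, jfun_one, if_pos rfl, if_neg (right_ne_zero_of_mul h),
          ENNReal.mul_top (left_ne_zero_of_mul h)]
      have h2 : jfun 1 m q = ∞ := by rw [hq0, jfun_one, if_pos rfl, if_neg hm0]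
      rw [h2, add_top, ENNReal.sum_eq_top]
      exact ⟨i, hi, h1⟩
    · have hqr : 0 < q.toReal := ENNReal.toReal_pos hq0 hq
      have hmr : 0 < m.toReal := ENNReal.toReal_pos hm0 hmt
      have key : ∀ z : ℝ≥0∞, z ≠ 0 → z ≠ ∞ → ∑ i ∈ s, (p i : ℝ≥0∞) * jfun 1 (w i) z =
          ENNReal.ofReal (∑ i ∈ s, (p i : ℝ) *
            (z.toReal * InformationTheory.klFun ((w i).toReal / z.toReal))) := by
        intro z hz _
        have hnn : ∀ i, 0 ≤ z.toReal * InformationTheory.klFun ((w i).toReal / z.toReal) := fun i =>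
          mul_nonneg ENNReal.toReal_nonneg (InformationTheory.klFun_nonneg (by positivity))
        rw [ENNReal.ofReal_sum_of_nonneg fun i _ => mul_nonneg (p i).coe_nonneg (hnn i)]
        refine Finset.sum_congr rfl fun i _ => ?_
        rw [jfun_one, if_neg hz, ENNReal.ofReal_mul (p i).coe_nonneg, ENNReal.ofReal_coe_nnreal]
      rw [key q hq0 hq, key m hm0 hmt, jfun_one, if_neg hq0, ← ENNReal.ofReal_add
        (Finset.sum_nonneg fun i _ => mul_nonneg (p i).coe_nonneg (mul_nonneg hmr.le
          (InformationTheory.klFun_nonneg (by positivity))))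
        (mul_nonneg hqr.le (InformationTheory.klFun_nonneg (by positivity)))]
      congr 1
      have hsum : m.toReal = ∑ i ∈ s, (p i : ℝ) * (w i).toReal := by
        rw [hm, ENNReal.toReal_sum fun i hi => ENNReal.mul_ne_top (by simp) (hw i hi)]
        simp
      have hpr : ∑ i ∈ s, (p i : ℝ) = 1 := by exact_mod_cast hp
      -- The logarithm of `w / q` splits through `m`, and the cross terms sum to `jfun 1 m q`. At `w
      -- i = 0` the logarithms do not split, but their coefficient is zero.
      have hterm : ∀ i ∈ s, (p i : ℝ) * (q.toReal * InformationTheory.klFun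
          ((w i).toReal / q.toReal)) = (p i : ℝ) * (m.toReal * InformationTheory.klFun
          ((w i).toReal / m.toReal)) + ((p i : ℝ) * (w i).toReal * Real.log (m.toReal / q.toReal) +
            (p i : ℝ) * (q.toReal - m.toReal)) := fun i _ => by
        rw [mul_klFun_div hqr, mul_klFun_div hmr]
        rcases (ENNReal.toReal_nonneg (a := w i)).eq_or_lt with h | h
        · rw [← h]; simp; ring
        · rw [Real.log_div h.ne' hqr.ne', Real.log_div h.ne' hmr.ne',
            Real.log_div hmr.ne' hqr.ne']
          ring
      rw [Finset.sum_congr rfl hterm, Finset.sum_add_distrib, Finset.sum_add_distrib,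
        ← Finset.sum_mul, ← Finset.sum_mul, hpr, ← hsum, mul_klFun_div hqr]
      ring

/-- The compensation identity for the Kullback-Leibler divergence. -/
lemma sum_linDiv_one {P : ProbabilityMeasure Y →₀ ℝ≥0} (hP : ∑ W ∈ P.support, P W = 1)
    (Q : ProbabilityMeasure Y) :
    ∑ W ∈ P.support, (P W : ℝ≥0∞) * linDiv 1 (W : Measure Y) (Q : Measure Y) =
      ∑ W ∈ P.support, (P W : ℝ≥0∞) * linDiv 1 (W : Measure Y) (priorMixture P) +
        linDiv 1 (priorMixture P) (Q : Measure Y) := by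
  have hprob := isProbabilityMeasure_priorMixture hP
  obtain ⟨ρ, t, r, -, mt, mr, hρt, hρr, hρ⟩ := exists_prior_densities P (Q : Measure Y)
  have hw : ∀ W ∈ P.support, ρ.withDensity (fun y => t y * mixtureDensity P W y) = W :=
    fun W hW => by rw [hρ _ (measurable_mixtureDensity P W), withDensity_mixtureDensity P hW]
  have mw : ∀ W, Measurable fun y => t y * mixtureDensity P W y := fun W =>
    mt.mul (measurable_mixtureDensity P W)
  have mj : ∀ W, ∀ z : Y → ℝ≥0∞, Measurable z →
      Measurable fun y => jfun 1 (t y * mixtureDensity P W y) (z y) := fun W z hz =>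
    (measurable_jfun 1).comp ((mw W).prodMk hz)
  have mjt : Measurable fun y => jfun 1 (t y) (r y) := (measurable_jfun 1).comp (mt.prodMk mr)
  have h1 : ∀ W ∈ P.support, (P W : ℝ≥0∞) * linDiv 1 (W : Measure Y) (Q : Measure Y) =
      ∫⁻ y, (P W : ℝ≥0∞) * jfun 1 (t y * mixtureDensity P W y) (r y) ∂ρ := fun W hW => by
    rw [linDiv_eq one_pos (mw W) mr (hw W hW) hρr, lintegral_const_mul _ (mj W r mr)]
  have h2 : ∀ W ∈ P.support, (P W : ℝ≥0∞) * linDiv 1 (W : Measure Y) (priorMixture P) =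
      ∫⁻ y, (P W : ℝ≥0∞) * jfun 1 (t y * mixtureDensity P W y) (t y) ∂ρ := fun W hW => by
    rw [linDiv_eq one_pos (mw W) mt (hw W hW) hρt, lintegral_const_mul _ (mj W t mt)]
  rw [Finset.sum_congr rfl h1, Finset.sum_congr rfl h2, linDiv_eq one_pos mt mr hρt hρr,
    ← lintegral_finsetSum _ fun W _ => (mj W r mr).const_mul _,
    ← lintegral_finsetSum _ fun W _ => (mj W t mt).const_mul _,
    ← lintegral_add_right _ mjt]
  have hae : ∀ᵐ y ∂ρ, t y ≠ 0 → (∑ W ∈ P.support, (P W : ℝ≥0∞) * mixtureDensity P W y = 1 ∧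
      ∀ W ∈ P.support, mixtureDensity P W y ≤ (P W : ℝ≥0∞)⁻¹) := by
    rw [← ae_withDensity_iff mt, hρt]
    exact (sum_mul_mixtureDensity P).and (mixtureDensity_le P)
  refine lintegral_congr_ae ?_
  filter_upwards [hae, ae_density_ne_top mt hρt, ae_density_ne_top mr hρr] with y h3 h4 h5
  have hsum : ∑ W ∈ P.support, (P W : ℝ≥0∞) * (t y * mixtureDensity P W y) = t y := by
    by_cases h0 : t y = 0
    · simp [h0]
    · simp_rw [mul_left_comm _ (t y)]
      rw [← Finset.mul_sum, (h3 h0).1, mul_one]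
  have hfin : ∀ W ∈ P.support, t y * mixtureDensity P W y ≠ ∞ := fun W hW => by
    by_cases h0 : t y = 0
    · simp [h0]
    · exact ENNReal.mul_ne_top h4 (ne_top_of_le_ne_top (by simpa using hW) ((h3 h0).2 W hW))
  have := sum_jfun_one P.support P hP (fun W => t y * mixtureDensity P W y) hfin (r y) h5
  rwa [hsum] at this

/-- From `1 - x⁻¹ ≤ log x ≤ x - 1` one gets `x - 1 ≤ x log x ≤ x (x - 1)`. -/
lemma abs_mul_log_le {x B : ℝ} (hx : 0 ≤ x) (hxB : x ≤ B) : |x * Real.log x| ≤ B ^ 2 + 1 := by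
  rcases hx.eq_or_lt with rfl | h
  · simp; positivity
  · have h1 := Real.log_le_sub_one_of_pos h
    have h2 := Real.one_sub_inv_le_log_of_pos h
    have h3 : x * (1 - x⁻¹) = x - 1 := by field_simp
    have h4 := mul_le_mul_of_nonneg_left h2 h.le
    rw [abs_le]
    constructor <;> nlinarith

/-- The order one Rényi information is the mean divergence from the mixture. -/
lemma renyiInfo_one {P : ProbabilityMeasure Y →₀ ℝ≥0} (hP : ∑ W ∈ P.support, P W = 1) :
    renyiInfo 1 P = ((∑ W ∈ P.support, (P W : ℝ≥0∞) *
      linDiv 1 (W : Measure Y) (priorMixture P) : ℝ≥0∞) : EReal) := by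
  have hprob := isProbabilityMeasure_priorMixture hP
  rw [renyiInfo, if_neg one_ne_zero, if_pos rfl]
  have hint : ∀ W ∈ P.support, Integrable (fun y => (mixtureDensity P W y).toReal *
      Real.log (mixtureDensity P W y).toReal) (priorMixture P) := fun W hW => by
    have hm := (measurable_mixtureDensity P W).ennreal_toReal
    refine Integrable.of_bound (C := ((P W : ℝ≥0∞)⁻¹).toReal ^ 2 + 1)
      (hm.mul hm.log).aestronglyMeasurable ?_
    filter_upwards [mixtureDensity_le P] with y hy
    exact abs_mul_log_le ENNReal.toReal_nonneg
      (ENNReal.toReal_mono (by simpa using hW) (hy W hW))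
  have hint' : ∀ W ∈ P.support, Integrable (fun y => (mixtureDensity P W y).toReal)
      (priorMixture P) := fun W hW => by
    refine integrable_toReal_of_lintegral_ne_top (measurable_mixtureDensity P W).aemeasurable ?_
    rw [lintegral_density_eq_one (withDensity_mixtureDensity P hW)]
    simp
  have hint1 : ∀ W ∈ P.support, Integrable (fun y => (mixtureDensity P W y).toReal *
      Real.log (mixtureDensity P W y).toReal + 1) (priorMixture P) := fun W hW =>
    (hint W hW).add (integrable_const _)
  have hI1 : ∀ W ∈ P.support, ∫ y, (mixtureDensity P W y).toReal ∂(priorMixture P) = 1 :=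
    fun W hW => by
      rw [integral_toReal (measurable_mixtureDensity P W).aemeasurable
        ((ae_density_ne_top (measurable_mixtureDensity P W)
          (withDensity_mixtureDensity P hW)).mono fun y hy => hy.lt_top),
        lintegral_density_eq_one (withDensity_mixtureDensity P hW), ENNReal.toReal_one]
  -- The function `klFun x` differs from `x log x` by `1 - x`, which integrates to zero when `x` is
  -- a probability density. The nonnegativity recorded here is what allows the real sum to be moved
  -- into `ℝ≥0∞`.
  have hkl : ∀ W ∈ P.support, linDiv 1 (W : Measure Y) (priorMixture P) = ENNReal.ofReal
      (∫ y, (mixtureDensity P W y).toReal * Real.log (mixtureDensity P W y).toReal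
        ∂(priorMixture P)) ∧ 0 ≤ ∫ y, (mixtureDensity P W y).toReal *
          Real.log (mixtureDensity P W y).toReal ∂(priorMixture P) := fun W hW => by
    have e : ∫ y, InformationTheory.klFun (mixtureDensity P W y).toReal ∂(priorMixture P) =
        ∫ y, (mixtureDensity P W y).toReal * Real.log (mixtureDensity P W y).toReal
          ∂(priorMixture P) := by
      simp_rw [InformationTheory.klFun]
      rw [integral_sub (hint1 W hW) (hint' W hW),
        integral_add (hint W hW) (integrable_const _), hI1 W hW]
      simp
    have hnn : ∀ y, 0 ≤ InformationTheory.klFun (mixtureDensity P W y).toReal := fun y =>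
      InformationTheory.klFun_nonneg ENNReal.toReal_nonneg
    refine ⟨?_, e ▸ integral_nonneg hnn⟩
    rw [linDiv_one_eq_klDiv, InformationTheory.klDiv_eq_lintegral_klFun_of_ac
      (absolutelyContinuous_priorMixture P hW), ← e, ofReal_integral_eq_lintegral_ofReal _
        (Eventually.of_forall hnn)]
    · rfl
    · simp_rw [InformationTheory.klFun]
      exact (hint1 W hW).sub (hint' W hW)
  have h1 : ∫ y, ∑ W ∈ P.support, posterior P W y * Real.log (posterior P W y / P W)
      ∂(priorMixture P) = ∑ W ∈ P.support, (P W : ℝ) * ∫ y, (mixtureDensity P W y).toReal *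
        Real.log (mixtureDensity P W y).toReal ∂(priorMixture P) := by
    rw [← Finset.sum_congr rfl fun W hW => integral_const_mul (P W : ℝ) _,
      ← integral_finsetSum _ fun W hW => (hint W hW).const_mul _]
    refine integral_congr_ae (Eventually.of_forall fun y => Finset.sum_congr rfl fun W hW => ?_)
    have h0 : (P W : ℝ) ≠ 0 := by simpa using hW
    simp only [posterior]
    rw [mul_div_cancel_left₀ _ h0, mul_assoc]
  have h2 : ∀ W ∈ P.support, (P W : ℝ≥0∞) * linDiv 1 (W : Measure Y) (priorMixture P) =
      ENNReal.ofReal ((P W : ℝ) * ∫ y, (mixtureDensity P W y).toReal *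
        Real.log (mixtureDensity P W y).toReal ∂(priorMixture P)) := fun W hW => by
    rw [(hkl W hW).1, ENNReal.ofReal_mul (P W).coe_nonneg, ENNReal.ofReal_coe_nnreal]
  rw [h1, Finset.sum_congr rfl h2]
  have hnn : ∀ W ∈ P.support, 0 ≤ (P W : ℝ) * ∫ y, (mixtureDensity P W y).toReal *
        Real.log (mixtureDensity P W y).toReal ∂(priorMixture P) := fun W hW =>
    mul_nonneg (P W).coe_nonneg (hkl W hW).2
  rw [← ENNReal.ofReal_sum_of_nonneg hnn, EReal.coe_ennreal_ofReal,
    max_eq_left (Finset.sum_nonneg hnn)]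

/-! ### The gauge between the linearised and the logarithmic scale -/

/-- With a real factor and one real summand no sum of opposite infinities can arise, so
distributivity survives for either sign of the factor. -/
lemma EReal.coe_mul_coe_add (c x : ℝ) (y : EReal) :
    (c : EReal) * (x + y) = c * x + c * y := by
  induction y with
  | bot =>
    rcases lt_trichotomy c 0 with h | rfl | h
    · rw [EReal.add_bot, EReal.coe_mul_bot_of_neg h, ← EReal.coe_mul, EReal.coe_add_top]
    · simp
    · rw [EReal.add_bot, EReal.coe_mul_bot_of_pos h, EReal.add_bot]
  | coe y => norm_cast; ring
  | top =>
    rcases lt_trichotomy c 0 with h | rfl | h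
    · rw [EReal.coe_add_top, EReal.coe_mul_top_of_neg h, EReal.add_bot]
    · simp
    · rw [EReal.coe_add_top, EReal.coe_mul_top_of_pos h, ← EReal.coe_mul, EReal.coe_add_top]

lemma EReal.continuous_const_mul (c : ℝ) : Continuous fun x : EReal => (c : EReal) * x := by
  by_cases hc : c = 0
  · simp [hc, continuous_const]
  · refine continuous_iff_continuousAt.2 fun x => ?_
    have h := EReal.continuousAt_mul (p := ((c : EReal), x)) (Or.inl (by simpa using hc))
      (Or.inl (by simpa using hc)) (Or.inl (by simp)) (Or.inl (by simp))
    exact ContinuousAt.comp (f := fun x : EReal => ((c : EReal), x)) h (by fun_prop)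

/-- The affine function `x ↦ 1 + β x` on the extended nonnegative reals. -/
def expGauge (β : ℝ) (x : ℝ≥0∞) : ℝ≥0∞ :=
  if 0 ≤ β then 1 + ENNReal.ofReal β * x else 1 - ENNReal.ofReal (-β) * x

/-- The function that recovers a Rényi divergence from its linearisation. -/
def logGauge (β : ℝ) (x : ℝ≥0∞) : EReal :=
  if β = 0 then (x : EReal) else ((1 / β : ℝ) : EReal) * ENNReal.log (expGauge β x)

lemma expGauge_of_nonneg {β : ℝ} (h : 0 ≤ β) (x : ℝ≥0∞) :
    expGauge β x = 1 + ENNReal.ofReal β * x := if_pos h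

lemma expGauge_of_neg {β : ℝ} (h : β < 0) (x : ℝ≥0∞) :
    expGauge β x = 1 - ENNReal.ofReal (-β) * x := if_neg h.not_ge

lemma expGauge_zero_right (β : ℝ) : expGauge β 0 = 1 := by
  unfold expGauge
  split_ifs <;> simp

lemma continuous_expGauge (β : ℝ) : Continuous (expGauge β) := by
  rcases le_or_gt 0 β with h | h
  · simp_rw [funext (expGauge_of_nonneg h)]
    exact continuous_const.add (ENNReal.continuous_const_mul (by simp))
  · simp_rw [funext (expGauge_of_neg h)]
    exact (ENNReal.continuous_sub_left (by simp)).comp (ENNReal.continuous_const_mul (by simp))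

lemma expGauge_ne_top (β : ℝ) {x : ℝ≥0∞} (hx : x ≠ ∞) : expGauge β x ≠ ∞ := by
  unfold expGauge
  split_ifs <;> finiteness

/-- Provides one positive lower bound for the slopes of all priors, whatever the sign of `β`. -/
lemma min_one_expGauge_le (β : ℝ) {x κ : ℝ≥0∞} (hx : x ≤ κ) :
    min 1 (expGauge β κ) ≤ expGauge β x := by
  rcases le_or_gt 0 β with h | h
  · rw [expGauge_of_nonneg h x]
    exact (min_le_left _ _).trans le_self_add
  · rw [expGauge_of_neg h x, expGauge_of_neg h κ]
    refine (min_le_right _ _).trans ?_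
    gcongr

/-- This is the identity 1 + β(K + (1 + βK)x) = (1 + βK)(1 + βx). After taking logarithms it turns
the linearised Sibson bound into the additive one. For negative `β` it survives truncation, since
subtracting a sum is subtracting twice. -/
lemma expGauge_add (β : ℝ) {K : ℝ≥0∞} (x : ℝ≥0∞) :
    expGauge β (K + expGauge β K * x) = expGauge β K * expGauge β x := by
  rcases le_or_gt 0 β with h | h
  · simp only [expGauge_of_nonneg h]
    ring
  · simp only [expGauge_of_neg h]
    rw [ENNReal.mul_sub fun _ _ => ne_top_of_le_ne_top ENNReal.one_ne_top tsub_le_self, mul_one,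
      mul_add, tsub_add_eq_tsub_tsub]
    congr 1
    ring

lemma continuous_logGauge (β : ℝ) : Continuous (logGauge β) := by
  unfold logGauge
  split_ifs
  · exact continuous_coe_ennreal_ereal
  · exact (EReal.continuous_const_mul _).comp
      (ENNReal.continuous_log.comp (continuous_expGauge β))

lemma monotone_logGauge (β : ℝ) : Monotone (logGauge β) := by
  intro x y hxy
  unfold logGauge
  split_ifs with h
  · exact EReal.coe_ennreal_le_coe_ennreal_iff.2 hxy
  · rcases lt_or_gt_of_ne h with h | h
    · rw [expGauge_of_neg h, expGauge_of_neg h]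
      have hpos : (0 : EReal) ≤ ((-(1 / β) : ℝ) : EReal) := by
        exact_mod_cast (neg_pos.2 (one_div_neg.2 h)).le
      have h1 : ENNReal.log (1 - ENNReal.ofReal (-β) * y) ≤
          ENNReal.log (1 - ENNReal.ofReal (-β) * x) := ENNReal.log_monotone (by gcongr)
      have h2 := mul_le_mul_of_nonneg_left h1 hpos
      rw [EReal.coe_neg, neg_mul, neg_mul] at h2
      exact EReal.neg_le_neg_iff.1 h2
    · rw [expGauge_of_nonneg h.le, expGauge_of_nonneg h.le]
      have hpos : (0 : EReal) ≤ ((1 / β : ℝ) : EReal) := by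
        exact_mod_cast (one_div_pos.2 h).le
      exact mul_le_mul_of_nonneg_left (ENNReal.log_monotone (by gcongr)) hpos

lemma logGauge_zero_right (β : ℝ) : logGauge β 0 = 0 := by
  unfold logGauge
  split_ifs <;> simp [expGauge_zero_right]

lemma eq_zero_of_logGauge_eq_zero {β : ℝ} {x : ℝ≥0∞} (h : logGauge β x = 0) : x = 0 := by
  unfold logGauge at h
  split_ifs at h with hβ
  · exact_mod_cast h
  · have hne : ((1 / β : ℝ) : EReal) ≠ 0 := by simpa using hβ
    have h1 : expGauge β x = 1 := by
      rcases mul_eq_zero.1 h with h | h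
      · exact absurd h hne
      · simpa using h
    rcases lt_or_gt_of_ne hβ with hβ | hβ
    · rw [expGauge_of_neg hβ] at h1
      by_contra hx
      have h2 : ENNReal.ofReal (-β) * x ≠ 0 := mul_ne_zero (by simpa using hβ) hx
      exact (ENNReal.sub_lt_self (by simp) (by simp) h2).ne h1
    · rw [expGauge_of_nonneg hβ.le] at h1
      have h2 : ENNReal.ofReal β * x = 0 := by
        nth_rewrite 2 [← add_zero (1 : ℝ≥0∞)] at h1
        exact (ENNReal.add_right_inj (by simp)).1 h1
      exact (mul_eq_zero.1 h2).resolve_left (by simpa using hβ)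

/-- For negative `β` the gauge becomes infinite already where `expGauge` reaches zero, so finiteness
of the capacity has to be converted into two conditions on the linearised value. -/
lemma ne_top_of_logGauge_lt_top {β : ℝ} {x : ℝ≥0∞} (h : logGauge β x < ⊤) :
    x ≠ ∞ ∧ expGauge β x ≠ 0 := by
  unfold logGauge at h
  split_ifs at h with hβ
  · refine ⟨by rintro rfl; simp at h, ?_⟩
    rw [expGauge_of_nonneg hβ.ge]
    simp
  · rcases lt_or_gt_of_ne hβ with hβ | hβ
    · have h0 : expGauge β x ≠ 0 := by
        intro h0
        rw [h0, ENNReal.log_zero, EReal.coe_mul_bot_of_neg (one_div_neg.2 hβ)] at h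
        exact lt_irrefl _ h
      refine ⟨?_, h0⟩
      rintro rfl
      apply h0
      rw [expGauge_of_neg hβ, ENNReal.mul_top (by simpa using hβ)]
      simp
    · refine ⟨?_, by rw [expGauge_of_nonneg hβ.le]; simp⟩
      rintro rfl
      rw [expGauge_of_nonneg hβ.le, ENNReal.mul_top (by simpa using hβ), add_top, ENNReal.log_top,
        EReal.coe_mul_top_of_pos (one_div_pos.2 hβ)] at h
      exact lt_irrefl _ h

lemma logGauge_add {β : ℝ} {K : ℝ≥0∞} (hK : K ≠ ∞) (hK0 : expGauge β K ≠ 0) (x : ℝ≥0∞) :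
    logGauge β (K + expGauge β K * x) = logGauge β K + logGauge β x := by
  unfold logGauge
  split_ifs with hβ
  · rw [hβ, expGauge_of_nonneg le_rfl]
    simp
  · rw [expGauge_add, ENNReal.log_mul_add, ENNReal.log_pos_real hK0 (expGauge_ne_top β hK),
      EReal.coe_mul_coe_add]

/-! ### The linearised divergence for all orders -/

/-- Reduces order `∞` to the order on measures, so that later arguments need no densities. A finite
bound `c` excludes points with `q = 0 < w`, where the quotient is infinite; `0 / 0 = 0` is harmless.
-/
lemma essSup_div_le_iff (W Q : ProbabilityMeasure Y) {c : ℝ≥0∞} (hc : c ≠ ∞) :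
    essSup (fun y => (W : Measure Y).rnDeriv ((W : Measure Y) + (Q : Measure Y)) y /
      (Q : Measure Y).rnDeriv ((W : Measure Y) + (Q : Measure Y)) y)
      ((W : Measure Y) + (Q : Measure Y)) ≤ c ↔ (W : Measure Y) ≤ c • (Q : Measure Y) := by
  obtain ⟨hW, hQ⟩ := exists_densities (W : Measure Y) (Q : Measure Y)
  have mw := Measure.measurable_rnDeriv (W : Measure Y) ((W : Measure Y) + (Q : Measure Y))
  have mq := Measure.measurable_rnDeriv (Q : Measure Y) ((W : Measure Y) + (Q : Measure Y))
  have hcQ : ((W : Measure Y) + (Q : Measure Y)).withDensity (fun y =>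
      c * (Q : Measure Y).rnDeriv ((W : Measure Y) + (Q : Measure Y)) y) = c • (Q : Measure Y) := by
    conv_rhs => rw [← hQ]
    exact withDensity_smul c mq
  constructor
  · intro h
    rw [← hcQ]
    conv_lhs => rw [← hW]
    refine withDensity_mono ?_
    filter_upwards [ENNReal.ae_le_essSup (μ := (W : Measure Y) + (Q : Measure Y)) (fun y =>
      (W : Measure Y).rnDeriv ((W : Measure Y) + (Q : Measure Y)) y /
      (Q : Measure Y).rnDeriv ((W : Measure Y) + (Q : Measure Y)) y),
      ae_density_ne_top mq hQ] with y h1 h2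
    exact (ENNReal.div_le_iff_le_mul (Or.inr hc) (Or.inl h2)).1 (h1.trans h)
  · intro h
    refine essSup_le_of_ae_le c ?_
    have h1 : ∀ᵐ y ∂((W : Measure Y) + (Q : Measure Y)),
        (W : Measure Y).rnDeriv ((W : Measure Y) + (Q : Measure Y)) y ≤
          c * (Q : Measure Y).rnDeriv ((W : Measure Y) + (Q : Measure Y)) y := by
      refine ae_le_of_forall_setLIntegral_le_of_sigmaFinite mw fun s hs _ => ?_
      rw [← withDensity_apply _ hs, ← withDensity_apply _ hs, hW, hcQ]
      exact h s
    filter_upwards [h1, ae_density_ne_top mq hQ] with y h2 h3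
    exact (ENNReal.div_le_iff_le_mul (Or.inr hc) (Or.inl h3)).2 h2

/-- The linearised Rényi divergence of order `α ∈ (0, ∞]`. -/
def linRenyi (α : ℝ≥0∞) (W Q : ProbabilityMeasure Y) : ℝ≥0∞ :=
  if α = ∞ then
    essSup (fun y => (W : Measure Y).rnDeriv ((W : Measure Y) + (Q : Measure Y)) y /
      (Q : Measure Y).rnDeriv ((W : Measure Y) + (Q : Measure Y)) y)
      ((W : Measure Y) + (Q : Measure Y)) - 1
  else linDiv α.toReal (W : Measure Y) (Q : Measure Y)

/-- The slope of the gauge that linearises the Rényi divergence of order `α`. -/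
def gaugeSlope (α : ℝ≥0∞) : ℝ := if α = ∞ then 1 else α.toReal - 1

lemma one_le_of_le_smul {W Q : ProbabilityMeasure Y} {c : ℝ≥0∞}
    (h : (W : Measure Y) ≤ c • (Q : Measure Y)) : 1 ≤ c := by
  have := h Set.univ
  simpa using this

lemma one_le_essSup_div (W Q : ProbabilityMeasure Y) :
    1 ≤ essSup (fun y => (W : Measure Y).rnDeriv ((W : Measure Y) + (Q : Measure Y)) y /
      (Q : Measure Y).rnDeriv ((W : Measure Y) + (Q : Measure Y)) y)
      ((W : Measure Y) + (Q : Measure Y)) := by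
  by_contra! h
  exact absurd (one_le_of_le_smul ((essSup_div_le_iff W Q h.ne_top).1 le_rfl)) h.not_ge

lemma linRenyi_top_le_iff {W Q : ProbabilityMeasure Y} {c : ℝ≥0∞} (hc : c ≠ ∞) :
    linRenyi ∞ W Q ≤ c ↔ (W : Measure Y) ≤ (1 + c) • (Q : Measure Y) := by
  rw [linRenyi, if_pos rfl, tsub_le_iff_left]
  exact essSup_div_le_iff W Q (by finiteness)

lemma linRenyi_of_ne_top {α : ℝ≥0∞} (ht : α ≠ ∞) (W Q : ProbabilityMeasure Y) :
    linRenyi α W Q = linDiv α.toReal (W : Measure Y) (Q : Measure Y) := if_neg ht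

lemma gaugeSlope_of_ne_top {α : ℝ≥0∞} (ht : α ≠ ∞) : gaugeSlope α = α.toReal - 1 := if_neg ht

lemma gaugeSlope_top : gaugeSlope ∞ = 1 := if_pos rfl

lemma hellinger_eq_expGauge {a : ℝ} (ha : 0 < a) (ha1 : a ≠ 1) (W Q : Measure Y)
    [IsProbabilityMeasure W] [IsProbabilityMeasure Q] :
    hellinger a W Q = expGauge (a - 1) (linDiv a W Q) := by
  rcases lt_or_gt_of_ne ha1 with h | h
  · rw [expGauge_of_neg (by linarith), neg_sub, ← hellinger_add_of_lt_one ha h W Q]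
    refine (ENNReal.add_sub_cancel_right (ne_top_of_le_ne_top ENNReal.one_ne_top ?_)).symm
    rw [← hellinger_add_of_lt_one ha h W Q]
    exact le_add_self
  · rw [expGauge_of_nonneg (by linarith), hellinger_of_one_lt h]

/-- The Rényi divergence is a function of its linearisation. -/
theorem renyiDiv_eq_logGauge {α : ℝ≥0∞} (h0 : α ≠ 0) (W Q : ProbabilityMeasure Y) :
    renyiDiv α W Q = logGauge (gaugeSlope α) (linRenyi α W Q) := by
  by_cases ht : α = ∞
  · subst ht
    rw [renyiDiv, if_neg h0, if_neg (by simp), if_pos rfl, gaugeSlope_top, logGauge,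
      if_neg one_ne_zero, expGauge_of_nonneg zero_le_one, linRenyi, if_pos rfl]
    simp only [ENNReal.ofReal_one, one_mul, div_one, EReal.coe_one]
    rw [add_tsub_cancel_of_le (one_le_essSup_div W Q)]
  · have ha : 0 < α.toReal := ENNReal.toReal_pos h0 ht
    rw [renyiDiv, if_neg h0, gaugeSlope_of_ne_top ht, linRenyi_of_ne_top ht, logGauge]
    by_cases h1 : α = 1
    · subst h1
      rw [if_pos rfl, if_pos (by simp), ENNReal.toReal_one, linDiv_one_eq_klDiv]
    · have h2 : α.toReal ≠ 1 := by
        rw [Ne, ENNReal.toReal_eq_one_iff]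
        exact h1
      rw [if_neg h1, if_neg ht, if_neg (by rwa [sub_eq_zero]), ← hellinger_eq_expGauge ha h2]
      rfl

lemma linDiv_self {a : ℝ} (ha : 0 < a) (W : ProbabilityMeasure Y) :
    linDiv a (W : Measure Y) (W : Measure Y) = 0 := by
  have h0 : jfun a 1 1 = 0 := by
    rcases lt_trichotomy a 1 with h | rfl | h
    · rw [jfun_of_lt_one h]
      simp [← ENNReal.ofReal_add ha.le (by linarith : 0 ≤ 1 - a)]
    · simp [jfun_one, InformationTheory.klFun_one]
    · rw [jfun_of_one_lt h, ENNReal.div_eq_zero_iff]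
      left
      simp only [ENNReal.one_rpow, mul_one]
      rw [← ENNReal.ofReal_one, ← ENNReal.ofReal_add zero_le_one (by linarith)]
      simp
  rw [linDiv_eq ha (measurable_const (a := 1)) (measurable_const (a := 1)) (ν := (W : Measure Y))
    (by exact withDensity_one) (by exact withDensity_one)]
  simp [h0]

lemma linRenyi_self {α : ℝ≥0∞} (h0 : α ≠ 0) (W : ProbabilityMeasure Y) : linRenyi α W W = 0 := by
  by_cases ht : α = ∞
  · subst ht
    rw [← nonpos_iff_eq_zero, linRenyi_top_le_iff (by simp)]
    simp
  · rw [linRenyi_of_ne_top ht, linDiv_self (ENNReal.toReal_pos h0 ht)]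

lemma TVle_of_linRenyi_le {α : ℝ≥0∞} (h0 : α ≠ 0) {ε : ℝ≥0∞} (hε : ε ≠ 0) :
    ∃ δ ≠ 0, ∀ W Q : ProbabilityMeasure Y, linRenyi α W Q ≤ δ →
      TVle (W : Measure Y) (Q : Measure Y) ε := by
  by_cases ht : α = ∞
  · subst ht
    refine ⟨min 1 ε, (lt_min one_pos (pos_iff_ne_zero.2 hε)).ne', fun W Q h A _ => ?_⟩
    rw [linRenyi_top_le_iff (ne_top_of_le_ne_top ENNReal.one_ne_top (min_le_left _ _))] at h
    calc (W : Measure Y) A ≤ (1 + min 1 ε) * (Q : Measure Y) A := h A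
      _ ≤ (Q : Measure Y) A + ε * 1 := by
        rw [add_mul, one_mul]
        gcongr
        · exact min_le_right _ _
        · exact prob_le_one
      _ = _ := by rw [mul_one]
  · obtain ⟨δ, hδ, h⟩ := TVle_of_linDiv_le (Y := Y) (ENNReal.toReal_pos h0 ht) hε
    exact ⟨δ, hδ, fun W Q hWQ => h W Q (by rwa [linRenyi_of_ne_top ht] at hWQ)⟩

lemma tendsto_of_TVle {q : ℕ → ProbabilityMeasure Y} {r : ProbabilityMeasure Y} {ε : ℕ → ℝ≥0∞}
    (hε : Tendsto ε atTop (𝓝 0)) (h : ∀ n, TVle (q n : Measure Y) (r : Measure Y) (ε n))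
    {A : Set Y} (hA : MeasurableSet A) :
    Tendsto (fun n => (q n : Measure Y) A) atTop (𝓝 ((r : Measure Y) A)) := by
  have h1 : Tendsto (fun n => (r : Measure Y) A - ε n) atTop (𝓝 ((r : Measure Y) A - 0)) :=
    ENNReal.Tendsto.sub tendsto_const_nhds hε (Or.inl (measure_ne_top _ _))
  have h2 : Tendsto (fun n => (r : Measure Y) A + ε n) atTop (𝓝 ((r : Measure Y) A + 0)) :=
    tendsto_const_nhds.add hε
  rw [tsub_zero] at h1
  rw [add_zero] at h2
  exact tendsto_of_tendsto_of_tendsto_of_le_of_le h1 h2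
    (fun n => tsub_le_iff_right.2 ((h n).symm A hA)) fun n => h n A hA

/-- At order `∞`, a failure of domination by `(1 + d) • Q'` is witnessed by a single set with a
strict inequality, which persists along the sequence. Finite orders use Fatou's lemma through
`linDiv_le_liminf`. -/
lemma linRenyi_le_liminf {α : ℝ≥0∞} (h0 : α ≠ 0) (W Q : ℕ → ProbabilityMeasure Y)
    (W' Q' : ProbabilityMeasure Y) (ε : ℕ → ℝ≥0∞) (hε : ∑' n, ε n ≠ ∞)
    (hW : ∀ n, TVle (W n : Measure Y) (W' : Measure Y) (ε n))
    (hQ : ∀ n, TVle (Q n : Measure Y) (Q' : Measure Y) (ε n)) :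
    linRenyi α W' Q' ≤ liminf (fun n => linRenyi α (W n) (Q n)) atTop := by
  by_cases ht : α = ∞
  · subst ht
    have hε0 := ENNReal.tendsto_atTop_zero_of_tsum_ne_top hε
    refine le_of_forall_lt fun c hc => ?_
    obtain ⟨d, hcd, hd⟩ := exists_between hc
    refine hcd.trans_le (le_liminf_of_le (by isBoundedDefault) ?_)
    have h1 := hd.not_ge
    rw [linRenyi_top_le_iff hd.ne_top, Measure.le_iff] at h1
    push Not at h1
    obtain ⟨A, hA, hlt⟩ := h1
    rw [Measure.smul_apply, smul_eq_mul] at hlt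
    have h2 := ENNReal.Tendsto.const_mul (a := 1 + d) (tendsto_of_TVle hε0 hQ hA)
      (Or.inr (by have := hd.ne_top; finiteness))
    filter_upwards [h2.eventually_lt (tendsto_of_TVle hε0 hW hA) hlt] with n hn
    by_contra! hcon
    have h3 := (linRenyi_top_le_iff hd.ne_top).1 hcon.le A
    rw [Measure.smul_apply, smul_eq_mul] at h3
    exact absurd hn h3.not_gt
  · simp_rw [linRenyi_of_ne_top ht]
    exact linDiv_le_liminf (ENNReal.toReal_pos h0 ht) W Q W' Q' ε hε hW hQ

/-! ### Sibson's identity in linearised form and mixtures of priors -/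

/-- The mean measure of order `∞` is the least upper bound of the members of a prior. -/
lemma meanMeasure_top_le_iff (P : ProbabilityMeasure Y →₀ ℝ≥0) (ξ : Measure Y) [IsFiniteMeasure ξ] :
    meanMeasure ∞ P ≤ ξ ↔ ∀ W ∈ P.support, (W : Measure Y) ≤ ξ := by
  have hf : ∀ y, meanDensity ∞ P y = P.support.sup fun W => mixtureDensity P W y := fun y => by
    rw [meanDensity, if_neg (by simp), if_pos rfl]
  constructor
  · intro h W hW
    rw [← withDensity_mixtureDensity P hW]
    refine (withDensity_mono (Eventually.of_forall fun y => ?_)).trans h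
    rw [hf]
    exact Finset.le_sup (f := fun W => mixtureDensity P W y) hW
  · intro h
    obtain ⟨ρ, t, r, hρf, mt, mr, hρt, hρr, hρ⟩ := exists_prior_densities P ξ
    have h1 : ∀ᵐ y ∂ρ, ∀ W ∈ P.support, t y * mixtureDensity P W y ≤ r y := by
      refine (Filter.eventually_all_finset _).2 fun W hW => ?_
      refine ae_le_of_forall_setLIntegral_le_of_sigmaFinite
        (mt.mul (measurable_mixtureDensity P W)) fun s hs _ => ?_
      rw [← withDensity_apply _ hs, ← withDensity_apply _ hs, hρr]
      have := hρ _ (measurable_mixtureDensity P W)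
      rw [withDensity_mixtureDensity P hW] at this
      exact (DFunLike.congr_fun this s).le.trans (h W hW s)
    rw [meanMeasure, ← hρ _ (measurable_meanDensity (by simp) P), ← hρr]
    refine withDensity_mono ?_
    filter_upwards [h1] with y hy
    rw [hf]
    rcases P.support.eq_empty_or_nonempty with he | hne
    · simp [he]
    · obtain ⟨W, hW, hWs⟩ := Finset.exists_mem_eq_sup _ hne fun W => mixtureDensity P W y
      rw [hWs]
      exact hy W hW

/-- Sibson's identity in linearised form, for finite orders. -/
theorem exists_sibson_of_ne_top {α : ℝ≥0∞} (h0 : α ≠ 0) (ht : α ≠ ∞)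
    {P : ProbabilityMeasure Y →₀ ℝ≥0} (hP : ∑ W ∈ P.support, P W = 1) :
    ∃ (q : ProbabilityMeasure Y) (K : ℝ≥0∞), renyiInfo α P = logGauge (gaugeSlope α) K ∧
      ∀ Q, ∑ W ∈ P.support, (P W : ℝ≥0∞) * linRenyi α W Q =
        K + expGauge (gaugeSlope α) K * linRenyi α q Q := by
  have ha : 0 < α.toReal := ENNReal.toReal_pos h0 ht
  simp_rw [linRenyi_of_ne_top ht, gaugeSlope_of_ne_top ht]
  by_cases h1 : α = 1
  · subst h1
    refine ⟨⟨priorMixture P, isProbabilityMeasure_priorMixture hP⟩, ∑ W ∈ P.support, (P W : ℝ≥0∞) *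
      linDiv 1 (W : Measure Y) (priorMixture P), ?_, fun Q => ?_⟩
    · rw [renyiInfo_one hP, ENNReal.toReal_one, sub_self, logGauge, if_pos rfl]
    · rw [ENNReal.toReal_one, sub_self, expGauge_of_nonneg le_rfl, ENNReal.ofReal_zero, zero_mul,
        add_zero, one_mul]
      exact sum_linDiv_one hP Q
  · have ha1 : α.toReal ≠ 1 := by rwa [Ne, ENNReal.toReal_eq_one_iff]
    obtain ⟨q, hq⟩ := exists_meanProb h0 hP
    set a := α.toReal with ha_def
    have hM0 := meanMeasure_univ_ne_zero h0 hP
    have hMt := meanMeasure_univ_ne_top h0 P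
    set M := meanMeasure α P Set.univ
    -- This value is forced by taking `Q = q` in the identity, where the last divergence vanishes.
    set K : ℝ≥0∞ := ∑ W ∈ P.support, (P W : ℝ≥0∞) * linDiv a (W : Measure Y) (q : Measure Y)
      with hK
    have hsum := coe_sum_eq_one hP
    have hsib := sum_hellinger_eq h0 ht hP hq
    have hhell : hellinger a (q : Measure Y) (q : Measure Y) = 1 := by
      rw [hellinger_eq_expGauge ha ha1, linDiv_self ha, expGauge_zero_right]
    -- Both claims come from the Hellinger form: evaluating it at `q` gives the power of the mass
    -- `M`, and comparing it at `Q` with its value at `q` gives the identity. Terms are cancelled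
    -- additively, hence the finiteness checks.
    have key : expGauge (a - 1) K = M ^ a ∧
        ∀ Q : ProbabilityMeasure Y, ∑ W ∈ P.support, (P W : ℝ≥0∞) * linDiv a (W : Measure Y)
          (Q : Measure Y) = K + M ^ a * linDiv a (q : Measure Y) (Q : Measure Y) := by
      rcases lt_or_gt_of_ne ha1 with h | h
      · have hb0 : ENNReal.ofReal (1 - a) ≠ 0 := by simpa using h
        have e : ∀ Q : ProbabilityMeasure Y, ∑ W ∈ P.support, (P W : ℝ≥0∞) *
            hellinger a (W : Measure Y) (Q : Measure Y) + ENNReal.ofReal (1 - a) *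
              ∑ W ∈ P.support, (P W : ℝ≥0∞) * linDiv a (W : Measure Y) (Q : Measure Y) = 1 :=
          fun Q => by
            rw [Finset.mul_sum, ← Finset.sum_add_distrib, ← hsum]
            refine Finset.sum_congr rfl fun W _ => ?_
            rw [mul_left_comm, ← mul_add, hellinger_add_of_lt_one ha h, mul_one]
        have e1 := e q
        rw [hsib, hhell, mul_one, ← hK] at e1
        refine ⟨?_, fun Q => ?_⟩
        · rw [expGauge_of_neg (by linarith), neg_sub, ← e1]
          refine ENNReal.add_sub_cancel_right (ne_top_of_le_ne_top ENNReal.one_ne_top ?_)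
          rw [← e1]
          exact le_add_self
        · have e2 := e Q
          have e3 := hellinger_add_of_lt_one ha h (q : Measure Y) (Q : Measure Y)
          rw [hsib] at e2
          have hHt : M ^ a * hellinger a (q : Measure Y) (Q : Measure Y) ≠ ∞ :=
            ne_top_of_le_ne_top ENNReal.one_ne_top (e2 ▸ le_self_add)
          have e4 : M ^ a * hellinger a (q : Measure Y) (Q : Measure Y) + ENNReal.ofReal (1 - a) *
              ∑ W ∈ P.support, (P W : ℝ≥0∞) * linDiv a (W : Measure Y) (Q : Measure Y) =
              M ^ a * hellinger a (q : Measure Y) (Q : Measure Y) + ENNReal.ofReal (1 - a) *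
                (K + M ^ a * linDiv a (q : Measure Y) (Q : Measure Y)) := by
            rw [e2, ← e1]
            nth_rewrite 1 [← mul_one (M ^ a), ← e3]
            ring
          exact (ENNReal.mul_right_inj hb0 (by simp)).1 ((ENNReal.add_right_inj hHt).1 e4)
      · have hb0 : ENNReal.ofReal (a - 1) ≠ 0 := by simpa using h
        have e : ∀ Q : ProbabilityMeasure Y, ∑ W ∈ P.support, (P W : ℝ≥0∞) *
            hellinger a (W : Measure Y) (Q : Measure Y) = 1 + ENNReal.ofReal (a - 1) *
              ∑ W ∈ P.support, (P W : ℝ≥0∞) * linDiv a (W : Measure Y) (Q : Measure Y) :=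
          fun Q => by
            rw [Finset.mul_sum, ← hsum, ← Finset.sum_add_distrib]
            refine Finset.sum_congr rfl fun W _ => ?_
            rw [hellinger_of_one_lt h, mul_add, mul_one, mul_left_comm]
        have e1 := e q
        rw [hsib, hhell, mul_one, ← hK] at e1
        refine ⟨by rw [expGauge_of_nonneg (by linarith), e1], fun Q => ?_⟩
        have e2 := e Q
        rw [hsib, hellinger_of_one_lt h, mul_add, mul_one] at e2
        nth_rewrite 1 [e1] at e2
        rw [add_assoc, ENNReal.add_right_inj (by simp), mul_left_comm, ← mul_add,
          ENNReal.mul_right_inj hb0 (by simp)] at e2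
        exact e2.symm
    refine ⟨q, K, ?_, fun Q => by rw [key.1, key.2 Q]⟩
    have hne : a - 1 ≠ 0 := sub_ne_zero.2 ha1
    rw [renyiInfo, if_neg h0, if_neg h1, if_neg ht, logGauge, if_neg hne, key.1,
      ENNReal.log_rpow, ← mul_assoc, ← EReal.coe_mul]
    congr 2
    rw [← ha_def]
    field_simp

/-- Sibson's identity for order `∞`. -/
theorem exists_sibson_top {P : ProbabilityMeasure Y →₀ ℝ≥0} (hP : ∑ W ∈ P.support, P W = 1) :
    ∃ (q : ProbabilityMeasure Y) (K : ℝ≥0∞), renyiInfo ∞ P = logGauge 1 K ∧ K ≠ ∞ ∧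
      ∀ Q : ProbabilityMeasure Y, ∀ c ≠ ∞, (1 + K) * (1 + linRenyi ∞ q Q) ≤ c ↔
        ∀ W ∈ P.support, (W : Measure Y) ≤ c • (Q : Measure Y) := by
  obtain ⟨q, hq⟩ := exists_meanProb ENNReal.top_ne_zero hP
  have hM0 := meanMeasure_univ_ne_zero ENNReal.top_ne_zero hP
  have hMt := meanMeasure_univ_ne_top ENNReal.top_ne_zero P
  set M := meanMeasure ∞ P Set.univ with hM
  have hfin : IsFiniteMeasure (meanMeasure ∞ P) := ⟨hMt.lt_top⟩
  have hM1 : 1 ≤ M := by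
    obtain ⟨W, hW⟩ : P.support.Nonempty := by
      rw [Finset.nonempty_iff_ne_empty]
      intro h
      rw [h] at hP
      simp at hP
    have := (meanMeasure_top_le_iff P (meanMeasure ∞ P)).1 le_rfl W hW Set.univ
    simpa using this
  have hMK : 1 + (M - 1) = M := add_tsub_cancel_of_le hM1
  refine ⟨q, M - 1, ?_, ne_top_of_le_ne_top hMt tsub_le_self, fun Q c hc => ?_⟩
  · rw [renyiInfo, if_neg ENNReal.top_ne_zero, if_neg (by simp), if_pos rfl, logGauge,
      if_neg one_ne_zero, expGauge_of_nonneg zero_le_one]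
    simp only [ENNReal.ofReal_one, one_mul, div_one, EReal.coe_one]
    rw [hMK]
  · have hfin' : IsFiniteMeasure (c • (Q : Measure Y)) :=
      ⟨by simpa using hc.lt_top⟩
    -- Both sides say that `c • Q` dominates the mean measure `M • q`: the left one after dividing
    -- by `M`, the right one because the mean measure is a least upper bound.
    rw [hMK, ← meanMeasure_top_le_iff, mul_comm,
      ← ENNReal.le_div_iff_mul_le (Or.inl hM0) (Or.inl hMt), linRenyi, if_pos rfl,
      add_tsub_cancel_of_le (one_le_essSup_div q Q), essSup_div_le_iff _ _
        (ENNReal.div_ne_top hc hM0)]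
    have e : meanMeasure ∞ P = M • (q : Measure Y) := by
      rw [hq, smul_smul, ENNReal.mul_inv_cancel hM0 hMt, one_smul]
    rw [e]
    simp only [Measure.le_iff, Measure.smul_apply, smul_eq_mul]
    refine forall₂_congr fun A _ => ?_
    rw [ENNReal.div_eq_inv_mul, mul_assoc, ← ENNReal.div_eq_inv_mul,
      ENNReal.le_div_iff_mul_le (Or.inl hM0) (Or.inl hMt), mul_comm]

lemma sum_support_eq (P : ProbabilityMeasure Y →₀ ℝ≥0) (f : ProbabilityMeasure Y → ℝ≥0∞) :
    ∑ W ∈ P.support, (P W : ℝ≥0∞) * f W = P.sum fun W p => (p : ℝ≥0∞) * f W := rfl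

lemma sum_smul_add_smul (P P' : ProbabilityMeasure Y →₀ ℝ≥0) (s t : ℝ≥0)
    (f : ProbabilityMeasure Y → ℝ≥0∞) :
    ∑ W ∈ (s • P + t • P').support, ((s • P + t • P') W : ℝ≥0∞) * f W =
      s * ∑ W ∈ P.support, (P W : ℝ≥0∞) * f W + t * ∑ W ∈ P'.support, (P' W : ℝ≥0∞) * f W := by
  rw [sum_support_eq, Finsupp.sum_add_index' (by simp) (by intros; push_cast; ring),
    Finsupp.sum_smul_index' (by simp), Finsupp.sum_smul_index' (by simp), Finset.mul_sum,
    Finset.mul_sum]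
  simp [Finsupp.sum, mul_assoc]

lemma smul_add_smul_mem_priors {𝒲 : Set (ProbabilityMeasure Y)} {P P' : ProbabilityMeasure Y →₀ ℝ≥0}
    (hP : P ∈ priors 𝒲) (hP' : P' ∈ priors 𝒲) {s t : ℝ≥0} (hst : s + t = 1) :
    s • P + t • P' ∈ priors 𝒲 := by
  refine ⟨fun W hW => ?_, ?_⟩
  · by_contra h
    have h1 : P W = 0 := by
      by_contra h2
      exact h (hP.1 W (Finsupp.mem_support_iff.2 h2))
    have h2 : P' W = 0 := by
      by_contra h2
      exact h (hP'.1 W (Finsupp.mem_support_iff.2 h2))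
    simp [h1, h2] at hW
  · have h := sum_smul_add_smul P P' s t 1
    simp only [Pi.one_apply, mul_one] at h
    rw [coe_sum_eq_one hP.2, coe_sum_eq_one hP'.2, mul_one, mul_one] at h
    rw [← ENNReal.coe_inj, ENNReal.ofNNReal_finsetSum, h]
    exact_mod_cast hst

lemma single_mem_priors {𝒲 : Set (ProbabilityMeasure Y)} {W : ProbabilityMeasure Y} (hW : W ∈ 𝒲) :
    Finsupp.single W 1 ∈ priors 𝒲 := by
  have hs : (Finsupp.single W (1 : ℝ≥0)).support = {W} :=
    Finsupp.support_single _ one_ne_zero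
  refine ⟨fun V hV => ?_, ?_⟩
  · rw [hs, Finset.mem_singleton] at hV
    rwa [hV]
  · rw [hs]
    simp

lemma eq_of_linRenyi_eq_zero {α : ℝ≥0∞} (h0 : α ≠ 0) {W Q : ProbabilityMeasure Y}
    (h : linRenyi α W Q = 0) : W = Q := by
  have hWQ : (W : Measure Y) = (Q : Measure Y) := eq_of_forall_TVle fun ε hε => by
    obtain ⟨δ, _, hδ⟩ := TVle_of_linRenyi_le (Y := Y) h0 hε
    exact hδ W Q (h ▸ zero_le)
  exact Subtype.ext hWQ

lemma add_mul_le_of_mul_le {K l c : ℝ≥0∞} (h : (1 + K) * (1 + l) ≤ 1 + c) :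
    K + (1 + K) * l ≤ c := by
  rw [mul_add, mul_one, add_assoc] at h
  exact (ENNReal.add_le_add_iff_left ENNReal.one_ne_top).1 h

/-- The linearised form of the Rényi information and of the mean measures, with the consequences
of Sibson's identity for mixtures of priors. -/
theorem exists_sibson_family {α : ℝ≥0∞} (h0 : α ≠ 0) (𝒲 : Set (ProbabilityMeasure Y)) :
    ∃ (q : priors 𝒲 → ProbabilityMeasure Y) (K : priors 𝒲 → ℝ≥0∞),
      (∀ P : priors 𝒲, renyiInfo α (P : ProbabilityMeasure Y →₀ ℝ≥0) =
        logGauge (gaugeSlope α) (K P)) ∧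
      (∀ P Q, K P + expGauge (gaugeSlope α) (K P) * linRenyi α (q P) Q ≤
        ⨆ W ∈ 𝒲, linRenyi α W Q) ∧
      (∀ i j, ∀ s t : ℝ≥0∞, s + t = 1 → s ≠ 0 → t ≠ 0 → ∃ k,
        s * (K i + expGauge (gaugeSlope α) (K i) * linRenyi α (q i) (q k)) +
          t * (K j + expGauge (gaugeSlope α) (K j) * linRenyi α (q j) (q k)) ≤ K k) ∧
      (∀ W ∈ 𝒲, ∃ i, q i = W ∧ expGauge (gaugeSlope α) (K i) = 1) := by
  by_cases ht : α = ∞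
  · subst ht
    choose q K hI hK hs using fun P : priors 𝒲 => exists_sibson_top P.2.2
    simp only [gaugeSlope_top, expGauge_of_nonneg zero_le_one, ENNReal.ofReal_one, one_mul]
    refine ⟨q, K, hI, fun P Q => ?_, fun i j s t hst hs0 ht0 => ?_, fun W hW => ?_⟩
    · by_cases hsup : ⨆ W ∈ 𝒲, linRenyi ∞ W Q = ∞
      · simp [hsup]
      · refine add_mul_le_of_mul_le ((hs P Q _ (by finiteness)).2 fun W hW => ?_)
        exact (linRenyi_top_le_iff hsup).1
          (le_iSup₂ (f := fun W (_ : W ∈ 𝒲) => linRenyi ∞ W Q) W (P.2.1 W hW))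
    · lift s to ℝ≥0 using (ne_top_of_le_ne_top ENNReal.one_ne_top (hst ▸ le_self_add))
      lift t to ℝ≥0 using (ne_top_of_le_ne_top ENNReal.one_ne_top (hst ▸ le_add_self))
      have hst' : s + t = 1 := by exact_mod_cast hst
      let k : priors 𝒲 := ⟨_, smul_add_smul_mem_priors i.2 j.2 hst'⟩
      refine ⟨k, ?_⟩
      have hk := (hs k (q k) (1 + K k) (by have := hK k; finiteness)).1
        (by rw [linRenyi_self h0, add_zero, mul_one])
      -- At order `∞` only the support matters: a bound valid for all members of the mixture is
      -- valid for the members of each part.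
      have hle : ∀ l : priors 𝒲, (∀ W ∈ (l : ProbabilityMeasure Y →₀ ℝ≥0).support,
          W ∈ (k : ProbabilityMeasure Y →₀ ℝ≥0).support) →
          K l + (1 + K l) * linRenyi ∞ (q l) (q k) ≤ K k := fun l hl =>
        add_mul_le_of_mul_le ((hs l (q k) (1 + K k) (by have := hK k; finiteness)).2
          fun W hW => hk W (hl W hW))
      have hs0' : s ≠ 0 := by simpa using hs0
      have ht0' : t ≠ 0 := by simpa using ht0
      have hi := hle i fun W hW => by
        have h1 := Finsupp.mem_support_iff.1 hW
        simp [k, hs0', h1]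
      have hj := hle j fun W hW => by
        have h1 := Finsupp.mem_support_iff.1 hW
        simp [k, ht0', h1]
      calc _ ≤ (s : ℝ≥0∞) * K k + t * K k := by gcongr
        _ = K k := by rw [← add_mul, hst, one_mul]
    · let i : priors 𝒲 := ⟨_, single_mem_priors hW⟩
      have h1 : (1 + K i) * (1 + linRenyi ∞ (q i) W) ≤ 1 := by
        refine (hs i W 1 (by simp)).2 fun V hV => ?_
        have : V = W := by
          simp only [i, Finsupp.support_single _ one_ne_zero, Finset.mem_singleton] at hV
          exact hV
        rw [this, one_smul]
      nth_rewrite 3 [← add_zero (1 : ℝ≥0∞)] at h1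
      have h2 := nonpos_iff_eq_zero.1 (add_mul_le_of_mul_le h1)
      obtain ⟨h3, h4⟩ := add_eq_zero.1 h2
      rw [h3, add_zero, one_mul] at h4
      exact ⟨i, eq_of_linRenyi_eq_zero h0 h4, by rw [h3, add_zero]⟩
  · choose q K hI hs using fun P : priors 𝒲 => exists_sibson_of_ne_top h0 ht P.2.2
    refine ⟨q, K, hI, fun P Q => ?_, fun i j s t hst hs0 ht0 => ?_, fun W hW => ?_⟩
    · rw [← hs P Q]
      calc _ ≤ ∑ W ∈ (P : ProbabilityMeasure Y →₀ ℝ≥0).support,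
            ((P : ProbabilityMeasure Y →₀ ℝ≥0) W : ℝ≥0∞) * ⨆ W ∈ 𝒲, linRenyi α W Q := by
            refine Finset.sum_le_sum fun W hW => ?_
            gcongr
            exact le_iSup₂ (f := fun W (_ : W ∈ 𝒲) => linRenyi α W Q) W (P.2.1 W hW)
        _ = _ := by rw [← Finset.sum_mul, coe_sum_eq_one P.2.2, one_mul]
    · lift s to ℝ≥0 using (ne_top_of_le_ne_top ENNReal.one_ne_top (hst ▸ le_self_add))
      lift t to ℝ≥0 using (ne_top_of_le_ne_top ENNReal.one_ne_top (hst ▸ le_add_self))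
      have hst' : s + t = 1 := by exact_mod_cast hst
      let k : priors 𝒲 := ⟨_, smul_add_smul_mem_priors i.2 j.2 hst'⟩
      refine ⟨k, ?_⟩
      -- At `Q = q k` the divergence on the right vanishes, so `K k` is the average of `linRenyi α W
      -- (q k)` under the mixture, and this average is affine in the prior.
      have h1 := hs k (q k)
      rw [linRenyi_self h0, mul_zero, add_zero] at h1
      rw [← h1, ← hs i (q k), ← hs j (q k)]
      exact (sum_smul_add_smul _ _ s t fun W => linRenyi α W (q k)).ge
    -- For a point mass tested at `Q = W` the left side of Sibson's identity is zero, so both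
    -- nonnegative terms on the right vanish.
    · let i : priors 𝒲 := ⟨_, single_mem_priors hW⟩
      have h1 := hs i W
      have h2 : ∑ V ∈ (Finsupp.single W (1 : ℝ≥0)).support,
          ((Finsupp.single W (1 : ℝ≥0)) V : ℝ≥0∞) * linRenyi α V W = 0 := by
        rw [Finsupp.support_single _ one_ne_zero, Finset.sum_singleton, linRenyi_self h0, mul_zero]
      obtain ⟨h3, h4⟩ := add_eq_zero.1 (h1.symm.trans h2)
      rw [h3, expGauge_zero_right, one_mul] at h4
      exact ⟨i, eq_of_linRenyi_eq_zero h0 h4, by rw [h3, expGauge_zero_right]⟩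

/-! ### Capacity, radius and existence of centers -/

lemma nonempty_priors {𝒲 : Set (ProbabilityMeasure Y)} (h : 𝒲.Nonempty) : Nonempty (priors 𝒲) :=
  ⟨⟨_, single_mem_priors h.choose_spec⟩⟩

/-- The gauge is monotone and continuous, hence commutes with suprema. Nonemptiness matters: the
empty supremum is `⊥` in `EReal`, while the gauge of `0` is `0`. -/
lemma renyiRelRadius_eq_logGauge {α : ℝ≥0∞} (h0 : α ≠ 0) {𝒲 : Set (ProbabilityMeasure Y)}
    (hne : 𝒲.Nonempty) (Q : ProbabilityMeasure Y) :
    renyiRelRadius α 𝒲 Q = logGauge (gaugeSlope α) (⨆ W ∈ 𝒲, linRenyi α W Q) := by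
  have := hne.to_subtype
  rw [renyiRelRadius, iSup_subtype', iSup_subtype',
    (monotone_logGauge _).map_ciSup_of_continuousAt (continuous_logGauge _).continuousAt]
  exact iSup_congr fun W => renyiDiv_eq_logGauge h0 _ _

/-- The Rényi information of a prior is at most the radius relative to any measure. -/
theorem renyiCapacity_le_renyiRelRadius {α : ℝ≥0∞} (h0 : α ≠ 0) {𝒲 : Set (ProbabilityMeasure Y)}
    (hne : 𝒲.Nonempty) (Q : ProbabilityMeasure Y) :
    renyiCapacity α 𝒲 ≤ renyiRelRadius α 𝒲 Q := by
  obtain ⟨q, K, hI, hsib, -, -⟩ := exists_sibson_family h0 𝒲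
  refine iSup₂_le fun P hP => ?_
  rw [renyiRelRadius_eq_logGauge h0 hne, hI ⟨P, hP⟩]
  exact monotone_logGauge _ (le_self_add.trans (hsib ⟨P, hP⟩ Q))

/-- A set of finite capacity has a center, and the bound of van Erven and Harremoës holds. -/
theorem exists_renyiDiv_le_capacity {α : ℝ≥0∞} (h0 : α ≠ 0) {𝒲 : Set (ProbabilityMeasure Y)}
    (hne : 𝒲.Nonempty) (hC : renyiCapacity α 𝒲 < ⊤) :
    ∃ q, (∀ W ∈ 𝒲, renyiDiv α W q ≤ renyiCapacity α 𝒲) ∧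
      ∀ Q, renyiCapacity α 𝒲 + renyiDiv α q Q ≤ renyiRelRadius α 𝒲 Q := by
  obtain ⟨q, K, hI, hsib, hmix, hpt⟩ := exists_sibson_family h0 𝒲
  have := nonempty_priors hne
  have hcap : renyiCapacity α 𝒲 = logGauge (gaugeSlope α) (⨆ P, K P) := by
    rw [renyiCapacity, iSup_subtype', (monotone_logGauge _).map_ciSup_of_continuousAt
      (continuous_logGauge _).continuousAt]
    exact iSup_congr hI
  rw [hcap] at hC
  obtain ⟨hK, hF⟩ := ne_top_of_logGauge_lt_top hC
  obtain ⟨r, h1, h2⟩ := exists_center_of_sibson 𝒲 (fun ε hε => TVle_of_linRenyi_le h0 hε)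
    (linRenyi_le_liminf h0) hK (continuous_expGauge (gaugeSlope α))
    (F₀ := min 1 (expGauge (gaugeSlope α) (⨆ P, K P)))
    (lt_min one_pos (pos_iff_ne_zero.2 hF)).ne'
    (ne_top_of_le_ne_top ENNReal.one_ne_top (min_le_left _ _))
    (fun i => min_one_expGauge_le _ (le_iSup K i)) (expGauge_ne_top _ hK) hmix hpt hsib
  refine ⟨r, fun W hW => ?_, fun Q => ?_⟩
  · rw [hcap, renyiDiv_eq_logGauge h0]
    exact monotone_logGauge _ (h1 W hW)
  · rw [hcap, renyiDiv_eq_logGauge h0, ← logGauge_add hK hF, renyiRelRadius_eq_logGauge h0 hne]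
    exact monotone_logGauge _ (h2 Q)

lemma renyiDiv_nonneg {α : ℝ≥0∞} (h0 : α ≠ 0) (W Q : ProbabilityMeasure Y) :
    0 ≤ renyiDiv α W Q := by
  rw [renyiDiv_eq_logGauge h0, ← logGauge_zero_right (gaugeSlope α)]
  exact monotone_logGauge _ zero_le

lemma eq_of_renyiDiv_eq_zero {α : ℝ≥0∞} (h0 : α ≠ 0) {W Q : ProbabilityMeasure Y}
    (h : renyiDiv α W Q = 0) : W = Q := by
  rw [renyiDiv_eq_logGauge h0] at h
  exact eq_of_linRenyi_eq_zero h0 (eq_zero_of_logGauge_eq_zero h)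

lemma renyiCapacity_nonneg {α : ℝ≥0∞} (h0 : α ≠ 0) {𝒲 : Set (ProbabilityMeasure Y)}
    (hne : 𝒲.Nonempty) : 0 ≤ renyiCapacity α 𝒲 := by
  obtain ⟨q, K, hI, -, -, -⟩ := exists_sibson_family h0 𝒲
  obtain ⟨P⟩ := nonempty_priors hne
  refine le_trans ?_ (le_iSup₂ (f := fun P (_ : P ∈ priors 𝒲) => renyiInfo α P) P.1 P.2)
  refine le_of_le_of_eq ?_ (hI P).symm
  rw [← logGauge_zero_right (gaugeSlope α)]
  exact monotone_logGauge _ zero_le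

/-! ### Comparison of divergences under domination of the second argument -/

/-- Densities of three measures, where one dominates a multiple of another one on a set that
carries the third one. -/
lemma exists_densities_of_smul_restrict_le {W Q R : ProbabilityMeasure Y} {A : Set Y}
    (hA : MeasurableSet A) (hW : (W : Measure Y) Aᶜ = 0) {l : ℝ≥0∞}
    (hle : l • (R : Measure Y).restrict A ≤ (Q : Measure Y)) :
    ∃ (ν : Measure Y) (w q r : Y → ℝ≥0∞), Measurable w ∧ Measurable q ∧ Measurable r ∧
      ν.withDensity w = W ∧ ν.withDensity q = Q ∧ ν.withDensity r = R ∧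
      ∀ᵐ y ∂ν, w y = 0 ∨ l * r y ≤ q y := by
  obtain ⟨ν, w, q, r, -, hν, mw, mq, mr, -, ew, eq, er, -⟩ :=
    exists_common_densities_seq (fun _ => W) (fun _ => Q) R R
  refine ⟨ν, w 0, q 0, r, mw 0, mq 0, mr, ew 0, eq 0, er, ?_⟩
  have h1 : ∀ᵐ y ∂ν, y ∈ Aᶜ → w 0 y = 0 := by
    rw [← ae_restrict_iff' hA.compl]
    rw [← ew 0, withDensity_apply _ hA.compl, lintegral_eq_zero_iff (mw 0)] at hW
    exact hW
  have h2 : ∀ᵐ y ∂ν, A.indicator (fun y => l * r y) y ≤ q 0 y := by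
    refine ae_le_of_forall_setLIntegral_le_of_sigmaFinite ((mr.const_mul l).indicator hA)
      fun s hs _ => ?_
    rw [lintegral_indicator hA, lintegral_const_mul _ mr, Measure.restrict_restrict hA,
      ← withDensity_apply _ (hA.inter hs), ← withDensity_apply _ hs, er, eq 0]
    have := hle s
    rwa [Measure.smul_apply, smul_eq_mul, Measure.restrict_apply hs, Set.inter_comm] at this
  filter_upwards [h1, h2] with y hy1 hy2
  by_cases hy : y ∈ A
  · right
    simpa [hy] using hy2
  · exact Or.inl (hy1 hy)

lemma rpow_mul_rpow_le_of_one_lt {a : ℝ} (ha : 1 < a) {l w q r : ℝ≥0∞} (hl : l ≠ ∞) (hr : r ≠ ∞)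
    (h : w = 0 ∨ l * r ≤ q) : w ^ a * q ^ (1 - a) ≤ l ^ (1 - a) * (w ^ a * r ^ (1 - a)) := by
  rcases h with rfl | h
  · rw [ENNReal.zero_rpow_of_pos (by linarith), zero_mul]
    exact zero_le
  · rw [mul_left_comm, ← ENNReal.mul_rpow_of_ne_top hl hr, ← neg_sub a 1, ENNReal.rpow_neg,
      ENNReal.rpow_neg]
    gcongr

lemma le_rpow_mul_rpow_of_lt_one {a : ℝ} (ha0 : 0 < a) (ha : a < 1) {l w q r : ℝ≥0∞}
    (h : w = 0 ∨ l * r ≤ q) : l ^ (1 - a) * (w ^ a * r ^ (1 - a)) ≤ w ^ a * q ^ (1 - a) := by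
  rcases h with rfl | h
  · simp [ENNReal.zero_rpow_of_pos ha0]
  · rw [mul_left_comm, ← ENNReal.mul_rpow_of_nonneg _ _ (by linarith)]
    gcongr

/-- Pointwise this is `w log (w / q) ≤ w log (w / r) - w log l`. The terms `r` and `q` restore the
mass terms of `klFun`, and the two parts of `log l` stand on opposite sides because its sign is
unknown. -/
lemma jfun_one_add_le {l : ℝ} (hl : 0 < l) {w q r : ℝ≥0∞} (hw : w ≠ ∞) (hq : q ≠ ∞) (hr : r ≠ ∞)
    (h : w = 0 ∨ ENNReal.ofReal l * r ≤ q) :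
    jfun 1 w q + r + ENNReal.ofReal (Real.log l) * w ≤
      jfun 1 w r + q + ENNReal.ofReal (-Real.log l) * w := by
  by_cases hw0 : w = 0
  · have h0 : ∀ z : ℝ≥0∞, z ≠ ∞ → jfun 1 0 z = z := fun z hz => by
      rw [jfun_one, if_pos rfl]
      split_ifs with h1
      · exact h1.symm
      · rw [ENNReal.toReal_zero, zero_div, InformationTheory.klFun_zero, mul_one,
          ENNReal.ofReal_toReal hz]
    rw [hw0, h0 q hq, h0 r hr, mul_zero, mul_zero, add_zero, add_zero, add_comm]
  · have hle := h.resolve_left hw0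
    by_cases hr0 : r = 0
    · simp [hr0, jfun_one, hw0]
    · have hl0 : ENNReal.ofReal l ≠ 0 := by simpa using hl
      have hq0 : q ≠ 0 := fun hq0 => by
        rw [hq0, nonpos_iff_eq_zero] at hle
        exact mul_ne_zero hl0 hr0 hle
      have hqr : 0 < q.toReal := ENNReal.toReal_pos hq0 hq
      have hrr : 0 < r.toReal := ENNReal.toReal_pos hr0 hr
      have hwr : 0 < w.toReal := ENNReal.toReal_pos hw0 hw
      have hle' : l * r.toReal ≤ q.toReal := by
        have := ENNReal.toReal_mono hq hle
        rwa [ENNReal.toReal_mul, ENNReal.toReal_ofReal hl.le] at this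
      have hlog := Real.log_le_log (by positivity) hle'
      rw [Real.log_mul hl.ne' hrr.ne'] at hlog
      have hn1 : 0 ≤ q.toReal * InformationTheory.klFun (w.toReal / q.toReal) :=
        mul_nonneg hqr.le (InformationTheory.klFun_nonneg (by positivity))
      have hn2 : 0 ≤ r.toReal * InformationTheory.klFun (w.toReal / r.toReal) :=
        mul_nonneg hrr.le (InformationTheory.klFun_nonneg (by positivity))
      have key : q.toReal * InformationTheory.klFun (w.toReal / q.toReal) + r.toReal +
          max (Real.log l) 0 * w.toReal ≤ r.toReal * InformationTheory.klFun (w.toReal / r.toReal) +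
            q.toReal + max (-Real.log l) 0 * w.toReal := by
        rw [mul_klFun_div hqr, mul_klFun_div hrr, Real.log_div hwr.ne' hqr.ne',
          Real.log_div hwr.ne' hrr.ne']
        have h3 : max (Real.log l) 0 - max (-Real.log l) 0 = Real.log l := by
          rcases le_total 0 (Real.log l) with h | h
          · rw [max_eq_left h, max_eq_right (by linarith), sub_zero]
          · rw [max_eq_right h, max_eq_left (by linarith)]; ring
        have h4 := mul_le_mul_of_nonneg_left hlog hwr.le
        have h5 : max (Real.log l) 0 * w.toReal - max (-Real.log l) 0 * w.toReal =
            Real.log l * w.toReal := by rw [← sub_mul, h3]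
        nlinarith
      have hof : ∀ x : ℝ, ENNReal.ofReal x * w = ENNReal.ofReal (max x 0 * w.toReal) := fun x => by
        rw [ENNReal.ofReal_mul (le_max_right _ _), ENNReal.ofReal_toReal hw]
        congr 1
        rcases le_total 0 x with h | h
        · rw [max_eq_left h]
        · rw [max_eq_right h, ENNReal.ofReal_of_nonpos h, ENNReal.ofReal_zero]
      rw [jfun_one, jfun_one, if_neg hq0, if_neg hr0, hof, hof]
      have h6 := ENNReal.ofReal_le_ofReal key
      rwa [ENNReal.ofReal_add (by positivity) (by positivity), ENNReal.ofReal_add hn1 hrr.le,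
        ENNReal.ofReal_add (by positivity) (by positivity), ENNReal.ofReal_add hn2 hqr.le,
        ENNReal.ofReal_toReal hr, ENNReal.ofReal_toReal hq] at h6

/-- The order one case of the comparison of divergences: a bound in linear form. -/
lemma linDiv_one_le {W Q R : ProbabilityMeasure Y} {A : Set Y} (hA : MeasurableSet A)
    (hW : (W : Measure Y) Aᶜ = 0) {l : ℝ} (hl : 0 < l)
    (hle : ENNReal.ofReal l • (R : Measure Y).restrict A ≤ (Q : Measure Y)) :
    linDiv 1 (W : Measure Y) Q + ENNReal.ofReal (Real.log l) ≤
      linDiv 1 (W : Measure Y) R + ENNReal.ofReal (-Real.log l) := by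
  obtain ⟨ν, w, q, r, mw, mq, mr, ew, eq, er, h⟩ := exists_densities_of_smul_restrict_le hA hW hle
  have iw := lintegral_density_eq_one ew
  have iq := lintegral_density_eq_one eq
  have ir := lintegral_density_eq_one er
  rw [linDiv_eq one_pos mw mq ew eq, linDiv_eq one_pos mw mr ew er]
  have mj : ∀ {f : Y → ℝ≥0∞}, Measurable f → Measurable fun y => jfun 1 (w y) (f y) := fun hf =>
    (measurable_jfun 1).comp (mw.prodMk hf)
  have h1 : ∫⁻ y, jfun 1 (w y) (q y) + r y + ENNReal.ofReal (Real.log l) * w y ∂ν ≤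
      ∫⁻ y, jfun 1 (w y) (r y) + q y + ENNReal.ofReal (-Real.log l) * w y ∂ν := by
    refine lintegral_mono_ae ?_
    filter_upwards [h, ae_density_ne_top mw ew, ae_density_ne_top mq eq, ae_density_ne_top mr er]
      with y hy h1 h2 h3 using jfun_one_add_le hl h1 h2 h3 hy
  have e1 : ∀ (c : ℝ≥0∞) {f g : Y → ℝ≥0∞}, Measurable f → Measurable g →
      ∫⁻ y, jfun 1 (w y) (f y) + g y + c * w y ∂ν =
        ∫⁻ y, jfun 1 (w y) (f y) ∂ν + c + ∫⁻ y, g y ∂ν := fun c f g hf hg => by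
    have mg : Measurable fun y => jfun 1 (w y) (f y) + g y := (mj hf).add hg
    rw [lintegral_add_left mg, lintegral_add_left (mj hf), lintegral_const_mul _ mw, iw, mul_one,
      add_right_comm]
  rw [e1 _ mq mr, e1 _ mr mq, iq, ir] at h1
  exact (ENNReal.add_le_add_iff_right ENNReal.one_ne_top).1 h1

lemma exp_renyiDiv_of_ne {α : ℝ≥0∞} (h0 : α ≠ 0) (h1 : α ≠ 1) (ht : α ≠ ∞)
    (W Q : ProbabilityMeasure Y) : EReal.exp (renyiDiv α W Q) =
      hellinger α.toReal (W : Measure Y) Q ^ (1 / (α.toReal - 1)) := by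
  rw [ENNReal.rpow_eq_exp_mul_log, renyiDiv, if_neg h0, if_neg h1, if_neg ht]
  rfl

lemma exp_renyiDiv_top (W Q : ProbabilityMeasure Y) : EReal.exp (renyiDiv ∞ W Q) =
    essSup (fun y => (W : Measure Y).rnDeriv ((W : Measure Y) + (Q : Measure Y)) y /
      (Q : Measure Y).rnDeriv ((W : Measure Y) + (Q : Measure Y)) y)
      ((W : Measure Y) + (Q : Measure Y)) := by
  rw [renyiDiv, if_neg (by simp), if_neg (by simp), if_pos rfl, ENNReal.exp_log]

lemma renyiDiv_one (W Q : ProbabilityMeasure Y) :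
    renyiDiv 1 W Q = (linDiv 1 (W : Measure Y) Q : EReal) := by
  rw [renyiDiv, if_neg one_ne_zero, if_pos rfl, linDiv_one_eq_klDiv]

/-- If `Q` dominates `l • R` on a set that carries `W`, then `D(W‖Q) ≤ D(W‖R) - log l`. -/
theorem exp_renyiDiv_le_mul_inv {α : ℝ≥0∞} (h0 : α ≠ 0) {W Q R : ProbabilityMeasure Y} {A : Set Y}
    (hA : MeasurableSet A) (hW : (W : Measure Y) Aᶜ = 0) {l : ℝ≥0∞} (hl0 : l ≠ 0) (hl : l ≠ ∞)
    (hle : l • (R : Measure Y).restrict A ≤ (Q : Measure Y)) :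
    EReal.exp (renyiDiv α W Q) ≤ EReal.exp (renyiDiv α W R) * l⁻¹ := by
  have hli : l⁻¹ ≠ 0 := ENNReal.inv_ne_zero.2 hl
  by_cases ht : α = ∞
  · subst ht
    rw [exp_renyiDiv_top, exp_renyiDiv_top]
    set e := essSup (fun y => (W : Measure Y).rnDeriv ((W : Measure Y) + (R : Measure Y)) y /
      (R : Measure Y).rnDeriv ((W : Measure Y) + (R : Measure Y)) y)
      ((W : Measure Y) + (R : Measure Y)) with he
    by_cases hL : e = ∞
    · rw [hL, ENNReal.top_mul hli]
      exact le_top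
    · rw [essSup_div_le_iff W Q (ENNReal.mul_ne_top hL (ENNReal.inv_ne_top.2 hl0))]
      have h1 := (essSup_div_le_iff W R hL).1 he.ge
      refine Measure.le_iff.2 fun B hB => ?_
      have h2 : (W : Measure Y) B = (W : Measure Y) (B ∩ A) := by
        refine le_antisymm ?_ (measure_mono Set.inter_subset_left)
        rw [← measure_inter_add_sdiff B hA]
        refine (add_le_add_right (measure_mono (t := Aᶜ) fun y hy => hy.2) _).trans ?_
        rw [hW, add_zero]
      have h3 := hle B
      rw [Measure.smul_apply, Measure.restrict_apply hB, smul_eq_mul] at h3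
      have h4 := h1 (B ∩ A)
      rw [Measure.smul_apply, smul_eq_mul] at h4 ⊢
      rw [h2]
      calc _ ≤ e * (R : Measure Y) (B ∩ A) := h4
        _ = e * l⁻¹ * (l * (R : Measure Y) (B ∩ A)) := by
          rw [mul_assoc, ← mul_assoc l⁻¹, ENNReal.inv_mul_cancel hl0 hl, one_mul]
        _ ≤ _ := by gcongr
  by_cases h1 : α = 1
  · subst h1
    have hlr : 0 < l.toReal := ENNReal.toReal_pos hl0 hl
    have h2 := linDiv_one_le hA hW hlr (by rwa [ENNReal.ofReal_toReal hl])
    rw [renyiDiv_one, renyiDiv_one]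
    by_cases hR : linDiv 1 (W : Measure Y) R = ∞
    · rw [hR, EReal.coe_ennreal_top, EReal.exp_top, ENNReal.top_mul hli]
      exact le_top
    · have hQ : linDiv 1 (W : Measure Y) Q ≠ ∞ :=
        ne_top_of_le_ne_top (by finiteness) (le_self_add.trans h2)
      have h3 := ENNReal.toReal_mono (by finiteness) h2
      rw [ENNReal.toReal_add hQ (by finiteness), ENNReal.toReal_add hR (by finiteness),
        ENNReal.toReal_ofReal', ENNReal.toReal_ofReal'] at h3
      rw [← ENNReal.exp_log l⁻¹, ← EReal.exp_add, EReal.exp_le_exp_iff, ENNReal.log_inv,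
        ENNReal.log_pos_real hl0 hl, ← EReal.coe_ennreal_toReal hQ, ← EReal.coe_ennreal_toReal hR]
      norm_cast
      rcases le_total 0 (Real.log l.toReal) with h | h
      · rw [max_eq_left h, max_eq_right (by linarith)] at h3
        linarith
      · rw [max_eq_right h, max_eq_left (by linarith)] at h3
        linarith
  · have ha : 0 < α.toReal := ENNReal.toReal_pos h0 ht
    have ha1 : α.toReal ≠ 1 := by
      rw [Ne, ENNReal.toReal_eq_one_iff]
      exact h1
    obtain ⟨ν, w, q, r, mw, mq, mr, ew, eq, er, h⟩ :=
      exists_densities_of_smul_restrict_le hA hW hle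
    rw [exp_renyiDiv_of_ne h0 h1 ht, exp_renyiDiv_of_ne h0 h1 ht, hellinger_eq ha mw mq ew eq,
      hellinger_eq ha mw mr ew er]
    have hm : Measurable fun y => w y ^ α.toReal * r y ^ (1 - α.toReal) := by fun_prop
    rcases lt_or_gt_of_ne ha1 with ha2 | ha2
    · have h2 : l ^ (1 - α.toReal) * ∫⁻ y, w y ^ α.toReal * r y ^ (1 - α.toReal) ∂ν ≤
          ∫⁻ y, w y ^ α.toReal * q y ^ (1 - α.toReal) ∂ν := by
        rw [← lintegral_const_mul _ hm]
        exact lintegral_mono_ae (h.mono fun y hy => le_rpow_mul_rpow_of_lt_one ha ha2 hy)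
      have h3 : (1 : ℝ) / (α.toReal - 1) = -(1 / (1 - α.toReal)) := by
        rw [← neg_sub 1 α.toReal, div_neg]
      have h4 : (0 : ℝ) < 1 - α.toReal := by linarith
      rw [h3, ENNReal.rpow_neg, ENNReal.rpow_neg, ← ENNReal.mul_inv (Or.inr hl) (Or.inr hl0)]
      refine ENNReal.inv_le_inv.2 (le_trans ?_ (ENNReal.rpow_le_rpow h2 (by positivity)))
      rw [ENNReal.mul_rpow_of_nonneg _ _ (by positivity), ← ENNReal.rpow_mul,
        mul_one_div_cancel h4.ne', ENNReal.rpow_one, mul_comm]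
    · have h2 : ∫⁻ y, w y ^ α.toReal * q y ^ (1 - α.toReal) ∂ν ≤
          l ^ (1 - α.toReal) * ∫⁻ y, w y ^ α.toReal * r y ^ (1 - α.toReal) ∂ν := by
        rw [← lintegral_const_mul _ hm]
        refine lintegral_mono_ae ?_
        filter_upwards [h, ae_density_ne_top mr er] with y hy hy2
          using rpow_mul_rpow_le_of_one_lt ha2 hl hy2 hy
      have h4 : 0 < α.toReal - 1 := by linarith
      refine (ENNReal.rpow_le_rpow h2 (by positivity)).trans_eq ?_
      rw [ENNReal.mul_rpow_of_nonneg _ _ (by positivity), ← ENNReal.rpow_mul, ← neg_sub, neg_mul,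
        mul_one_div_cancel h4.ne', ENNReal.rpow_neg_one, mul_comm]

/-- A set that carries `W` has probability at least `exp (-D(W‖Q))` under `Q`. -/
theorem one_le_exp_renyiDiv_mul {α : ℝ≥0∞} (h0 : α ≠ 0) {W Q : ProbabilityMeasure Y} {A : Set Y}
    (hA : MeasurableSet A) (hW : (W : Measure Y) Aᶜ = 0) (hD : renyiDiv α W Q < ⊤) :
    1 ≤ EReal.exp (renyiDiv α W Q) * (Q : Measure Y) A := by
  have hone : ∀ R : ProbabilityMeasure Y, 1 ≤ EReal.exp (renyiDiv α W R) := fun R =>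
    EReal.one_le_exp_iff.2 (renyiDiv_nonneg h0 W R)
  -- Conditioning `R` on `A` lowers the divergence by `-log R(A)`, and the lowered divergence is
  -- still nonnegative.
  have hpos : ∀ R : ProbabilityMeasure Y, (R : Measure Y) A ≠ 0 →
      1 ≤ EReal.exp (renyiDiv α W R) * (R : Measure Y) A := fun R hR => by
    have hR' : (R : Measure Y) A ≠ ∞ := measure_ne_top _ _
    have : IsProbabilityMeasure (((R : Measure Y) A)⁻¹ • (R : Measure Y).restrict A) :=
      ⟨by rw [Measure.smul_apply, Measure.restrict_apply_univ, smul_eq_mul,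
        ENNReal.inv_mul_cancel hR hR']⟩
    have h1 := exp_renyiDiv_le_mul_inv h0 (Q := ⟨_, this⟩) hA hW (ENNReal.inv_ne_zero.2 hR')
      (ENNReal.inv_ne_top.2 hR) le_rfl
    rw [inv_inv] at h1
    exact (hone _).trans h1
  refine hpos Q fun hQA => ?_
  set E := EReal.exp (renyiDiv α W Q) with hE
  have hEt : E ≠ ∞ := (EReal.exp_lt_top_iff.2 hD).ne
  have hE1 : 1 ≤ E := hone Q
  have hE0 : E ≠ 0 := (one_pos.trans_le hE1).ne'
  -- If `Q` gave `A` no mass, mixing in a portion `t` of `W` would give `A` mass exactly `t` and at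
  -- most double `E`. The case already proved then yields `1 ≤ 2 * E * t`, which the constant 4
  -- makes equal to one half.
  set t : ℝ≥0∞ := (4 * E)⁻¹ with ht
  have ht0 : t ≠ 0 := ENNReal.inv_ne_zero.2 (by finiteness)
  have ht2 : t ≤ 2⁻¹ := ENNReal.inv_le_inv.2 <| by
    calc (2 : ℝ≥0∞) ≤ 4 * 1 := by norm_num
      _ ≤ 4 * E := by gcongr
  have ht1 : t ≤ 1 := ht2.trans (by norm_num)
  have hs2 : 2⁻¹ ≤ 1 - t := by
    rw [← ENNReal.one_sub_inv_two]
    gcongr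
  have hWA : (W : Measure Y) A = 1 := by
    rw [← prob_compl_eq_zero_iff hA]
    exact hW
  have : IsProbabilityMeasure ((1 - t) • (Q : Measure Y) + t • (W : Measure Y)) :=
    ⟨by simp [tsub_add_cancel_of_le ht1]⟩
  let R : ProbabilityMeasure Y := ⟨_, this⟩
  have hRA : (R : Measure Y) A = t := by
    change ((1 - t) • (Q : Measure Y) + t • (W : Measure Y)) A = t
    simp [hQA, hWA]
  have h1 : EReal.exp (renyiDiv α W R) ≤ E * (1 - t)⁻¹ :=
    exp_renyiDiv_le_mul_inv h0 (A := Set.univ) MeasurableSet.univ (by simp)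
      (ne_of_gt (lt_of_lt_of_le (by simp) hs2)) (by finiteness)
      (by rw [Measure.restrict_univ]; exact Measure.le_add_right le_rfl)
  have h2 := hpos R (by rwa [hRA])
  rw [hRA] at h2
  have h3 : (1 - t)⁻¹ ≤ 2 := by
    rw [← inv_inv (2 : ℝ≥0∞)]
    exact ENNReal.inv_le_inv.2 hs2
  have h4 : (1 : ℝ≥0∞) ≤ 2⁻¹ := by
    calc (1 : ℝ≥0∞) ≤ EReal.exp (renyiDiv α W R) * t := h2
      _ ≤ E * 2 * t := by gcongr; exact h1.trans (by gcongr)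
      _ = (4 * E) * t * 2⁻¹ := by
        rw [show (4 : ℝ≥0∞) = 2 * 2 by norm_num, show (2 : ℝ≥0∞) * 2 * E * t * 2⁻¹ =
          E * 2 * t * (2 * 2⁻¹) by ring, ENNReal.mul_inv_cancel (by simp) (by simp), mul_one]
      _ = 2⁻¹ := by rw [ht, ENNReal.mul_inv_cancel (by simp [hE0]) (by finiteness), one_mul]
  exact absurd h4 (by norm_num)

/-! ### Properties of centers -/

lemma renyiRelRadius_mono {α : ℝ≥0∞} {𝒲 𝒱 : Set (ProbabilityMeasure Y)} (h : 𝒲 ⊆ 𝒱)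
    (Q : ProbabilityMeasure Y) : renyiRelRadius α 𝒲 Q ≤ renyiRelRadius α 𝒱 Q :=
  biSup_mono h

lemma renyiCapacity_mono {α : ℝ≥0∞} {𝒲 𝒱 : Set (ProbabilityMeasure Y)} (h : 𝒲 ⊆ 𝒱) :
    renyiCapacity α 𝒲 ≤ renyiCapacity α 𝒱 :=
  biSup_mono fun _ hP => ⟨fun W hW => h (hP.1 W hW), hP.2⟩

lemma exists_isRenyiCenter {α : ℝ≥0∞} (h0 : α ≠ 0) {𝒲 : Set (ProbabilityMeasure Y)}
    (hne : 𝒲.Nonempty) (hC : renyiCapacity α 𝒲 < ⊤) :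
    ∃ q, IsRenyiCenter α 𝒲 q ∧
      ∀ Q, renyiCapacity α 𝒲 + renyiDiv α q Q ≤ renyiRelRadius α 𝒲 Q := by
  obtain ⟨q, h1, h2⟩ := exists_renyiDiv_le_capacity h0 hne hC
  exact ⟨q, ⟨hC, le_antisymm (iSup₂_le h1) (renyiCapacity_le_renyiRelRadius h0 hne q)⟩, h2⟩

/-- The bound of van Erven and Harremoës together with the uniqueness of the center. -/
theorem IsRenyiCenter.capacity_add_le {α : ℝ≥0∞} (h0 : α ≠ 0) {𝒲 : Set (ProbabilityMeasure Y)}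
    (hne : 𝒲.Nonempty) {q : ProbabilityMeasure Y} (hq : IsRenyiCenter α 𝒲 q) :
    (∀ r, IsRenyiCenter α 𝒲 r → r = q) ∧
      ∀ Q, renyiCapacity α 𝒲 + renyiDiv α q Q ≤ renyiRelRadius α 𝒲 Q := by
  obtain ⟨s, -, hs⟩ := exists_isRenyiCenter h0 hne hq.1
  -- For a center `r` the radius equals the capacity, so the bound at `Q = r` leaves no room for a
  -- positive divergence once the finite capacity is cancelled.
  have key : ∀ r, IsRenyiCenter α 𝒲 r → s = r := fun r hr => by
    refine eq_of_renyiDiv_eq_zero h0 (le_antisymm ?_ (renyiDiv_nonneg h0 s r))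
    have h1 := hs r
    rw [hr.2] at h1
    have hb : renyiCapacity α 𝒲 ≠ ⊥ :=
      ne_of_gt (EReal.bot_lt_zero.trans_le (renyiCapacity_nonneg h0 hne))
    lift renyiCapacity α 𝒲 to ℝ using ⟨hr.1.ne, hb⟩ with c
    by_contra! h2
    have h3 := EReal.add_lt_add_left_coe h2 c
    rw [add_zero] at h3
    exact h3.not_ge h1
  exact ⟨fun r hr => (key r hr).symm.trans (key q hq), key q hq ▸ hs⟩

lemma IsRenyiCenter.renyiDiv_le {α : ℝ≥0∞} {𝒲 : Set (ProbabilityMeasure Y)}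
    {q W : ProbabilityMeasure Y} (hq : IsRenyiCenter α 𝒲 q) (hW : W ∈ 𝒲) :
    renyiDiv α W q ≤ renyiCapacity α 𝒲 :=
  hq.2 ▸ le_iSup₂ (f := fun W (_ : W ∈ 𝒲) => renyiDiv α W q) W hW

/-! ### Capacity of a union -/

/-- If a finite measure dominates the centers of the pieces, scaled by the exponentials of the
capacities, then it bounds the radius of the union. -/
theorem renyiRelRadius_iUnion_le {T : Type*} {α : ℝ≥0∞} (h0 : α ≠ 0)
    {𝒲 : T → Set (ProbabilityMeasure Y)} (hne : ∀ i, (𝒲 i).Nonempty)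
    {q : T → ProbabilityMeasure Y} (hq : ∀ i, IsRenyiCenter α (𝒲 i) (q i)) {ν : Measure Y}
    (hν : ν Set.univ ≠ ∞) (hle : ∀ i, EReal.exp (renyiCapacity α (𝒲 i)) • (q i : Measure Y) ≤ ν)
    {Q : ProbabilityMeasure Y} (hQ : (Q : Measure Y) = (ν Set.univ)⁻¹ • ν) :
    renyiRelRadius α (⋃ i, 𝒲 i) Q ≤ ENNReal.log (ν Set.univ) := by
  refine iSup₂_le fun W hW => ?_
  obtain ⟨i, hi⟩ := Set.mem_iUnion.1 hW
  set e := EReal.exp (renyiCapacity α (𝒲 i)) with he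
  have he0 : e ≠ 0 := (one_pos.trans_le
    (EReal.one_le_exp_iff.2 (renyiCapacity_nonneg h0 (hne i)))).ne'
  have het : e ≠ ∞ := (EReal.exp_lt_top_iff.2 (hq i).1).ne
  have hN : ν Set.univ ≠ 0 := fun h => by
    have := hle i Set.univ
    rw [h, Measure.smul_apply, measure_univ, smul_eq_mul, mul_one] at this
    exact he0 (nonpos_iff_eq_zero.1 this)
  have h1 := exp_renyiDiv_le_mul_inv h0 (W := W) (Q := Q) (R := q i) (A := Set.univ)
    (l := (ν Set.univ)⁻¹ * e) MeasurableSet.univ (by simp)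
    (mul_ne_zero (ENNReal.inv_ne_zero.2 hν) he0)
    (ENNReal.mul_ne_top (ENNReal.inv_ne_top.2 hN) het) (by
      rw [Measure.restrict_univ, hQ, mul_smul]
      refine Measure.le_iff.2 fun B _ => ?_
      exact mul_le_mul_right (hle i B) (ν Set.univ)⁻¹)
  have h2 : EReal.exp (renyiDiv α W (q i)) ≤ e := EReal.exp_le_exp_iff.2 ((hq i).renyiDiv_le hi)
  rw [← EReal.exp_le_exp_iff, ENNReal.exp_log]
  calc _ ≤ e * ((ν Set.univ)⁻¹ * e)⁻¹ := h1.trans (by gcongr)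
    _ = ν Set.univ := by
      rw [ENNReal.mul_inv (Or.inr het) (Or.inr he0), inv_inv, mul_left_comm,
        ENNReal.mul_inv_cancel he0 het, mul_one]

/-- The normalisation of a finite nonzero measure. -/
lemma exists_eq_inv_smul {ν : Measure Y} (h0 : ν Set.univ ≠ 0) (ht : ν Set.univ ≠ ∞) :
    ∃ Q : ProbabilityMeasure Y, (Q : Measure Y) = (ν Set.univ)⁻¹ • ν :=
  ⟨⟨(ν Set.univ)⁻¹ • ν, ⟨by
    rw [Measure.smul_apply, smul_eq_mul, ENNReal.inv_mul_cancel h0 ht]⟩⟩, rfl⟩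

/-- Pairwise singular finite families are carried by disjoint measurable sets. -/
lemma exists_disjoint_carriers {T : Type*} [Countable T] {μ : T → Measure Y}
    (h : ∀ i j, i ≠ j → μ i ⟂ₘ μ j) :
    ∃ A : T → Set Y, (∀ i, MeasurableSet (A i)) ∧ (∀ i, μ i (A i)ᶜ = 0) ∧
      Pairwise (Function.onFun Disjoint A) := by
  choose S hS h1 h2 using h
  -- The separating sets for `(i, j)` and `(j, i)` are chosen independently, so the carrier of `i`
  -- must avoid the null set from the first choice and lie in the one from the second; countability
  -- keeps the removed part null.
  refine ⟨fun i => ⋂ j, ⋂ hij : i ≠ j, (S i j hij)ᶜ ∩ S j i hij.symm, fun i => ?_, fun i => ?_,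
    fun i j hij => ?_⟩
  · exact MeasurableSet.iInter fun j => MeasurableSet.iInter fun hij =>
      (hS i j hij).compl.inter (hS j i hij.symm)
  · simp only [Set.compl_iInter, Set.compl_inter, compl_compl]
    refine measure_iUnion_null fun j => measure_iUnion_null fun hij => ?_
    exact measure_union_null (h1 i j hij) (h2 j i hij.symm)
  · refine Set.disjoint_left.2 fun y hi hj => ?_
    have h3 := (Set.mem_iInter₂.1 hi j hij).1
    exact h3 (Set.mem_iInter₂.1 hj i hij.symm).2

section Union

variable {T : Type*} {α : ℝ≥0∞} {𝒲 : T → Set (ProbabilityMeasure Y)} {q : T → ProbabilityMeasure Y}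

lemma one_le_exp_renyiCapacity (h0 : α ≠ 0) {𝒱 : Set (ProbabilityMeasure Y)} (hne : 𝒱.Nonempty) :
    1 ≤ EReal.exp (renyiCapacity α 𝒱) :=
  EReal.one_le_exp_iff.2 (renyiCapacity_nonneg h0 hne)

lemma nonempty_iUnion_of_forall [Nonempty T] (hne : ∀ i, (𝒲 i).Nonempty) :
    (⋃ i, 𝒲 i).Nonempty :=
  Set.nonempty_iUnion.2 ⟨Classical.arbitrary T, hne _⟩

/-- The sum of the centers of the pieces, scaled by the exponentials of the capacities. -/
def centerSum (α : ℝ≥0∞) (𝒲 : T → Set (ProbabilityMeasure Y)) (q : T → ProbabilityMeasure Y) :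
    Measure Y :=
  Measure.sum fun i => EReal.exp (renyiCapacity α (𝒲 i)) • (q i : Measure Y)

lemma centerSum_univ : centerSum α 𝒲 q Set.univ = ∑' i, EReal.exp (renyiCapacity α (𝒲 i)) := by
  rw [centerSum, Measure.sum_apply _ MeasurableSet.univ]
  simp

lemma smul_le_centerSum (i : T) :
    EReal.exp (renyiCapacity α (𝒲 i)) • (q i : Measure Y) ≤ centerSum α 𝒲 q :=
  Measure.le_sum (fun i => EReal.exp (renyiCapacity α (𝒲 i)) • (q i : Measure Y)) i

lemma smul_add_smul_le_centerSum {i j : T} (hij : i ≠ j) :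
    EReal.exp (renyiCapacity α (𝒲 i)) • (q i : Measure Y) +
      EReal.exp (renyiCapacity α (𝒲 j)) • (q j : Measure Y) ≤ centerSum α 𝒲 q := by
  classical
  refine Measure.le_iff.2 fun B hB => ?_
  rw [centerSum, Measure.sum_apply _ hB, Measure.add_apply, ← Finset.sum_pair
    (f := fun i => (EReal.exp (renyiCapacity α (𝒲 i)) • (q i : Measure Y)) B) hij]
  exact ENNReal.sum_le_tsum _

lemma univ_ne_zero_of_smul_le [Nonempty T] (h0 : α ≠ 0) (hne : ∀ i, (𝒲 i).Nonempty) {ν : Measure Y}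
    (hle : ∀ i, EReal.exp (renyiCapacity α (𝒲 i)) • (q i : Measure Y) ≤ ν) :
    ν Set.univ ≠ 0 := fun h => by
  let i := Classical.arbitrary T
  have h1 := hle i Set.univ
  rw [h, Measure.smul_apply, measure_univ, smul_eq_mul, mul_one] at h1
  exact absurd ((one_le_exp_renyiCapacity h0 (hne i)).trans h1) (by simp)

/-- The dominating measure is left free so that the same bound serves for the full sum of scaled
centers and for that sum with a common part removed. -/
lemma renyiCapacity_iUnion_le [Nonempty T] (h0 : α ≠ 0) (hne : ∀ i, (𝒲 i).Nonempty)
    (hq : ∀ i, IsRenyiCenter α (𝒲 i) (q i)) {ν : Measure Y}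
    (hle : ∀ i, EReal.exp (renyiCapacity α (𝒲 i)) • (q i : Measure Y) ≤ ν) :
    renyiCapacity α (⋃ i, 𝒲 i) ≤ ENNReal.log (ν Set.univ) := by
  by_cases hν : ν Set.univ = ∞
  · rw [hν, ENNReal.log_top]
    exact le_top
  · obtain ⟨Q, hQ⟩ := exists_eq_inv_smul (univ_ne_zero_of_smul_le h0 hne hle) hν
    exact (renyiCapacity_le_renyiRelRadius h0 (nonempty_iUnion_of_forall hne) Q).trans
      (renyiRelRadius_iUnion_le h0 hne hq hν hle hQ)

lemma tsum_exp_ne_top [Finite T] (hfin : ∀ i, renyiCapacity α (𝒲 i) < ⊤) :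
    ∑' i, EReal.exp (renyiCapacity α (𝒲 i)) ≠ ∞ := by
  have := Fintype.ofFinite T
  rw [tsum_fintype]
  exact ENNReal.sum_ne_top.2 fun i _ => (EReal.exp_lt_top_iff.2 (hfin i)).ne

/-- Sets with pairwise singular centers are in the worst position: the exponential of the capacity
is additive. -/
theorem renyiCapacity_iUnion_of_mutuallySingular [Nonempty T] [Finite T] (h0 : α ≠ 0)
    (hne : ∀ i, (𝒲 i).Nonempty) (hq : ∀ i, IsRenyiCenter α (𝒲 i) (q i))
    (hs : ∀ i j, i ≠ j → (q i : Measure Y) ⟂ₘ (q j : Measure Y)) :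
    renyiCapacity α (⋃ i, 𝒲 i) = ENNReal.log (∑' i, EReal.exp (renyiCapacity α (𝒲 i))) ∧
      renyiCapacity α (⋃ i, 𝒲 i) < ⊤ := by
  have hU := nonempty_iUnion_of_forall hne
  have hle := renyiCapacity_iUnion_le h0 hne hq fun i => smul_le_centerSum (q := q) i
  rw [centerSum_univ] at hle
  have hlt : renyiCapacity α (⋃ i, 𝒲 i) < ⊤ :=
    hle.trans_lt (ENNReal.log_lt_top_iff.2 (tsum_exp_ne_top fun i => (hq i).1).lt_top)
  refine ⟨le_antisymm hle ?_, hlt⟩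
  obtain ⟨Q, hQ, -⟩ := exists_isRenyiCenter h0 hU hlt
  obtain ⟨A, mA, hA, hdis⟩ := exists_disjoint_carriers hs
  -- The bound C_i + D(q_i‖Q) ≤ C, exponentiated and combined with exp (-D(q_i‖Q)) ≤ Q(A_i).
  have key : ∀ i, EReal.exp (renyiCapacity α (𝒲 i)) ≤
      EReal.exp (renyiCapacity α (⋃ i, 𝒲 i)) * (Q : Measure Y) (A i) := fun i => by
    have h1 : renyiCapacity α (𝒲 i) + renyiDiv α (q i) Q ≤ renyiCapacity α (⋃ i, 𝒲 i) :=
      (((hq i).capacity_add_le h0 (hne i)).2 Q).trans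
        ((renyiRelRadius_mono (Set.subset_iUnion 𝒲 i) Q).trans_eq hQ.2)
    have h2 : renyiDiv α (q i) Q < ⊤ := by
      refine lt_of_le_of_lt ?_ hlt
      refine le_trans ?_ h1
      exact le_add_of_nonneg_left (renyiCapacity_nonneg h0 (hne i))
    calc EReal.exp (renyiCapacity α (𝒲 i))
        ≤ EReal.exp (renyiCapacity α (𝒲 i)) *
          (EReal.exp (renyiDiv α (q i) Q) * (Q : Measure Y) (A i)) :=
          le_mul_of_one_le_right' (one_le_exp_renyiDiv_mul h0 (mA i) (hA i) h2)
      _ = EReal.exp (renyiCapacity α (𝒲 i) + renyiDiv α (q i) Q) * (Q : Measure Y) (A i) := by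
          rw [EReal.exp_add, mul_assoc]
      _ ≤ _ := by
          gcongr
  rw [← EReal.exp_le_exp_iff, ENNReal.exp_log]
  calc _ ≤ ∑' i, EReal.exp (renyiCapacity α (⋃ i, 𝒲 i)) * (Q : Measure Y) (A i) :=
        ENNReal.tsum_le_tsum key
    _ = EReal.exp (renyiCapacity α (⋃ i, 𝒲 i)) * (Q : Measure Y) (⋃ i, A i) := by
        rw [ENNReal.tsum_mul_left, measure_iUnion hdis mA]
    _ ≤ _ := mul_le_of_le_one_right' prob_le_one

/-- If two centers are not singular, then the upper bound on the capacity of a union is strict. -/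
theorem renyiCapacity_iUnion_lt [Nonempty T] (h0 : α ≠ 0) (hne : ∀ i, (𝒲 i).Nonempty)
    (hq : ∀ i, IsRenyiCenter α (𝒲 i) (q i))
    (hsum : ∑' i, EReal.exp (renyiCapacity α (𝒲 i)) ≠ ∞) {i j : T} (hij : i ≠ j)
    (hs : ¬ (q i : Measure Y) ⟂ₘ (q j : Measure Y)) :
    renyiCapacity α (⋃ i, 𝒲 i) < ENNReal.log (∑' i, EReal.exp (renyiCapacity α (𝒲 i))) := by
  rw [Measure.mutuallySingular_iff_disjoint, disjoint_iff] at hs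
  -- The lattice infimum is the mass that the two centers share; it is nonzero exactly because they
  -- are not singular.
  set η : Measure Y := (q i : Measure Y) ⊓ (q j : Measure Y) with hη
  have hη0 : η Set.univ ≠ 0 := fun h => hs (Measure.measure_univ_eq_zero.1 h)
  have hsm : ∀ k, (q k : Measure Y) ≤ EReal.exp (renyiCapacity α (𝒲 k)) • (q k : Measure Y) :=
    fun k => Measure.le_iff.2 fun B _ => by
      rw [Measure.smul_apply, smul_eq_mul]
      exact le_mul_of_one_le_left' (one_le_exp_renyiCapacity h0 (hne k))
  have hηi : η ≤ (q i : Measure Y) := inf_le_left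
  have hηj : η ≤ (q j : Measure Y) := inf_le_right
  have : IsFiniteMeasure η := isFiniteMeasure_of_le _ hηi
  have hsub : centerSum α 𝒲 q - η + η = centerSum α 𝒲 q :=
    Measure.sub_add_cancel_of_le ((hηi.trans (hsm i)).trans (smul_le_centerSum i))
  have hle : ∀ k, EReal.exp (renyiCapacity α (𝒲 k)) • (q k : Measure Y) ≤
      centerSum α 𝒲 q - η := fun k => by
    -- At least one of `i`, `j` differs from `k`, and its summand alone is large enough to contain
    -- `η`.
    have h1 : EReal.exp (renyiCapacity α (𝒲 k)) • (q k : Measure Y) + η ≤ centerSum α 𝒲 q := by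
      by_cases hk : k = i
      · subst hk
        exact (add_le_add le_rfl (hηj.trans (hsm j))).trans (smul_add_smul_le_centerSum hij)
      · exact (add_le_add le_rfl (hηi.trans (hsm i))).trans (smul_add_smul_le_centerSum hk)
    rw [← hsub] at h1
    refine Measure.le_iff.2 fun B _ => ?_
    have h2 := h1 B
    rw [Measure.add_apply, Measure.add_apply] at h2
    exact (ENNReal.add_le_add_iff_right (measure_ne_top η B)).1 h2
  refine (renyiCapacity_iUnion_le h0 hne hq hle).trans_lt (ENNReal.log_lt_log ?_)
  have h3 := congrArg (fun μ : Measure Y => μ Set.univ) hsub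
  simp only [Measure.add_apply, centerSum_univ] at h3
  rw [← h3] at hsum ⊢
  exact ENNReal.lt_add_right (ENNReal.add_ne_top.1 hsum).1 hη0

end Union

end

/-! ### The theorem -/

theorem mainTheorem8 {Y : Type*} [MeasurableSpace Y] {T : Type*} [Nonempty T]
    (α : ℝ≥0∞) (hα : α ≠ 0) (𝒲 : T → Set (ProbabilityMeasure Y))
    (hne : ∀ i, (𝒲 i).Nonempty) (hfin : ∀ i, renyiCapacity α (𝒲 i) < ⊤) :
    -- the two bounds
    (⨆ i, renyiCapacity α (𝒲 i)) ≤ renyiCapacity α (⋃ i, 𝒲 i) ∧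
    renyiCapacity α (⋃ i, 𝒲 i) ≤ ENNReal.log (∑' i, EReal.exp (renyiCapacity α (𝒲 i))) ∧
    -- the center of each component exists and is unique
    (∀ i, ∃! q, IsRenyiCenter α (𝒲 i) q) ∧
    -- below, `q i` is the center of the `i`-th component
    ∀ q : T → ProbabilityMeasure Y, (∀ i, IsRenyiCenter α (𝒲 i) (q i)) →
      -- equality in the lower bound
      (∀ i, renyiCapacity α (𝒲 i) = renyiCapacity α (⋃ j, 𝒲 j) ↔
        renyiRelRadius α (⋃ j, 𝒲 j) (q i) ≤ renyiCapacity α (𝒲 i)) ∧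
      -- in that case the union has the unique center `q i`
      (∀ i, renyiCapacity α (𝒲 i) = renyiCapacity α (⋃ j, 𝒲 j) →
        ∀ r, IsRenyiCenter α (⋃ j, 𝒲 j) r ↔ r = q i) ∧
      -- equality in the upper bound
      (renyiCapacity α (⋃ i, 𝒲 i) = ENNReal.log (∑' i, EReal.exp (renyiCapacity α (𝒲 i))) ∧
          renyiCapacity α (⋃ i, 𝒲 i) < ⊤ ↔
        Finite T ∧ ∀ i j, i ≠ j → (q i : Measure Y) ⟂ₘ (q j : Measure Y)) ∧
      -- in that case the union has a unique center, a mixture of the centers `q i`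
      (Finite T → (∀ i j, i ≠ j → (q i : Measure Y) ⟂ₘ (q j : Measure Y)) →
        (∃! r, IsRenyiCenter α (⋃ i, 𝒲 i) r) ∧
        ∀ r, IsRenyiCenter α (⋃ i, 𝒲 i) r →
          (r : Measure Y) = (∑' j, EReal.exp (renyiCapacity α (𝒲 j)))⁻¹ •
            Measure.sum fun i => EReal.exp (renyiCapacity α (𝒲 i)) • (q i : Measure Y)) := by
  have hU := nonempty_iUnion_of_forall hne
  have hex : ∀ {𝒱 : Set (ProbabilityMeasure Y)}, 𝒱.Nonempty → renyiCapacity α 𝒱 < ⊤ →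
      ∃! q, IsRenyiCenter α 𝒱 q := fun h1 h2 => by
    obtain ⟨q, hq, -⟩ := exists_isRenyiCenter hα h1 h2
    exact ⟨q, hq, (hq.capacity_add_le hα h1).1⟩
  have hmono : ∀ i, renyiCapacity α (𝒲 i) ≤ renyiCapacity α (⋃ j, 𝒲 j) := fun i =>
    renyiCapacity_mono (Set.subset_iUnion 𝒲 i)
  have hcen : ∀ {q : T → ProbabilityMeasure Y}, (∀ i, IsRenyiCenter α (𝒲 i) (q i)) →
      ∀ i, renyiCapacity α (𝒲 i) = renyiCapacity α (⋃ j, 𝒲 j) →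
        ∀ r, IsRenyiCenter α (⋃ j, 𝒲 j) r ↔ r = q i := fun {q} hq i hi => by
    -- When the capacities agree, a center of the union has radius at most that capacity on the
    -- smaller set too, so it is a center there; uniqueness on the smaller set identifies it.
    have h1 : ∀ r, IsRenyiCenter α (⋃ j, 𝒲 j) r → r = q i := fun r hr => by
      refine ((hq i).capacity_add_le hα (hne i)).1 r ⟨hfin i, le_antisymm ?_ ?_⟩
      · rw [hi, ← hr.2]
        exact renyiRelRadius_mono (Set.subset_iUnion 𝒲 i) r
      · exact renyiCapacity_le_renyiRelRadius hα (hne i) r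
    refine fun r => ⟨h1 r, fun hr => ?_⟩
    obtain ⟨s, hs, -⟩ := hex hU (hi ▸ hfin i)
    rwa [hr, ← h1 s hs]
  refine ⟨iSup_le hmono, ?_, fun i => hex (hne i) (hfin i), fun q hq =>
    ⟨fun i => ⟨fun hi => ?_, fun hi => ?_⟩, hcen hq, ⟨fun ⟨h1, h2⟩ => ?_, fun ⟨h1, h2⟩ =>
      renyiCapacity_iUnion_of_mutuallySingular hα hne hq h2⟩, fun h1 h2 => ?_⟩⟩
  · choose q hq using fun i => (hex (hne i) (hfin i)).exists
    rw [← centerSum_univ (q := q)]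
    exact renyiCapacity_iUnion_le hα hne hq smul_le_centerSum
  · rw [((hcen hq i hi (q i)).2 rfl).2, hi]
  · exact le_antisymm (hmono i) ((renyiCapacity_le_renyiRelRadius hα hU (q i)).trans hi)
  · have hsum : ∑' i, EReal.exp (renyiCapacity α (𝒲 i)) ≠ ∞ := fun h => by
      rw [h1, h] at h2
      exact h2.ne ENNReal.log_top
    refine ⟨?_, fun i j hij => by_contra fun hs =>
      (renyiCapacity_iUnion_lt hα hne hq hsum hij hs).ne h1⟩
    -- Every summand is at least one, so a finite sum leaves room for finitely many indices only.
    refine Set.finite_univ_iff.1 ((ENNReal.finite_const_le_of_tsum_ne_top hsum one_ne_zero).subset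
      fun i _ => one_le_exp_renyiCapacity hα (hne i))
  · obtain ⟨h3, h4⟩ := renyiCapacity_iUnion_of_mutuallySingular hα hne hq h2
    refine ⟨hex hU h4, fun r hr => ?_⟩
    have hsum := tsum_exp_ne_top hfin
    rw [← centerSum_univ (q := q)] at hsum h3 ⊢
    obtain ⟨Q, hQ⟩ := exists_eq_inv_smul
      (univ_ne_zero_of_smul_le (q := q) hα hne smul_le_centerSum) hsum
    -- The normalised sum of scaled centers has radius at most the logarithm of the total mass,
    -- which `h3` identifies with the capacity. It is therefore the center.
    have h5 := renyiRelRadius_iUnion_le hα hne hq hsum smul_le_centerSum hQ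
    rw [← h3] at h5
    rw [← (hr.capacity_add_le hα hU).1 Q
      ⟨h4, le_antisymm h5 (renyiCapacity_le_renyiRelRadius hα hU Q)⟩, hQ]
    rfl
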